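/- Let $k$ be an algebraically closed field, $X$ a smooth integral separated surface of finite type over $k$, $D\subset X$ a prime divisor, $U=X-D$, $U'\to U$ a (connected, finite étale) Galois cover, and $\pi:X'\to X$ the normalisation of $X$ in $U'$. Let $x\in D$ be a closed point and $x'\in\pi^{-1}(x)$ a point at which $X'$ is smooth over $k$. Let $A=\widehat{\mathcal O}_{X,x}$ and $R=\widehat{\mathcal O}_{X',x'}$ be the completed local rings, $X_{\hat x}=\operatorname{Spec}A$, $X'_{\hat x'}=\operatorname{Spec}R$; the map $A\to R$ is induced by $\pi$. Let $g\in\mathfrak m_A$ be such that $D_{\hat x}:=D\times_X X_{\hat x}=V(g)$, and let $h\in\mathfrak m_A$ be such that $C=V(h)\subset X_{\hat x}$ is a smooth curve (i.e. $A/hA$ is regular of dimension $1$) which has no common component with $D_{\hat x}$. Let $K$ be the fraction field of $A$, $L=K\otimes_A R$, and let $\mathfrak C(R/A)=\{y\in L : \operatorname{Tr}_{L/K}(yb)\in A \text{ for all } b\in R\}$ be the Dedekind codifferent. Consider finite sequences of successive blowups at closed points, starting from $X'_{\hat x'}$. The number of blowup stages of such a sequence is the length of the longest chain of blowups in it in which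 each blowup after the first is centred at a point of the exceptional divisor created by the preceding one. The sequence resolves $C':=X'_{\hat x'}\times_{X_{\hat x}}C=\operatorname{Spec}(R/hR)$ if the strict transform of $C'$ on the last surface is regular. Let $M_C$ be the least number of blowup stages of a sequence that resolves $C'$. Then the $A$-module $\mathfrak C(R/A)/R$ is finitely generated and annihilated by some power of $g$, the intersection number $(C.D_{\hat x})=\operatorname{length}_A A/(g,h)$ is finite, and $$M_C\le r\cdot s\cdot (C.D_{\hat x}),$$ where $r$ is the smallest integer $\ge 0$ with $g^rA\subseteq\operatorname{Ann}_A(\mathfrak C(R/A)/R)$ and $s$ is the smallest number of generators of $\mathfrak C(R/A)/R$ as an $A$-module. In particular $C'$ is resolved by finitely many blowups at closed points. -/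

import Mathlib

universe u

open CategoryTheory CategoryTheory.Limits AlgebraicGeometry IsLocalRing
open scoped TensorProduct

noncomputable section

/-! ## Completion of a local homomorphism -/

section Completion

variable {O O' : Type*} [CommRing O] [IsLocalRing O] [CommRing O'] [IsLocalRing O']

theorem map_maximalIdeal_pow_le (φ : O →+* O') [IsLocalHom φ] (n : ℕ) :
    (maximalIdeal O ^ n).map φ ≤ maximalIdeal O' ^ n := by
  rw [Ideal.map_pow]
  exact Ideal.pow_right_mono (((local_hom_TFAE φ).out 0 2).mp ‹_›) n

/-- The composite `Ô → O / 𝔪ⁿ → O' / 𝔪'ⁿ`. -/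
def completionMapLevel (φ : O →+* O') [IsLocalHom φ] (n : ℕ) :
    AdicCompletion (maximalIdeal O) O →+* O' ⧸ maximalIdeal O' ^ n :=
  (Ideal.quotientMap (maximalIdeal O' ^ n) φ
      (Ideal.map_le_iff_le_comap.mp (map_maximalIdeal_pow_le φ n))).comp
    (AdicCompletion.evalₐ (maximalIdeal O) n : _ →+* O ⧸ maximalIdeal O ^ n)

theorem completionMapLevel_compat (φ : O →+* O') [IsLocalHom φ] {m n : ℕ} (hle : m ≤ n) :
    (Ideal.Quotient.factorPow (maximalIdeal O') hle).comp (completionMapLevel φ n) =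
      completionMapLevel φ m := by
  ext x
  obtain ⟨y, rfl⟩ := AdicCompletion.mk_surjective (maximalIdeal O) O x
  simp only [completionMapLevel, RingHom.comp_apply, RingHom.coe_coe, AdicCompletion.evalₐ_mk,
    Ideal.quotientMap_mk, Ideal.Quotient.factorPow, Ideal.Quotient.factor_mk]
  rw [Ideal.Quotient.eq, ← map_sub]
  refine Ideal.map_le_iff_le_comap.mp (map_maximalIdeal_pow_le φ m) ?_
  have h := y.2 hle
  rw [SModEq.sub_mem] at h
  simpa using neg_mem h

/-- The map `Ô → Ô'` induced on completions (at the maximal ideals) by a local homomorphism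
`φ : O → O'` of local rings: the inverse limit of the maps `O / 𝔪ⁿ → O' / 𝔪'ⁿ`. -/
def completionMap (φ : O →+* O') [IsLocalHom φ] :
    AdicCompletion (maximalIdeal O) O →+* AdicCompletion (maximalIdeal O') O' :=
  AdicCompletion.liftRingHom (maximalIdeal O') (completionMapLevel φ)
    (completionMapLevel_compat φ)

/-- The completed map extends `φ`. -/
theorem completionMap_algebraMap (φ : O →+* O') [IsLocalHom φ] (a : O) :
    completionMap φ (algebraMap O _ a) = algebraMap O' _ (φ a) := by
  apply AdicCompletion.ext_evalₐ
  intro n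
  rw [completionMap, AdicCompletion.evalₐ_liftRingHom]
  simp only [completionMapLevel, RingHom.comp_apply, RingHom.coe_coe, AlgHom.commutes]
  rfl

end Completion

/-! ## Dedekind codifferent -/

section Codifferent

variable (A K R : Type*) [CommRing A] [CommRing K] [Algebra A K] [CommRing R] [Algebra A R]

/-- The Dedekind codifferent `𝔠(R/A) = {x ∈ L | Tr_{L/K}(x b) ∈ A for all b ∈ R}`, where `K` is the
total ring of fractions of `A` and `L = K ⊗_A R`, as an `A`-module. -/
def dedekindCodifferent : Submodule A (K ⊗[A] R) where
  carrier := {x | ∀ b : R,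
    Algebra.trace K (K ⊗[A] R) (x * (1 ⊗ₜ[A] b)) ∈ (algebraMap A K).range}
  zero_mem' b := by simp
  add_mem' {x y} hx hy b := by
    rw [add_mul, map_add]
    exact add_mem (hx b) (hy b)
  smul_mem' a x hx b := by
    obtain ⟨c, hc⟩ := hx b
    refine ⟨a * c, ?_⟩
    rw [smul_mul_assoc, ← algebraMap_smul K a (x * _), map_smul, ← hc, smul_eq_mul, map_mul]

/-- The image of `R` in `L = K ⊗_A R`. -/
def imageInTotal : Submodule A (K ⊗[A] R) :=
  LinearMap.range (Algebra.TensorProduct.includeRight : R →ₐ[A] K ⊗[A] R).toLinearMap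

/-- The `A`-module `𝔠(R/A) / R`. -/
def CodifferentQuotient : Type _ :=
  dedekindCodifferent A K R ⧸ (imageInTotal A K R).submoduleOf (dedekindCodifferent A K R)

instance : AddCommGroup (CodifferentQuotient A K R) :=
  inferInstanceAs (AddCommGroup (dedekindCodifferent A K R ⧸
    (imageInTotal A K R).submoduleOf (dedekindCodifferent A K R)))

instance : Module A (CodifferentQuotient A K R) :=
  inferInstanceAs (Module A (dedekindCodifferent A K R ⧸
    (imageInTotal A K R).submoduleOf (dedekindCodifferent A K R)))

variable {A}

/-- The exponents `n` for which `gⁿ A ⊆ Ann_A(𝔠(R/A) / R)`. -/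
def annihilatingExponents (g : A) : Set ℕ :=
  {n | Ideal.span {g ^ n} ≤ Module.annihilator A (CodifferentQuotient A K R)}

/-- The smallest `n` with `gⁿ A ⊆ Ann_A(𝔠(R/A) / R)`. -/
def leastExponent (g : A) : ℕ := sInf (annihilatingExponents K R g)

variable (A)

/-- The smallest number of generators of `𝔠(R/A) / R` as an `A`-module. -/
def codifferentGenerators : ℕ :=
  (⊤ : Submodule A (CodifferentQuotient A K R)).spanFinrank

end Codifferent

/-! ## Blowup sequences at closed points of a local surface

Let `R` be a regular local ring of dimension two with fraction field `K`, and consider iterated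
blowups of `Spec R` at closed points. All the surfaces `Y` that occur are integral, separated and
birational over `Spec R`, so a closed point of `Y` is the same thing as its local ring, regarded as
a subring of `K` that contains `R`. Every closed point of such a `Y` lies over the closed point
of `Spec R`. -/

section Blowup

/-- A local ring between `R` and `K`: a point of a birational model of `Spec R`. -/
structure LocalPoint (R K : Type*) [CommRing R] [CommRing K] [Algebra R K] where
  /-- the local ring -/
  ring : Subalgebra R K
  [isLocalRing : IsLocalRing ring]

attribute [instance] LocalPoint.isLocalRing

variable {R K : Type*} [CommRing R] [CommRing K] [Algebra R K]

/-- The coordinate ring `S[𝔪/t] ⊆ K`, for `S` the local ring of `P` with maximal ideal `𝔪`, of the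
affine chart belonging to `t` of the blowup of `Spec S` at its closed point. -/
def blowupChart (P : LocalPoint R K) (t : K) : Subalgebra R K :=
  Algebra.adjoin R ((P.ring : Set K) ∪ {b | ∃ a ∈ maximalIdeal P.ring, b * t = a})

/-- `P'` is a closed point of the exceptional divisor of the blowup of (a surface at) the closed
point `P`: for some nonzero `t ∈ 𝔪_P`, its local ring is the localisation of `S[𝔪/t]` at a maximal
ideal `q` that contains the equation `t` of the exceptional divisor. -/
def IsOnExceptionalDivisor (P P' : LocalPoint R K) : Prop :=
  ∃ t : P.ring, t ∈ maximalIdeal P.ring ∧ IsUnit (t : K) ∧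
    ∃ q : Ideal (blowupChart P (t : K)), q.IsMaximal ∧ (∃ c ∈ q, (c : K) = t) ∧
      (P'.ring : Set K) =
        {x | ∃ a b : blowupChart P (t : K), b ∉ q ∧ x * (b : K) = a}

/-- The closed points of the surface obtained from `Spec R` by blowing up the points of `l`
(a blowup sequence): the closed point of `Spec R` and all closed points of the exceptional
divisors produced, except those that have themselves been blown up. -/
def closedPointsAfter (l : List (LocalPoint R K)) : Set (LocalPoint R K) :=
  {P | (P.ring = ⊥ ∨ ∃ Q ∈ l, IsOnExceptionalDivisor Q P) ∧ P ∉ l}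

/-- `l` lists (the last one first) the centres of a finite sequence of successive blowups at closed
points, starting from `Spec R`: each centre is a closed point of the surface obtained
so far. -/
inductive IsBlowupSequence : List (LocalPoint R K) → Prop
  | nil : IsBlowupSequence []
  | cons {l : List (LocalPoint R K)} {P : LocalPoint R K} :
      IsBlowupSequence l → P ∈ closedPointsAfter l → IsBlowupSequence (P :: l)

/-- The number of blowup stages of a blowup sequence: the length of the longest sequence of
successive blowups, each but the first at a point of the new exceptional divisor (the one created
by its predecessor). -/
def blowupStages (l : List (LocalPoint R K)) : ℕ∞ :=
  ⨆ c : {c : List (LocalPoint R K) // (∀ P ∈ c, P ∈ l) ∧ c.IsChain IsOnExceptionalDivisor},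
    (c.1.length : ℕ∞)

/-- The ideal at `P` of the strict transform of the curve `V(f) ⊆ Spec R`, i.e. of the
scheme-theoretic closure of the inverse image of `V(f)` minus the closed point: a function `a` lies
in it iff its restriction to the locus `b ≠ 0` is a multiple of `f`, for every `b ∈ 𝔪_R`. -/
def strictTransform [IsLocalRing R] (f : R) (P : LocalPoint R K) : Ideal P.ring where
  carrier := {a | ∀ b ∈ maximalIdeal R, ∃ n : ℕ,
    algebraMap R P.ring b ^ n * a ∈ Ideal.span {algebraMap R P.ring f}}
  zero_mem' b _ := ⟨0, by simp⟩
  add_mem' {x y} hx hy b hb := by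
    obtain ⟨m, hm⟩ := hx b hb
    obtain ⟨n, hn⟩ := hy b hb
    refine ⟨m + n, ?_⟩
    have h : algebraMap R P.ring b ^ (m + n) * (x + y) =
        algebraMap R P.ring b ^ n * (algebraMap R P.ring b ^ m * x) +
          algebraMap R P.ring b ^ m * (algebraMap R P.ring b ^ n * y) := by ring
    rw [h]
    exact add_mem (Ideal.mul_mem_left _ _ hm) (Ideal.mul_mem_left _ _ hn)
  smul_mem' c x hx b hb := by
    obtain ⟨m, hm⟩ := hx b hb
    refine ⟨m, ?_⟩
    rw [smul_eq_mul, mul_left_comm]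
    exact Ideal.mul_mem_left _ _ hm

/-- The blowup sequence `l` resolves the curve `V(f)`: the strict transform is regular at each
closed point of the last surface through which it passes. -/
def ResolvesCurve [IsLocalRing R] (f : R) (l : List (LocalPoint R K)) : Prop :=
  ∀ P ∈ closedPointsAfter l,
    strictTransform f P = ⊤ ∨ IsRegularLocalRing (P.ring ⧸ strictTransform f P)

/-- The number of blowup stages needed to resolve the curve `V(f)` in `Spec R`: the least number of
blowup stages of a blowup sequence at closed points that resolves it (`⊤` if there is none). -/
def resolutionStages (R : Type*) [CommRing R] [IsLocalRing R] (f : R) : ℕ∞ :=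
  ⨅ l : {l : List (LocalPoint R (FractionRing R)) // IsBlowupSequence l ∧ ResolvesCurve f l},
    blowupStages l.1

end Blowup

/-! ## Galois covers of the complement of a prime divisor -/

/-- A (connected) Galois cover: a finite étale surjective morphism with connected source which is a
torsor under its automorphism group `G`, i.e. `∐_{σ ∈ G} U' → U' ×_U U'`, `(σ, u) ↦ (u, σ u)`, is an
isomorphism. -/
def IsGaloisCover {U' U : Scheme.{u}} (f : U' ⟶ U) : Prop :=
  IsFinite f ∧ Etale f ∧ Surjective f ∧ ConnectedSpace U' ∧
    IsIso (Sigma.desc fun σ : Aut (Over.mk f) =>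
      (pullback.lift (𝟙 U') σ.hom.left (by simpa using (Over.w σ.hom).symm) : U' ⟶ pullback f f))

/-- The open complement of a closed subscheme. -/
def complementOpen {D X : Scheme.{u}} (i : D ⟶ X) [IsClosedImmersion i] : X.Opens :=
  ⟨(Set.range i)ᶜ, i.isClosedEmbedding.isClosed_range.isOpen_compl⟩

/-- A smooth surface `X` over `k`, a prime divisor `D` on it, and a Galois cover `U' → U` of
`U = X - D`. -/
structure BranchedCover (k : Type u) [Field k] where
  /-- the surface -/
  X : Scheme.{u}
  /-- its structure morphism -/
  str : X ⟶ Spec (.of k)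
  isIntegral_X : IsIntegral X
  isSeparated_str : IsSeparated str
  quasiCompact_str : QuasiCompact str
  smooth_str : SmoothOfRelativeDimension 2 str
  /-- the divisor -/
  D : Scheme.{u}
  /-- its inclusion -/
  incl : D ⟶ X
  isClosedImmersion_incl : IsClosedImmersion incl
  isIntegral_D : IsIntegral D
  /-- `D` has codimension one -/
  codim_D : ringKrullDim (X.presheaf.stalk (incl (genericPoint D))) = 1
  /-- the covering space -/
  U' : Scheme.{u}
  /-- the covering map -/
  cover : U' ⟶ (complementOpen incl).toScheme
  isGaloisCover_cover : IsGaloisCover cover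

namespace BranchedCover

variable {k : Type u} [Field k] (B : BranchedCover k)

attribute [instance] isIntegral_X isSeparated_str quasiCompact_str smooth_str
  isClosedImmersion_incl isIntegral_D

instance isFinite_cover : IsFinite B.cover := B.isGaloisCover_cover.1

instance isLocallyNoetherian_X : IsLocallyNoetherian B.X :=
  haveI : Smooth B.str := SmoothOfRelativeDimension.smooth 2 B.str
  LocallyOfFiniteType.isLocallyNoetherian B.str

/-- The composite `U' → U ⊆ X`. -/
def toX : B.U' ⟶ B.X := B.cover ≫ (complementOpen B.incl).ι

instance : QuasiCompact B.toX := by unfold toX; infer_instance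

instance : QuasiSeparated B.toX := by unfold toX; infer_instance

/-- The normalisation `X'` of `X` in `U'`. -/
def X' : Scheme.{u} := B.toX.normalization

/-- The projection `π : X' → X`. -/
def proj : B.X' ⟶ B.X := B.toX.fromNormalization

/-- `X'` is smooth over `k` at `x'` (that is, on some open neighbourhood of it). -/
def SmoothAt (x' : B.X') : Prop :=
  ∃ V : B.X'.Opens, x' ∈ V ∧ Smooth (V.ι ≫ B.proj ≫ B.str)

theorem SmoothAt.isNoetherianRing {B : BranchedCover k} {x' : B.X'} (hx' : B.SmoothAt x') :
    IsNoetherianRing (B.X'.presheaf.stalk x') := by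
  obtain ⟨V, hV, _⟩ := hx'
  have : IsLocallyNoetherian V.toScheme :=
    LocallyOfFiniteType.isLocallyNoetherian (V.ι ≫ B.proj ≫ B.str)
  let y : V.toScheme := ⟨x', hV⟩
  have : IsNoetherianRing (V.toScheme.presheaf.stalk y) := inferInstance
  exact isNoetherianRing_of_ringEquiv _ (V.stalkIso y).commRingCatIsoToRingEquiv

end BranchedCover

/-- A branched Galois cover together with a closed point `x'` of `X'`, at which `X'` is smooth, and
which lies over a closed point `x = π(x')` of `X` on the divisor `D`. -/
structure PointedBranchedCover (k : Type u) [Field k] extends BranchedCover k where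
  /-- the point upstairs -/
  x' : toBranchedCover.X'
  isClosed_x : IsClosed {toBranchedCover.proj x'}
  mem_D : toBranchedCover.proj x' ∈ Set.range incl
  smoothAt_x' : toBranchedCover.SmoothAt x'

namespace PointedBranchedCover

variable {k : Type u} [Field k] (B : PointedBranchedCover k)

/-- The point `x` downstairs. -/
abbrev x : B.X := B.proj B.x'

instance isNoetherianRing_stalk : IsNoetherianRing (B.X'.presheaf.stalk B.x') :=
  B.smoothAt_x'.isNoetherianRing

/-- `A`, the completed local ring of `X` at `x`. -/
def A : Type u := AdicCompletion (maximalIdeal (B.X.presheaf.stalk B.x)) (B.X.presheaf.stalk B.x)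

instance : CommRing B.A := inferInstanceAs (CommRing (AdicCompletion _ _))

instance : IsLocalRing B.A := inferInstanceAs
  (IsLocalRing (AdicCompletion (maximalIdeal (B.X.presheaf.stalk B.x)) (B.X.presheaf.stalk B.x)))

/-- `R`, the completed local ring of `X'` at `x'`. -/
def R : Type u :=
  AdicCompletion (maximalIdeal (B.X'.presheaf.stalk B.x')) (B.X'.presheaf.stalk B.x')

instance : CommRing B.R := inferInstanceAs (CommRing (AdicCompletion _ _))

instance : IsLocalRing B.R := inferInstanceAs
  (IsLocalRing
    (AdicCompletion (maximalIdeal (B.X'.presheaf.stalk B.x')) (B.X'.presheaf.stalk B.x')))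

/-- `R` is an `A`-algebra through the completion of the local homomorphism of `π` at `x'`. -/
instance : Algebra B.A B.R :=
  RingHom.toAlgebra (completionMap (B.proj.stalkMap B.x').hom)

/-- The canonical morphism `X_x̂ = Spec A → X`. -/
def fromCompletion : Spec (.of B.A) ⟶ B.X :=
  Spec.map (CommRingCat.ofHom (algebraMap (B.X.presheaf.stalk B.x)
    (AdicCompletion (maximalIdeal (B.X.presheaf.stalk B.x)) (B.X.presheaf.stalk B.x)))) ≫
    B.X.fromSpecStalk B.x

/-- `D_x̂ = D ×_X X_x̂` is the closed subscheme `V(g)` of `X_x̂ = Spec A`. -/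
def IsEquationOfD (g : B.A) : Prop :=
  ∃ e : pullback B.incl B.fromCompletion ≅ Spec (.of (B.A ⧸ Ideal.span {g})),
    e.hom ≫ Spec.map (CommRingCat.ofHom (Ideal.Quotient.mk (Ideal.span {g}))) =
      pullback.snd B.incl B.fromCompletion

end PointedBranchedCover

end

/-! The number of blowup stages is bounded by the δ-invariant of `C'`, and the δ-invariant by the
codifferent.

The extension `R/A`. Both `A` and `R` turn out to be power series rings in two variables over `k`;
`R` is finite over `A`, and `A → R` is injective for dimension reasons. As `A/hA` is a discrete
valuation ring and `R` has depth two, `R/hR` is torsion free over `A/hA`, and this makes `R` free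
over `A` (`Module.free_of_isTorsionFree_quotient`). The extension is unramified off `g = 0`, so the
discriminant of a basis divides a power of `g` (`exists_discr_dvd_pow`), and the trace form
identifies the codifferent with `Hom_A(R, A)` (`range_traceDual`).

From the codifferent to δ. Let `κ` be the fraction field of `A/hA`. Since `g ∉ (h)`, the
discriminant is nonzero in `κ`, so `κ ⊗ R` is reduced with nondegenerate trace form. Let `Õ` be the
integral closure of `A` in `κ ⊗ R`, the normalisation of `C'`. Traces of integral elements lie in
the normal ring `A/hA`. Hence `w ↦ Tr(w ·)` embeds `Õ`, modulo the image of `R`, into the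
functionals on `R` reduced modulo `h`, modulo those given by traces. That target is a quotient of
`𝔠(R/A)/R` killed by `g^r` and `h` and generated by `s` elements, so its length is at most `s ·
length A/(g^r, h) ≤ r · s · length A/(g, h)`.

From δ to blowups. At an infinitely near point `P` with local ring `O_P` the strict transform is the
kernel of `O_P → κ ⊗ O_P`. Let `Õ_P ⊆ Õ` consist of the elements that become functions at `P`
(`pointOrder`), and let `d(P)` be the length of `Õ/Õ_P`. Suppose that `Q`, on the exceptional
divisor over `P` in the chart of `t`, lies on the strict transform and `d(Q) = d(P)`. Then the
quotients `z/t`, for `z` in the maximal ideal of `P`, are already functions on the curve at `P`; so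
`t` generates the maximal ideal there and the curve is regular at `P`. If `d(P) = 0` the curve at
`P` is normal, hence regular. Thus `d` is positive at unresolved points and drops strictly from each
to the next. Over each point there are only finitely many unresolved ones, because a point on the
curve is determined by a maximal ideal of `Õ` lying over it. Blowing up exactly the unresolved
points resolves the curve, and no chain is longer than the initial `d`, which is at most δ
(`resolutionStages_le_of_measure`, `resolutionStages_le_length`).

Geometric input. The completion of a formally smooth local `k`-algebra with residue field `k` is a
power series ring (`exists_ringEquiv_mvPowerSeries`). The dimension at `x'` is found by comparing
differentials over the generic point. Finiteness of `R` follows from integrality of the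
normalisation and completeness of `A`, and unramifiedness off `g = 0` from the étaleness of `X'`
over `U`. -/

noncomputable section

/-! ## Finiteness over complete rings -/

theorem IsPrecomplete.fin_fun {A : Type*} [CommRing A] (I : Ideal A) [IsPrecomplete I A] (n : ℕ) :
    IsPrecomplete I (Fin n → A) := by
  refine ⟨fun f hf => ?_⟩
  have key : ∀ (m : ℕ) (v : Fin n → A),
      v ∈ (I ^ m • ⊤ : Submodule A (Fin n → A)) ↔ ∀ i, v i ∈ (I ^ m • ⊤ : Submodule A A) := by
    intro m v
    constructor
    · intro hv i
      have := Submodule.mem_map_of_mem (f := (LinearMap.proj i : (Fin n → A) →ₗ[A] A)) hv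
      rw [Submodule.map_smul''] at this
      exact Submodule.smul_mono le_rfl le_top this
    · intro hv
      rw [pi_eq_sum_univ' v]
      refine Submodule.sum_mem _ fun i _ => Submodule.smul_mem_smul ?_ trivial
      simpa using hv i
  have h1 : ∀ i, ∃ L : A, ∀ m, f m i ≡ L [SMOD (I ^ m • ⊤ : Submodule A A)] := by
    intro i
    refine IsPrecomplete.prec ‹_› (f := fun m => f m i) ?_
    intro m k hmk
    have := hf hmk
    rw [SModEq.sub_mem] at this ⊢
    exact (key m _).1 this i
  choose L hL using h1
  refine ⟨L, fun m => ?_⟩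
  rw [SModEq.sub_mem, key]
  intro i
  have := hL i m
  rwa [SModEq.sub_mem] at this

/-- Nakayama's lemma in its complete form: `M` is not known to be finite, only separated. Successive
approximations converge in `A^n`, and separatedness of `M` identifies the image of the limit. -/
theorem Module.Finite.of_isPrecomplete_of_isHausdorff {A M : Type*} [CommRing A] (I : Ideal A)
    [IsPrecomplete I A] [AddCommGroup M] [Module A M] [IsHausdorff I M] {n : ℕ} (v : Fin n → M)
    (hv : ∀ m : M, ∃ c : Fin n → A, m - ∑ i, c i • v i ∈ (I • ⊤ : Submodule A M)) :
    (∀ m : M, ∃ c : Fin n → A, m = ∑ i, c i • v i) := by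
  have := IsPrecomplete.fin_fun I n
  have hs : Function.Surjective (Fintype.linearCombination A v) := by
    refine surjective_of_mkQ_comp_surjective (I := I) ?_
    intro y
    obtain ⟨m, rfl⟩ := Submodule.Quotient.mk_surjective _ y
    obtain ⟨c, hc⟩ := hv m
    refine ⟨c, ?_⟩
    simp only [LinearMap.comp_apply, Submodule.mkQ_apply]
    rw [eq_comm, Submodule.Quotient.eq]
    simpa [Fintype.linearCombination_apply] using hc
  intro m
  obtain ⟨c, hc⟩ := hs m
  exact ⟨c, by rw [← hc, Fintype.linearCombination_apply]⟩

/-! ## Traces of integral elements -/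

/-- The trace is the sum of the eigenvalues in an algebraic closure. Each eigenvalue is a root of
the monic `q`, hence integral over `B`. No normality of `B` is involved. -/
theorem Module.End.isIntegral_trace_of_aeval_eq_zero {B κ V : Type*} [CommRing B] [Field κ]
    [Algebra B κ] [AddCommGroup V] [Module κ V] [Module.Finite κ V] (φ : Module.End κ V)
    (q : Polynomial B) (hq : q.Monic) (h : Polynomial.aeval φ (q.map (algebraMap B κ)) = 0) :
    IsIntegral B (LinearMap.trace κ V φ) := by
  classical
  let b := Module.finBasis κ V
  let M := LinearMap.toMatrix b b φ
  let E := AlgebraicClosure κ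
  rw [LinearMap.trace_eq_matrix_trace κ b]
  refine (isIntegral_algHom_iff (IsScalarTower.toAlgHom B κ E) (algebraMap κ E).injective).1 ?_
  have h1 : IsScalarTower.toAlgHom B κ E M.trace = (M.map (algebraMap κ E)).trace := by
    simp [Matrix.trace, map_sum]
  change IsIntegral B (IsScalarTower.toAlgHom B κ E M.trace)
  rw [h1, Matrix.trace_eq_sum_roots_charpoly]
  refine IsIntegral.multiset_sum fun μ hμ => ?_
  have hμ' := Polynomial.isRoot_of_mem_roots hμ
  have hφ : Polynomial.aeval M (q.map (algebraMap B κ)) = 0 := by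
    have := congrArg (LinearMap.toMatrixAlgEquiv b) h
    rw [map_zero] at this
    exact (Polynomial.aeval_algHom_apply (LinearMap.toMatrixAlgEquiv b).toAlgHom φ _).trans this
  have hspec : (μ : E) ∈ spectrum E (M.map (algebraMap κ E)) :=
    Matrix.mem_spectrum_of_isRoot_charpoly hμ'
  have hM : Polynomial.aeval (M.map (algebraMap κ E)) ((q.map (algebraMap B κ)).map (algebraMap κ E))
      = 0 := by
    have h2 := Polynomial.aeval_algHom_apply (Algebra.ofId κ E).mapMatrix M (q.map (algebraMap B κ))
    rw [hφ, map_zero] at h2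
    rw [Polynomial.aeval_map_algebraMap]
    exact h2
  have h3 := spectrum.subset_polynomial_aeval (M.map (algebraMap κ E))
    ((q.map (algebraMap B κ)).map (algebraMap κ E)) ⟨μ, hspec, rfl⟩
  rw [hM] at h3
  have h4 : Polynomial.eval μ ((q.map (algebraMap B κ)).map (algebraMap κ E)) = 0 := by
    by_contra hne
    rw [spectrum.mem_iff] at h3
    apply h3
    rw [sub_zero]
    exact (IsUnit.mk0 _ hne).map (algebraMap E _)
  refine ⟨q, hq, ?_⟩
  rw [Polynomial.eval_map, Polynomial.eval₂_map] at h4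
  rwa [← IsScalarTower.algebraMap_eq B κ E] at h4

theorem Algebra.isIntegral_trace_of_finite {B κ F : Type*} [CommRing B] [Field κ]
    [Algebra B κ] [CommRing F] [Algebra κ F] [Algebra B F] [IsScalarTower B κ F]
    [Module.Finite κ F] {w : F} (hw : IsIntegral B w) :
    IsIntegral B (Algebra.trace κ F w) := by
  obtain ⟨q, hq, h⟩ := hw
  rw [Algebra.trace_apply]
  refine Module.End.isIntegral_trace_of_aeval_eq_zero _ q hq ?_
  have h1 : Polynomial.aeval w (q.map (algebraMap B κ)) = 0 := by
    rw [Polynomial.aeval_map_algebraMap]; exact h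
  change Polynomial.aeval (Algebra.lmul κ F w) _ = 0
  rw [Polynomial.aeval_algHom_apply, h1, map_zero]

/-! ## Lengths -/

theorem Module.length_le_of_generators {A M : Type*} [CommRing A] [AddCommGroup M] [Module A M]
    (I : Ideal A) (hI : ∀ a ∈ I, ∀ m : M, a • m = 0) {n : ℕ} (v : Fin n → M)
    (hv : Submodule.span A (Set.range v) = ⊤) :
    Module.length A M ≤ n * Module.length A (A ⧸ I) := by
  have hk : ∀ i, I ≤ LinearMap.ker (LinearMap.toSpanSingleton A M (v i)) := by
    intro i a ha
    simpa using hI a ha (v i)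
  let f : (Fin n → A ⧸ I) →ₗ[A] M :=
    ∑ i, (Submodule.liftQ I (LinearMap.toSpanSingleton A M (v i)) (hk i)) ∘ₗ LinearMap.proj i
  have hf : Function.Surjective f := by
    rw [← LinearMap.range_eq_top, ← top_le_iff, ← hv, Submodule.span_le]
    rintro _ ⟨i, rfl⟩
    refine ⟨Pi.single i (Submodule.Quotient.mk 1), ?_⟩
    simp only [f, LinearMap.sum_apply, LinearMap.comp_apply, LinearMap.proj_apply]
    rw [Finset.sum_eq_single i]
    · rw [Pi.single_eq_same]
      erw [Submodule.liftQ_apply]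
      simp
    · intro j _ hj
      rw [Pi.single_eq_of_ne hj, map_zero]
    · simp
  refine (Module.length_le_of_surjective f hf).trans ?_
  rw [Module.length_pi_of_fintype]
  simp

/-- The kernel of `A/(g^(n+1), h) → A/(g^n, h)` is generated by the class of `g^n`, which `(g, h)`
kills, so each step adds at most the length of `A/(g, h)`. -/
theorem Module.length_quotient_pow_le {A : Type*} [CommRing A] (g h : A) (n : ℕ) :
    Module.length A (A ⧸ Ideal.span {g ^ n, h}) ≤ n * Module.length A (A ⧸ Ideal.span {g, h}) := by
  induction n with
  | zero =>
    have : Ideal.span {g ^ 0, h} = ⊤ :=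
      Ideal.eq_top_of_isUnit_mem _ (Ideal.subset_span (Set.mem_insert _ _)) (by simp)
    rw [this]
    have : Subsingleton (A ⧸ (⊤ : Ideal A)) := Ideal.Quotient.subsingleton_iff.2 rfl
    simp
  | succ n ih =>
    let I := Ideal.span {g ^ (n + 1), h}
    let J := Ideal.span {g ^ n, h}
    have hIJ : I ≤ J := by
      rw [Ideal.span_le]
      rintro x (rfl | rfl)
      · rw [pow_succ]; exact Ideal.mul_mem_right _ _ (Ideal.subset_span (by simp))
      · exact Ideal.subset_span (by simp)
    let K := Ideal.span {g, h}
    have hK : K ≤ LinearMap.ker (LinearMap.toSpanSingleton A (A ⧸ I) (Submodule.Quotient.mk (g ^ n)))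
        := by
      rw [Ideal.span_le]
      rintro x (rfl | rfl)
      · simp only [SetLike.mem_coe, LinearMap.mem_ker, LinearMap.toSpanSingleton_apply]
        rw [← Submodule.Quotient.mk_smul, Submodule.Quotient.mk_eq_zero, smul_eq_mul, ← pow_succ']
        exact Ideal.subset_span (by simp)
      · simp only [SetLike.mem_coe, LinearMap.mem_ker, LinearMap.toSpanSingleton_apply]
        rw [← Submodule.Quotient.mk_smul, Submodule.Quotient.mk_eq_zero, smul_eq_mul]
        exact Ideal.mul_mem_right _ _ (Ideal.subset_span (by simp))
    let f : (A ⧸ K) →ₗ[A] (A ⧸ I) := Submodule.liftQ K _ hK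
    let q : (A ⧸ I) →ₗ[A] (A ⧸ J) := Submodule.factor hIJ
    have hq : Function.Surjective q := Submodule.factor_surjective hIJ
    have hker : LinearMap.ker q ≤ LinearMap.range f := by
      intro x hx
      obtain ⟨a, rfl⟩ := Submodule.Quotient.mk_surjective _ x
      have ha : a ∈ J := by
        have : q (Submodule.Quotient.mk a) = Submodule.Quotient.mk a := rfl
        rw [LinearMap.mem_ker, this] at hx
        exact (Submodule.Quotient.mk_eq_zero J).1 hx
      obtain ⟨c, d, rfl⟩ := Ideal.mem_span_pair.1 ha
      refine ⟨Submodule.Quotient.mk c, ?_⟩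
      change c • (Submodule.Quotient.mk (g ^ n) : A ⧸ I) = _
      rw [← Submodule.Quotient.mk_smul, Submodule.Quotient.eq]
      have : c • g ^ n - (c * g ^ n + d * h) = -d * h := by simp
      rw [this]
      exact Ideal.mul_mem_left _ _ (Ideal.subset_span (by simp))
    have h1 := Module.length_eq_add_of_exact (LinearMap.ker q).subtype q
      (Submodule.injective_subtype _) hq (by rw [LinearMap.exact_iff]; simp)
    have h2 : Module.length A (LinearMap.ker q) ≤ Module.length A (A ⧸ K) := by
      refine (Module.length_le_of_injective (Submodule.inclusion hker)
        (Submodule.inclusion_injective hker)).trans ?_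
      exact Module.length_le_of_surjective f.rangeRestrict f.surjective_rangeRestrict
    change Module.length A (A ⧸ I) ≤ _
    rw [h1]
    push_cast
    rw [add_mul, one_mul, add_comm]
    exact add_le_add ih h2

/-! ## The generic fibre of an algebra along a prime divisor of the base -/

theorem algebraMap_fractionRing_quotient_eq_zero_iff {A : Type*} [CommRing A] (p : Ideal A)
    (κ : Type*) [Field κ] [Algebra A κ] [Algebra (A ⧸ p) κ] [IsScalarTower A (A ⧸ p) κ]
    [IsFractionRing (A ⧸ p) κ] (a : A) : algebraMap A κ a = 0 ↔ a ∈ p := by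
  rw [IsScalarTower.algebraMap_apply A (A ⧸ p) κ, Ideal.Quotient.algebraMap_eq,
    FaithfulSMul.algebraMap_eq_zero_iff, Ideal.Quotient.eq_zero_iff_mem]

/-- `κ` is the localisation of `A/p` at the complement of `p`, so `κ ⊗ Q` is the localisation of
`Q/pQ` there, and the kernel is what some `c ∉ p` annihilates. -/
theorem one_tmul_eq_zero_iff {A : Type*} [CommRing A] (p : Ideal A) (κ : Type*) [Field κ]
    [Algebra A κ] [Algebra (A ⧸ p) κ] [IsScalarTower A (A ⧸ p) κ] [IsFractionRing (A ⧸ p) κ]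
    {Q : Type*} [AddCommGroup Q] [Module A Q] (q : Q) :
    (1 : κ) ⊗ₜ[A] q = 0 ↔ ∃ c ∉ p, c • q ∈ (p • ⊤ : Submodule A Q) := by
  have hp : p.IsPrime := by
    have : IsDomain (A ⧸ p) := (FaithfulSMul.algebraMap_injective (A ⧸ p) κ).isDomain
    exact (Ideal.Quotient.isDomain_iff_prime p).1 this
  have hpd : IsDomain (A ⧸ p) := (Ideal.Quotient.isDomain_iff_prime p).2 hp
  have hS : Algebra.algebraMapSubmonoid (A ⧸ p) p.primeCompl = nonZeroDivisors (A ⧸ p) := by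
    ext x
    obtain ⟨a, rfl⟩ := Ideal.Quotient.mk_surjective x
    rw [mem_nonZeroDivisors_iff_ne_zero]
    constructor
    · rintro ⟨b, hb, hab⟩ h0
      rw [← hab] at h0
      exact hb (Ideal.Quotient.eq_zero_iff_mem.1 h0)
    · intro h0
      exact ⟨a, fun h => h0 (Ideal.Quotient.eq_zero_iff_mem.2 h), rfl⟩
  have hloc : IsLocalizedModule p.primeCompl (IsScalarTower.toAlgHom A (A ⧸ p) κ).toLinearMap := by
    rw [isLocalizedModule_iff_isLocalization, hS]
    infer_instance
  have hloc2 : IsLocalizedModule p.primeCompl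
      ((IsScalarTower.toAlgHom A (A ⧸ p) κ).toLinearMap.rTensor Q) :=
    IsLocalizedModule.rTensor (R := A) (A := A) (S := p.primeCompl) _
  have h1 : (1 : κ) ⊗ₜ[A] q = (IsScalarTower.toAlgHom A (A ⧸ p) κ).toLinearMap.rTensor Q
    ((1 : A ⧸ p) ⊗ₜ q) := by simp
  have h2 : ∀ q : Q, (1 : A ⧸ p) ⊗ₜ[A] q = 0 ↔ q ∈ (p • ⊤ : Submodule A Q) := by
    intro q
    rw [← (TensorProduct.quotTensorEquivQuotSMul Q p).map_eq_zero_iff]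
    have := TensorProduct.quotTensorEquivQuotSMul_mk_tmul p (1 : A) q
    rw [map_one] at this
    rw [this, one_smul, Submodule.Quotient.mk_eq_zero]
  rw [h1, ← map_zero ((IsScalarTower.toAlgHom A (A ⧸ p) κ).toLinearMap.rTensor Q),
    IsLocalizedModule.eq_iff_exists p.primeCompl]
  constructor
  · rintro ⟨c, hc⟩
    refine ⟨c, c.2, ?_⟩
    rw [← h2, TensorProduct.tmul_smul]
    rw [smul_zero] at hc
    exact hc
  · rintro ⟨c, hc, h⟩
    refine ⟨⟨c, hc⟩, ?_⟩
    rw [← h2, TensorProduct.tmul_smul] at h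
    rw [smul_zero]
    exact h

/-! ## Depth two and freeness -/

/-- Depth two in elementary form. Writing `x^n a = f c` and `y^n a = f d` gives `x^n d = y^n c`; as
`x` is prime and does not divide `y`, `x^n` divides `c` and can be cancelled. -/
theorem mem_span_of_pow_mul_mem {R : Type*} [CommRing R] [IsDomain R] {x y f a : R} (hx : Prime x)
    (hy : y ∉ Ideal.span {x}) (hf : f ≠ 0) {n : ℕ} (h1 : x ^ n * a ∈ Ideal.span {f})
    (h2 : y ^ n * a ∈ Ideal.span {f}) : a ∈ Ideal.span {f} := by
  rw [Ideal.mem_span_singleton] at *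
  obtain ⟨c, hc⟩ := h1
  obtain ⟨d, hd⟩ := h2
  have h3 : x ^ n * d = y ^ n * c := mul_left_cancel₀ hf (by
    linear_combination (y ^ n) * hc - (x ^ n) * hd)
  have h4 : x ^ n ∣ c := by
    have : x ^ n ∣ y ^ n * c := ⟨d, h3.symm⟩
    exact hx.pow_dvd_of_dvd_mul_left n (fun h => hy (hx.dvd_of_dvd_pow h)) this
  obtain ⟨c', rfl⟩ := h4
  exact ⟨c', mul_left_cancel₀ (pow_ne_zero n hx.ne_zero) (by linear_combination hc)⟩

/-- `R/hR` is finite and torsion free over the principal ideal domain `A/hA`, hence free. Lifts of a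
basis generate `R` by Nakayama. Modulo `h` there are no relations, so every relation is `h` times a
vector, again a relation because `h` is regular on `R`; Nakayama then kills the module of relations.
-/
theorem Module.free_of_isTorsionFree_quotient {A R : Type*} [CommRing A] [IsLocalRing A]
    [IsNoetherianRing A] [AddCommGroup R] [Module A R] [Module.Finite A R] (h : A)
    (hh : h ∈ maximalIdeal A) (hreg : ∀ r : R, h • r = 0 → r = 0)
    [IsDomain (A ⧸ Ideal.span {h})] [IsPrincipalIdealRing (A ⧸ Ideal.span {h})]
    (htf : ∀ c ∉ Ideal.span {h}, ∀ r : R,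
      c • r ∈ (Ideal.span {h} • ⊤ : Submodule A R) → r ∈ (Ideal.span {h} • ⊤ : Submodule A R)) :
    Module.Free A R := by
  classical
  let p := Ideal.span {h}
  let R' := R ⧸ (p • ⊤ : Submodule A R)
  have hfin : Module.Finite (A ⧸ p) R' := Module.Finite.of_restrictScalars_finite A _ _
  have htor : Module.IsTorsionFree (A ⧸ p) R' := by
    rw [Module.isTorsionFree_iff_smul_eq_zero]
    intro c r hcr
    obtain ⟨c, rfl⟩ := Ideal.Quotient.mk_surjective c
    obtain ⟨r, rfl⟩ := Submodule.Quotient.mk_surjective _ r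
    by_cases hc : c ∈ p
    · left; exact Ideal.Quotient.eq_zero_iff_mem.2 hc
    · right
      rw [Submodule.Quotient.mk_eq_zero]
      apply htf c hc
      rw [← Submodule.Quotient.mk_eq_zero]
      exact hcr
  have hfree : Module.Free (A ⧸ p) R' := Module.free_of_finite_type_torsion_free'
  let b := Module.Free.chooseBasis (A ⧸ p) R'
  let ι := Module.Free.ChooseBasisIndex (A ⧸ p) R'
  have hl : ∀ i, ∃ r : R, (Submodule.Quotient.mk r : R') = b i := fun i =>
    Submodule.Quotient.mk_surjective _ (b i)
  choose v hv using hl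
  let f := Fintype.linearCombination A v
  have hp : p ≤ Ideal.jacobson ⊥ := by
    rw [IsLocalRing.jacobson_eq_maximalIdeal _ bot_ne_top, Ideal.span_le]
    simpa using hh
  have hmk : ∀ c : ι → A, (Submodule.Quotient.mk (f c) : R') = ∑ i, Ideal.Quotient.mk p (c i) • b i
      := by
    intro c
    simp only [f, Fintype.linearCombination_apply]
    rw [← Submodule.mkQ_apply, map_sum]
    refine Finset.sum_congr rfl fun i _ => ?_
    rw [map_smul, Submodule.mkQ_apply, hv]
    rfl
  have hsurj : LinearMap.range f = ⊤ := by
    rw [← top_le_iff]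
    refine Submodule.le_of_le_smul_of_le_jacobson_bot (I := p) Module.Finite.fg_top hp ?_
    intro r _
    have hc : ∃ c : ι → A, ∀ i, Ideal.Quotient.mk p (c i) = b.repr (Submodule.Quotient.mk r) i :=
      Classical.axiomOfChoice fun i => Ideal.Quotient.mk_surjective _
    obtain ⟨c, hc⟩ := hc
    have : (Submodule.Quotient.mk (f c) : R') = Submodule.Quotient.mk r := by
      rw [hmk]
      simp only [hc]
      exact b.sum_repr _
    rw [Submodule.Quotient.eq] at this
    have h2 : r = f c + -(f c - r) := by abel
    rw [h2]
    exact Submodule.add_mem_sup ⟨c, rfl⟩ (neg_mem this)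
  have hinj : LinearMap.ker f = ⊥ := by
    refine Submodule.eq_bot_of_le_smul_of_le_jacobson_bot p _ (IsNoetherian.noetherian _) ?_ hp
    intro c hc
    rw [LinearMap.mem_ker] at hc
    have h1 := hmk c
    rw [hc, Submodule.Quotient.mk_zero] at h1
    have h2 := Fintype.linearIndependent_iff.1 b.linearIndependent _ h1.symm
    have h3 : ∀ i, ∃ d, c i = h * d := fun i => by
      have := Ideal.Quotient.eq_zero_iff_mem.1 (h2 i)
      exact Ideal.mem_span_singleton.1 this
    choose d hd using h3
    have hcd : c = h • d := by ext i; simp [hd]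
    have hdk : d ∈ LinearMap.ker f := by
      rw [LinearMap.mem_ker]
      apply hreg
      rw [← map_smul, ← hcd, hc]
    rw [hcd]
    exact Submodule.smul_mem_smul (Ideal.subset_span rfl) hdk
  exact Module.Free.of_equiv
    (LinearEquiv.ofBijective f ⟨LinearMap.ker_eq_bot.1 hinj, LinearMap.range_eq_top.1 hsurj⟩)

/-! ## Discriminants -/

theorem Algebra.trace_pi_apply {K I : Type*} [Field K] [Finite I] (L : I → Type*)
    [∀ i, CommRing (L i)] [∀ i, Algebra K (L i)] [∀ i, Module.Finite K (L i)] [Fintype I]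
    (x : ∀ i, L i) : Algebra.trace K (∀ i, L i) x = ∑ i, Algebra.trace K (L i) (x i) := by
  classical
  let b := Pi.basis fun i => Module.finBasis K (L i)
  rw [Algebra.trace_eq_matrix_trace b, Matrix.trace, Fintype.sum_sigma]
  refine Finset.sum_congr rfl fun i _ => ?_
  rw [Algebra.trace_eq_matrix_trace (Module.finBasis K (L i)), Matrix.trace]
  refine Finset.sum_congr rfl fun j _ => ?_
  simp only [Matrix.diag_apply, Algebra.leftMulMatrix_eq_repr_mul, b, Pi.basis_repr, Pi.basis_apply]
  simp

/-- `F` is a finite product of finite separable field extensions, and the trace form of each factor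
is nondegenerate. Testing against elements supported in one factor separates the components. -/
theorem Algebra.FormallyUnramified.eq_zero_of_trace_mul_eq_zero {K F : Type u} [Field K]
    [CommRing F] [Algebra K F] [Module.Finite K F] [Algebra.FormallyUnramified K F] {x : F}
    (hx : ∀ y, Algebra.trace K F (x * y) = 0) : x = 0 := by
  classical
  have : Algebra.FormallyEtale K F := Algebra.FormallyEtale.of_formallyUnramified_of_field K F
  obtain ⟨I, _, L, _, _, e, hsep⟩ := (Algebra.FormallyEtale.iff_exists_algEquiv_prod K F).1 this
  have := Fintype.ofFinite I
  have hfin : ∀ i, Module.Finite K (L i) := fun i => by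
    have h1 : Module.Finite K (∀ i, L i) := Module.Finite.equiv e.toLinearEquiv
    exact Module.Finite.of_surjective (LinearMap.proj i : (∀ i, L i) →ₗ[K] L i)
      (Function.surjective_eval i)
  apply e.injective
  rw [map_zero]
  ext i
  have hnd := traceForm_nondegenerate K (L i)
  refine hnd.1 (e x i) fun z => ?_
  have := hx (e.symm (Pi.single i z))
  rw [← Algebra.trace_eq_of_algEquiv e, map_mul, AlgEquiv.apply_symm_apply,
    Algebra.trace_pi_apply] at this
  rw [Algebra.traceForm_apply, ← this, Finset.sum_eq_single i]
  · simp
  · intro j _ hj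
    simp [Pi.single_eq_of_ne hj]
  · simp

theorem Algebra.trace_one_tmul {A R : Type*} (κ : Type*) [CommRing A] [CommRing R] [Algebra A R]
    [Module.Free A R] [Module.Finite A R] [CommRing κ] [Algebra A κ] (r : R) :
    Algebra.trace κ (κ ⊗[A] R) (1 ⊗ₜ r) = algebraMap A κ (Algebra.trace A R r) := by
  rw [Algebra.trace_apply, Algebra.trace_apply, ← LinearMap.trace_baseChange]
  congr 1
  ext s
  simp

theorem Algebra.discr_one_tmul {A R ι : Type*} (κ : Type*) [CommRing A] [CommRing R] [Algebra A R]
    [Fintype ι] [DecidableEq ι] (b : Module.Basis ι A R) [CommRing κ] [Algebra A κ] :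
    Algebra.discr κ (b.baseChange κ) = algebraMap A κ (Algebra.discr A b) := by
  have := Module.Free.of_basis b
  have := Module.Finite.of_basis b
  rw [Algebra.discr_def, Algebra.discr_def, RingHom.map_det]
  congr 1
  ext i j
  simp only [Algebra.traceMatrix_apply, Algebra.traceForm_apply, RingHom.mapMatrix_apply,
    Matrix.map_apply]
  rw [← Algebra.trace_one_tmul]
  simp

theorem Algebra.discr_ne_zero_of_formallyUnramified {K F ι : Type u} [Field K] [CommRing F]
    [Algebra K F] [Algebra.FormallyUnramified K F] [Fintype ι] [DecidableEq ι]
    (b : Module.Basis ι K F) : Algebra.discr K b ≠ 0 := by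
  classical
  have := Module.Finite.of_basis b
  rw [Algebra.discr_def, Algebra.traceMatrix_of_basis,
    ← LinearMap.BilinForm.nondegenerate_iff_det_ne_zero]
  refine ⟨fun x hx => Algebra.FormallyUnramified.eq_zero_of_trace_mul_eq_zero (K := K) hx,
    fun x hx => Algebra.FormallyUnramified.eq_zero_of_trace_mul_eq_zero (K := K) fun y => ?_⟩
  rw [mul_comm]
  exact hx y

/-- The discriminant commutes with base change and is nonzero on an unramified fibre, so every prime
containing it contains `g`; hence `g` is in the radical of the ideal it generates. -/
theorem exists_discr_dvd_pow {A R ι : Type u} [CommRing A] [CommRing R] [Algebra A R]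
    [Fintype ι] [DecidableEq ι] (b : Module.Basis ι A R) (g : A)
    (hunr : ∀ (p : Ideal A) [p.IsPrime], g ∉ p →
      Algebra.FormallyUnramified p.ResidueField (p.ResidueField ⊗[A] R)) :
    ∃ n, Algebra.discr A b ∣ g ^ n := by
  classical
  have : g ∈ (Ideal.span {Algebra.discr A b}).radical := by
    rw [Ideal.radical_eq_sInf, Ideal.mem_sInf]
    rintro p ⟨hp, hprime⟩
    by_contra hg
    have := hunr p hg
    have h1 := Algebra.discr_ne_zero_of_formallyUnramified (b.baseChange p.ResidueField)
    rw [Algebra.discr_one_tmul] at h1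
    apply h1
    rw [Ideal.algebraMap_residueField_eq_zero]
    exact hp (Ideal.subset_span rfl)
  obtain ⟨n, hn⟩ := this
  exact ⟨n, Ideal.mem_span_singleton.1 hn⟩

/-! ## The codifferent as a dual -/

section TraceDual

variable {A R ι : Type*} [CommRing A] [CommRing R] [Algebra A R] [Fintype ι] [DecidableEq ι]
  (b : Module.Basis ι A R) (K : Type*) [Field K] [Algebra A K]

theorem Algebra.traceForm_nondegenerate_of_discr (hd : algebraMap A K (Algebra.discr A b) ≠ 0) :
    (Algebra.traceForm K (K ⊗[A] R)).Nondegenerate := by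
  rw [LinearMap.BilinForm.nondegenerate_iff_det_ne_zero (b.baseChange K),
    ← Algebra.traceMatrix_of_basis, ← Algebra.discr_def, Algebra.discr_one_tmul]
  exact hd

/-- The element of `K ⊗ R` that represents a functional on `R` through the trace form. -/
def traceDual (hd : algebraMap A K (Algebra.discr A b) ≠ 0) : (R →ₗ[A] A) →ₗ[A] K ⊗[A] R :=
  haveI := Module.Finite.of_basis b
  { toFun φ := (LinearMap.BilinForm.toDual _ (Algebra.traceForm_nondegenerate_of_discr b K hd)).symm
      ((Algebra.linearMap A K ∘ₗ φ).liftBaseChange K)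
    map_add' φ ψ := by
      rw [← map_add]; congr 1
      apply TensorProduct.AlgebraTensorModule.curry_injective
      ext; simp
    map_smul' a φ := by
      rw [RingHom.id_apply, ← algebraMap_smul K a (LinearEquiv.symm _ _), ← map_smul]; congr 1
      apply TensorProduct.AlgebraTensorModule.curry_injective
      ext; simp [Algebra.smul_def] }

theorem trace_traceDual_mul (hd : algebraMap A K (Algebra.discr A b) ≠ 0) (φ : R →ₗ[A] A) (r : R) :
    Algebra.trace K (K ⊗[A] R) (traceDual b K hd φ * (1 ⊗ₜ r)) = algebraMap A K (φ r) := by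
  have := Module.Finite.of_basis b
  have h1 := LinearMap.BilinForm.apply_toDual_symm_apply
    (hB := Algebra.traceForm_nondegenerate_of_discr b K hd)
    ((Algebra.linearMap A K ∘ₗ φ).liftBaseChange K) (1 ⊗ₜ r)
  rw [Algebra.traceForm_apply] at h1
  refine Eq.trans h1 ?_
  simp

theorem eq_of_trace_mul_one_tmul_eq (hd : algebraMap A K (Algebra.discr A b) ≠ 0) {y z : K ⊗[A] R}
    (h : ∀ r : R, Algebra.trace K (K ⊗[A] R) (y * (1 ⊗ₜ r)) =
      Algebra.trace K (K ⊗[A] R) (z * (1 ⊗ₜ r))) : y = z := by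
  rw [← sub_eq_zero]
  refine (Algebra.traceForm_nondegenerate_of_discr b K hd).1 (y - z) fun x => ?_
  rw [Algebra.traceForm_apply]
  induction x using TensorProduct.induction_on with
  | zero => simp
  | tmul c r =>
    have : (y - z) * (c ⊗ₜ[A] r) = c • ((y - z) * (1 ⊗ₜ r)) := by
      rw [← mul_smul_comm, TensorProduct.smul_tmul', smul_eq_mul, mul_one]
    rw [this, map_smul, sub_mul, map_sub, h r, sub_self, smul_zero]
  | add x y hx hy => rw [mul_add, map_add, hx, hy, add_zero]

theorem traceDual_injective (hd : algebraMap A K (Algebra.discr A b) ≠ 0)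
    (hK : Function.Injective (algebraMap A K)) : Function.Injective (traceDual b K hd) := by
  intro φ ψ h
  ext r
  apply hK
  rw [← trace_traceDual_mul b K hd, h, trace_traceDual_mul]

/-- This is what makes the codifferent a free dual module, so that it can be reduced modulo `h`. -/
theorem range_traceDual (hd : algebraMap A K (Algebra.discr A b) ≠ 0)
    (hK : Function.Injective (algebraMap A K)) :
    LinearMap.range (traceDual b K hd) = dedekindCodifferent A K R := by
  apply le_antisymm
  · rintro _ ⟨φ, rfl⟩ r
    exact ⟨φ r, (trace_traceDual_mul b K hd φ r).symm⟩
  · intro y hy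
    choose f hf using hy
    let φ : R →ₗ[A] A :=
      { toFun := f
        map_add' := fun r s => hK (by
          rw [map_add, hf, hf, hf, TensorProduct.tmul_add, mul_add, map_add])
        map_smul' := fun a r => hK (by
          rw [RingHom.id_apply, smul_eq_mul, map_mul, hf, hf, TensorProduct.tmul_smul,
            mul_smul_comm, ← algebraMap_smul K a (y * _), map_smul, smul_eq_mul]) }
    refine ⟨φ, eq_of_trace_mul_one_tmul_eq b K hd fun r => ?_⟩
    rw [trace_traceDual_mul]
    exact hf r

/-- Cramer's rule for the trace matrix: its adjugate produces an element of `R` that pairs with the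
basis as `discr • y` does. -/
theorem discr_smul_mem_imageInTotal (hd : algebraMap A K (Algebra.discr A b) ≠ 0)
    {y : K ⊗[A] R} (hy : y ∈ dedekindCodifferent A K R) :
    Algebra.discr A b • y ∈ imageInTotal A K R := by
  have := Module.Free.of_basis b
  have := Module.Finite.of_basis b
  choose f hf using hy
  let M := Algebra.traceMatrix A b
  let a : ι → A := fun i => f (b i)
  let c : ι → A := M.adjugate.mulVec a
  refine ⟨∑ i, c i • b i, eq_of_trace_mul_one_tmul_eq b K hd fun r => ?_⟩
  have key : ∀ j, Algebra.trace A R ((∑ i, c i • b i) * b j) = Algebra.discr A b * a j := by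
    intro j
    have h1 : M.mulVec c j = (Algebra.discr A b • a) j := by
      simp only [c]
      rw [Matrix.mulVec_mulVec, Matrix.mul_adjugate, Matrix.smul_mulVec, Matrix.one_mulVec]
      rfl
    rw [Pi.smul_apply, smul_eq_mul] at h1
    rw [← h1, Finset.sum_mul, map_sum]
    simp only [Matrix.mulVec, dotProduct, M, Algebra.traceMatrix_apply, Algebra.traceForm_apply]
    refine Finset.sum_congr rfl fun i _ => ?_
    rw [smul_mul_assoc, map_smul, smul_eq_mul, mul_comm, mul_comm (b i)]
  have h2 : ∀ r, Algebra.trace K (K ⊗[A] R) ((1 ⊗ₜ (∑ i, c i • b i)) * (1 ⊗ₜ r)) =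
      Algebra.trace K (K ⊗[A] R) (Algebra.discr A b • y * (1 ⊗ₜ r)) := by
    intro r
    induction b.mem_span r using Submodule.span_induction with
    | zero => simp
    | add r s _ _ hr hs => simp only [TensorProduct.tmul_add, mul_add, map_add, hr, hs]
    | smul t r _ hr =>
      simp only [TensorProduct.tmul_smul, mul_smul_comm, LinearMap.map_smul_of_tower, hr]
    | mem r hr =>
      obtain ⟨j, rfl⟩ := hr
      rw [Algebra.TensorProduct.tmul_mul_tmul, one_mul, Algebra.trace_one_tmul, key, map_mul, hf,
        smul_mul_assoc, LinearMap.map_smul_of_tower, Algebra.smul_def]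
  exact h2 r

theorem CodifferentQuotient.finite [IsNoetherianRing A]
    (hd : algebraMap A K (Algebra.discr A b) ≠ 0) (hK : Function.Injective (algebraMap A K)) :
    Module.Finite A (CodifferentQuotient A K R) := by
  have := Module.Free.of_basis b
  have := Module.Finite.of_basis b
  have h1 : Module.Finite A (dedekindCodifferent A K R) := by
    rw [← range_traceDual b K hd hK]
    infer_instance
  exact Module.Finite.of_surjective
    ((imageInTotal A K R).submoduleOf (dedekindCodifferent A K R)).mkQ
    (Submodule.mkQ_surjective _)

theorem mem_annihilatingExponents_of_discr_dvd (hd : algebraMap A K (Algebra.discr A b) ≠ 0)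
    {g : A} {n : ℕ} (hn : Algebra.discr A b ∣ g ^ n) : n ∈ annihilatingExponents K R g := by
  obtain ⟨c, hc⟩ := hn
  change Ideal.span {g ^ n} ≤ _
  rw [Ideal.span_singleton_le_iff_mem, Module.mem_annihilator]
  intro m
  obtain ⟨y, rfl⟩ := Submodule.mkQ_surjective
    ((imageInTotal A K R).submoduleOf (dedekindCodifferent A K R)) m
  refine (Submodule.Quotient.mk_eq_zero (x := g ^ n • y) _).2 ?_
  change g ^ n • (y : K ⊗[A] R) ∈ imageInTotal A K R
  rw [hc, mul_comm, mul_smul]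
  exact Submodule.smul_mem _ c (discr_smul_mem_imageInTotal b K hd y.2)

/-- Nonemptiness is essential: only then is the infimum attained, `sInf ∅` being `0`. -/
theorem pow_leastExponent_smul_eq_zero (g : A) (hne : (annihilatingExponents K R g).Nonempty)
    (m : CodifferentQuotient A K R) : g ^ leastExponent K R g • m = 0 := by
  have h : leastExponent K R g ∈ annihilatingExponents K R g := Nat.sInf_mem hne
  exact Module.mem_annihilator.1 (h (Ideal.subset_span rfl)) m

end TraceDual

/-! ## Functionals modulo a prime, and functionals given by traces -/

section Functionals

variable (A R κ : Type*) [CommRing A] [CommRing R] [Algebra A R] [CommRing κ] [Algebra A κ]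

/-- The functionals `R → κ` of the form `r ↦ Tr (s r)`. -/
def traceFunctional : R →ₗ[A] (R →ₗ[A] κ) :=
  LinearMap.compRight (M := R) A (Algebra.linearMap A κ) ∘ₗ Algebra.traceForm A R

theorem traceFunctional_apply (s r : R) :
    traceFunctional A R κ s r = algebraMap A κ (Algebra.trace A R (s * r)) := rfl

/-- The functionals `R → κ` that come from functionals `R → A`, modulo those given by traces. -/
def functionalQuotient : Submodule A ((R →ₗ[A] κ) ⧸ LinearMap.range (traceFunctional A R κ)) :=
  LinearMap.range ((LinearMap.range (traceFunctional A R κ)).mkQ ∘ₗ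
    LinearMap.compRight (M := R) A (Algebra.linearMap A κ))

variable {A R ι : Type*} [CommRing A] [CommRing R] [Algebra A R] [Fintype ι] [DecidableEq ι]
  (b : Module.Basis ι A R) (K : Type*) [Field K] [Algebra A K] (κ : Type*) [CommRing κ]
  [Algebra A κ]

/-- Under the identification of the codifferent with `Hom_A(R, A)`, the submodule `R` consists of
the trace functionals `r ↦ Tr(s r)`. Composing functionals with `A → κ` therefore induces a map on
the quotients. -/
theorem exists_surjective_codifferentQuotient (hd : algebraMap A K (Algebra.discr A b) ≠ 0)
    (hK : Function.Injective (algebraMap A K)) :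
    ∃ f : CodifferentQuotient A K R →ₗ[A] functionalQuotient A R κ, Function.Surjective f := by
  have := Module.Free.of_basis b
  have := Module.Finite.of_basis b
  let e : (R →ₗ[A] A) ≃ₗ[A] dedekindCodifferent A K R :=
    (LinearEquiv.ofInjective (traceDual b K hd) (traceDual_injective b K hd hK)).trans
      (LinearEquiv.ofEq _ _ (range_traceDual b K hd hK))
  let q : (R →ₗ[A] A) →ₗ[A] functionalQuotient A R κ := LinearMap.rangeRestrict _
  have hq : Function.Surjective q := LinearMap.surjective_rangeRestrict _
  have hle : (imageInTotal A K R).submoduleOf (dedekindCodifferent A K R) ≤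
      LinearMap.ker (q ∘ₗ e.symm.toLinearMap) := by
    rintro y hy
    obtain ⟨s, hs⟩ := hy
    obtain ⟨φ, rfl⟩ := e.surjective y
    have hφ : φ = Algebra.traceForm A R s := by
      ext r
      apply hK
      rw [← trace_traceDual_mul b K hd φ r, Algebra.traceForm_apply, ← Algebra.trace_one_tmul K]
      have : traceDual b K hd φ = (1 : K) ⊗ₜ[A] s := hs.symm
      rw [this, Algebra.TensorProduct.tmul_mul_tmul, one_mul]
    rw [LinearMap.mem_ker, LinearMap.comp_apply, LinearEquiv.coe_coe, LinearEquiv.symm_apply_apply,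
      hφ]
    exact Subtype.ext ((Submodule.Quotient.mk_eq_zero _).2 ⟨s, rfl⟩)
  refine ⟨Submodule.liftQ _ (q ∘ₗ e.symm.toLinearMap) hle, ?_⟩
  intro z
  obtain ⟨φ, rfl⟩ := hq z
  refine ⟨Submodule.Quotient.mk (e φ), ?_⟩
  erw [Submodule.liftQ_apply]
  simp

/-- As a quotient of `𝔠(R/A)/R` the module is generated by `s` elements and killed by `g^r`; it is
also killed by `h`, because the functionals take values in `κ`. -/
theorem length_functionalQuotient_le [IsNoetherianRing A] (g h : A)
    (hκ : algebraMap A κ h = 0) (hd : algebraMap A K (Algebra.discr A b) ≠ 0)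
    (hK : Function.Injective (algebraMap A K)) (hne : (annihilatingExponents K R g).Nonempty) :
    Module.length A (functionalQuotient A R κ) ≤
      (leastExponent K R g : ℕ∞) * (codifferentGenerators A K R : ℕ∞) *
        Module.length A (A ⧸ Ideal.span {g, h}) := by
  obtain ⟨f, hf⟩ := exists_surjective_codifferentQuotient b K κ hd hK
  have hfin := CodifferentQuotient.finite b K hd hK
  have hfg : (⊤ : Submodule A (CodifferentQuotient A K R)).FG := Module.Finite.fg_top
  let s := (⊤ : Submodule A (CodifferentQuotient A K R)).generators
  have hs : s.ncard = codifferentGenerators A K R := hfg.generators_ncard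
  have hsf : s.Finite := hfg.finite_generators
  have hspan : Submodule.span A s = ⊤ := Submodule.span_generators _
  let e : s ≃ Fin (codifferentGenerators A K R) := by
    have := hsf.fintype
    exact Fintype.equivFinOfCardEq (by rw [← hs, Set.ncard_eq_toFinset_card', Set.toFinset_card])
  have h1 := Module.length_le_of_generators (M := functionalQuotient A R κ)
    (Ideal.span {g ^ leastExponent K R g, h}) (by
      intro a ha m
      have hle : Ideal.span {g ^ leastExponent K R g, h} ≤
          Module.annihilator A (functionalQuotient A R κ) := by
        rw [Ideal.span_le]
        rintro x (rfl | rfl)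
        · refine Module.mem_annihilator.2 fun m => ?_
          obtain ⟨n, rfl⟩ := hf m
          rw [← map_smul, pow_leastExponent_smul_eq_zero K g hne, map_zero]
        · refine Module.mem_annihilator.2 fun m => ?_
          obtain ⟨φ, hφ⟩ := Submodule.Quotient.mk_surjective _ m.1
          refine Subtype.ext ?_
          rw [Submodule.coe_smul, ← hφ, ← Submodule.Quotient.mk_smul]
          have h0 : x • φ = 0 := by
            ext r
            rw [LinearMap.smul_apply, Algebra.smul_def, hκ, zero_mul, LinearMap.zero_apply]
          rw [h0]
          rfl
      exact Module.mem_annihilator.1 (hle ha) m)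
    (fun i => f (e.symm i).1) (by
      have : Set.range (fun i => f (e.symm i).1) = f '' s := by
        ext z
        constructor
        · rintro ⟨i, rfl⟩; exact ⟨_, (e.symm i).2, rfl⟩
        · rintro ⟨w, hw, rfl⟩; exact ⟨e ⟨w, hw⟩, by simp⟩
      rw [this, ← Submodule.map_span, hspan, Submodule.map_top, LinearMap.range_eq_top.2 hf])
  refine h1.trans ?_
  calc _ ≤ (codifferentGenerators A K R : ℕ∞) *
        (leastExponent K R g * Module.length A (A ⧸ Ideal.span {g, h})) := by
        gcongr; exact Module.length_quotient_pow_le g h _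
    _ = _ := by ring

end Functionals

/-! ## Integral elements of the generic fibre along a prime -/

section GenericFibre

variable {A R ι : Type*} [CommRing A] [CommRing R] [Algebra A R] [Fintype ι]
  (b : Module.Basis ι A R) (p : Ideal A) (κ : Type*) [Field κ] [Algebra A κ]
  [Algebra (A ⧸ p) κ] [IsScalarTower A (A ⧸ p) κ] [IsFractionRing (A ⧸ p) κ]

theorem exists_algebraMap_eq_of_isIntegral [IsIntegrallyClosed (A ⧸ p)] {z : κ}
    (hz : IsIntegral A z) : ∃ a : A, algebraMap A κ a = z := by
  have h1 : IsIntegral (A ⧸ p) z := hz.tower_top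
  obtain ⟨y, hy⟩ := IsIntegrallyClosed.isIntegral_iff.1 h1
  obtain ⟨a, rfl⟩ := Ideal.Quotient.mk_surjective y
  exact ⟨a, by rw [IsScalarTower.algebraMap_apply A (A ⧸ p) κ]; exact hy⟩

/-- The functional `r ↦ Tr (w r)` on `R` for `w ∈ κ ⊗ R`. -/
def fibreTrace : κ ⊗[A] R →ₗ[A] (R →ₗ[A] κ) :=
  LinearMap.mk₂ A (fun w r => Algebra.trace κ (κ ⊗[A] R) (w * (1 ⊗ₜ r)))
    (fun w v r => by rw [add_mul, map_add])
    (fun a w r => by rw [smul_mul_assoc, LinearMap.map_smul_of_tower])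
    (fun w r s => by rw [TensorProduct.tmul_add, mul_add, map_add])
    (fun a w r => by rw [TensorProduct.tmul_smul, mul_smul_comm, LinearMap.map_smul_of_tower])

theorem fibreTrace_apply (w : κ ⊗[A] R) (r : R) :
    fibreTrace κ w r = Algebra.trace κ (κ ⊗[A] R) (w * (1 ⊗ₜ r)) := rfl

include b in
theorem fibreTrace_one_tmul (s : R) : fibreTrace κ (1 ⊗ₜ[A] s) = traceFunctional A R κ s := by
  have := Module.Free.of_basis b
  have := Module.Finite.of_basis b
  ext r
  rw [fibreTrace_apply, traceFunctional_apply, Algebra.TensorProduct.tmul_mul_tmul, one_mul,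
    Algebra.trace_one_tmul]

theorem fibreTrace_injective [DecidableEq ι] (hd : algebraMap A κ (Algebra.discr A b) ≠ 0) :
    Function.Injective (fibreTrace κ : κ ⊗[A] R →ₗ[A] (R →ₗ[A] κ)) := fun _ _ h =>
  eq_of_trace_mul_one_tmul_eq b κ hd fun r => LinearMap.congr_fun h r

include b p in
-- The traces of `w` times the basis elements are integral over `A`, so they lie in the normal ring
-- `A/p`. They can be lifted to `A` independently because `R` is free.
theorem exists_lift_fibreTrace [IsIntegrallyClosed (A ⧸ p)] {w : κ ⊗[A] R} (hw : IsIntegral A w) :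
    ∃ φ : R →ₗ[A] A, Algebra.linearMap A κ ∘ₗ φ = fibreTrace κ w := by
  have := Module.Free.of_basis b
  have := Module.Finite.of_basis b
  have h1 : ∀ i, ∃ a : A, algebraMap A κ a = fibreTrace κ w (b i) := by
    intro i
    refine exists_algebraMap_eq_of_isIntegral p κ ?_
    rw [fibreTrace_apply]
    refine Algebra.isIntegral_trace_of_finite (hw.mul ?_)
    exact (IsIntegral.of_finite A (b i)).map (Algebra.TensorProduct.includeRight : R →ₐ[A] κ ⊗[A] R)
  choose a ha using h1
  refine ⟨b.constr A a, b.ext fun i => ?_⟩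
  rw [LinearMap.comp_apply, Module.Basis.constr_basis, ← ha]
  rfl

/-- The image of `R` inside the integral closure of `A` in `κ ⊗ R`. -/
def imageInIntegralClosure (A R κ : Type*) [CommRing A] [CommRing R] [Algebra A R] [CommRing κ]
    [Algebra A κ] : Submodule A (integralClosure A (κ ⊗[A] R)) :=
  (LinearMap.range (Algebra.TensorProduct.includeRight : R →ₐ[A] κ ⊗[A] R).toLinearMap).comap
    (integralClosure A (κ ⊗[A] R)).val.toLinearMap

/-- The trace functional of an integral element reduces a functional with values in `A`. By
nondegeneracy it is one of the functionals `r ↦ Tr(s r)` only if the element comes from `R`, so the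
map on quotients is injective. -/
theorem length_integralClosure_quotient_le_functionalQuotient [DecidableEq ι]
    [IsIntegrallyClosed (A ⧸ p)]
    (hd : algebraMap A κ (Algebra.discr A b) ≠ 0) :
    Module.length A (integralClosure A (κ ⊗[A] R) ⧸ imageInIntegralClosure A R κ) ≤
      Module.length A (functionalQuotient A R κ) := by
  let f : integralClosure A (κ ⊗[A] R) →ₗ[A] functionalQuotient A R κ :=
    LinearMap.codRestrict _ ((LinearMap.range (traceFunctional A R κ)).mkQ ∘ₗ fibreTrace κ ∘ₗ
      (integralClosure A (κ ⊗[A] R)).val.toLinearMap) (by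
        intro w
        obtain ⟨φ, hφ⟩ := exists_lift_fibreTrace b p κ w.2
        exact ⟨φ, congrArg _ hφ⟩)
  have hker : LinearMap.ker f = imageInIntegralClosure A R κ := by
    ext w
    rw [LinearMap.mem_ker]
    have h1 : f w = 0 ↔ fibreTrace κ (w : κ ⊗[A] R) ∈ LinearMap.range (traceFunctional A R κ) := by
      rw [← Submodule.Quotient.mk_eq_zero, Subtype.ext_iff]
      rfl
    rw [h1]
    constructor
    · rintro ⟨s, hs⟩
      refine ⟨s, fibreTrace_injective b κ hd ?_⟩
      rw [← fibreTrace_one_tmul b] at hs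
      exact hs
    · rintro ⟨s, hs⟩
      refine ⟨s, ?_⟩
      rw [← fibreTrace_one_tmul b]
      exact congrArg _ hs
  rw [← hker]
  exact Module.length_le_of_injective ((LinearMap.ker f).liftQ f le_rfl)
    (LinearMap.ker_eq_bot.1 (Submodule.ker_liftQ_eq_bot _ _ _ le_rfl))

include b p in
-- The trace form embeds the integral closure in the finite module of reductions of functionals `R →
-- A`.
theorem integralClosure_fibre_finite [DecidableEq ι] [IsNoetherianRing A] [IsIntegrallyClosed (A ⧸ p)]
    (hd : algebraMap A κ (Algebra.discr A b) ≠ 0) :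
    Module.Finite A (integralClosure A (κ ⊗[A] R)) := by
  have := Module.Free.of_basis b
  have := Module.Finite.of_basis b
  let G : Submodule A (R →ₗ[A] κ) :=
    LinearMap.range (LinearMap.compRight (M := R) A (Algebra.linearMap A κ))
  let f : integralClosure A (κ ⊗[A] R) →ₗ[A] G :=
    LinearMap.codRestrict _ (fibreTrace κ ∘ₗ (integralClosure A (κ ⊗[A] R)).val.toLinearMap) (by
        intro w
        obtain ⟨φ, hφ⟩ := exists_lift_fibreTrace b p κ w.2
        exact ⟨φ, hφ⟩)
  refine Module.Finite.of_injective f fun w v h => ?_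
  exact Subtype.ext (fibreTrace_injective b κ hd (congrArg Subtype.val h))

/-- The powers of `x` stabilise, so `x^n (1 - x y) = 0` for some `y`. Then `x (1 - x y)` is
nilpotent, hence zero. This von Neumann regularity supplies the idempotents `x y` that isolate the
components of the fibre. -/
theorem exists_mul_mul_eq_self_of_isArtinianRing (F : Type*) [CommRing F] [IsArtinianRing F]
    [IsReduced F] (x : F) : ∃ y, x * x * y = x := by
  obtain ⟨n, y, hy⟩ := IsArtinian.exists_pow_succ_smul_dvd x (1 : F)
  refine ⟨y, ?_⟩
  simp only [smul_eq_mul, mul_one, Nat.succ_eq_add_one] at hy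
  have : IsNilpotent (x - x * x * y) := by
    refine ⟨n + 1, ?_⟩
    have h0 : x ^ n * (1 - x * y) = 0 := by linear_combination -hy
    calc (x - x * x * y) ^ (n + 1) = x * (x ^ n * (1 - x * y)) * (1 - x * y) ^ n := by
          rw [show x - x * x * y = x * (1 - x * y) by ring, mul_pow]; ring
      _ = 0 := by rw [h0]; ring
  exact (sub_eq_zero.1 this.eq_zero).symm

include b in
-- Multiples of a nilpotent are nilpotent and have trace zero in a field, so a nilpotent lies in the
-- radical of the nondegenerate trace form.
theorem fibre_isReduced [DecidableEq ι] (hd : algebraMap A κ (Algebra.discr A b) ≠ 0) :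
    IsReduced (κ ⊗[A] R) := by
  have := Module.Finite.of_basis b
  have := Module.Free.of_basis b
  refine ⟨fun x hx => ?_⟩
  refine (Algebra.traceForm_nondegenerate_of_discr b κ hd).1 x fun y => ?_
  rw [Algebra.traceForm_apply]
  have h1 : IsNilpotent (x * y) := (Commute.all x y).isNilpotent_mul_right hx
  exact (Algebra.isNilpotent_trace_of_isNilpotent h1).eq_zero

include b in
theorem exists_mul_mul_eq_self_fibre [DecidableEq ι] (hd : algebraMap A κ (Algebra.discr A b) ≠ 0)
    (x : κ ⊗[A] R) : ∃ y, x * x * y = x := by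
  have := Module.Finite.of_basis b
  have := fibre_isReduced b κ hd
  have : IsArtinianRing (κ ⊗[A] R) := IsArtinianRing.of_finite κ _
  exact exists_mul_mul_eq_self_of_isArtinianRing _ x

end GenericFibre

/-! ## Points on exceptional divisors -/

section Points

variable {R K : Type*} [CommRing R] [Field K] [Algebra R K]

theorem LocalPoint.ext_ring {R K : Type*} [CommRing R] [CommRing K] [Algebra R K] {P Q : LocalPoint R K} (h : P.ring = Q.ring) : P = Q := by
  cases P; cases Q; cases h; rfl

/-- `Q` is a closed point of the exceptional divisor over `P` in the chart of `t`: the facts about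
the inclusion of local rings that are used. -/
structure IsChartPoint (P Q : LocalPoint R K) (t : P.ring) : Prop where
  mem_maximalIdeal : t ∈ maximalIdeal P.ring
  ne_zero : (t : K) ≠ 0
  le : P.ring ≤ Q.ring
  div_mem : ∀ z ∈ maximalIdeal P.ring, (z : K) / t ∈ Q.ring
  param_mem : Subalgebra.inclusion le t ∈ maximalIdeal Q.ring
  exists_eq_div : ∀ x : Q.ring, ∃ a b : blowupChart P (t : K), ∃ hb : (b : K) ∈ Q.ring,
    IsUnit (⟨b, hb⟩ : Q.ring) ∧ (x : K) * b = a

theorem le_blowupChart (P : LocalPoint R K) (t : K) : P.ring ≤ blowupChart P t :=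
  fun _ hx => Algebra.subset_adjoin (Or.inl hx)

theorem div_mem_blowupChart (P : LocalPoint R K) {t : K} (ht : t ≠ 0) {z : P.ring}
    (hz : z ∈ maximalIdeal P.ring) : (z : K) / t ∈ blowupChart P t :=
  Algebra.subset_adjoin (Or.inr ⟨z, hz, div_mul_cancel₀ _ ht⟩)

theorem blowupChart_le (P Q : LocalPoint R K) {t : K} (ht : t ≠ 0) (hle : P.ring ≤ Q.ring)
    (hdiv : ∀ z ∈ maximalIdeal P.ring, (z : K) / t ∈ Q.ring) : blowupChart P t ≤ Q.ring := by
  refine Algebra.adjoin_le ?_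
  rintro x (hx | ⟨a, ha, h⟩)
  · exact hle hx
  · have : x = a / t := by rw [← h]; field_simp
    rw [this]
    exact hdiv a ha

theorem exists_mul_pow_mem_of_mem_blowupChart (P : LocalPoint R K) (t : P.ring) {x : K}
    (hx : x ∈ blowupChart P (t : K)) : ∃ n : ℕ, x * (t : K) ^ n ∈ P.ring := by
  induction hx using Algebra.adjoin_induction with
  | mem x hx =>
    rcases hx with hx | ⟨a, -, h⟩
    · exact ⟨0, by simpa using hx⟩
    · exact ⟨1, by rw [pow_one, h]; exact a.2⟩
  | algebraMap r => exact ⟨0, by simp⟩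
  | add x y _ _ hx hy =>
    obtain ⟨m, hm⟩ := hx
    obtain ⟨n, hn⟩ := hy
    refine ⟨m + n, ?_⟩
    have : (x + y) * (t : K) ^ (m + n) = x * t ^ m * t ^ n + y * t ^ n * t ^ m := by ring
    rw [this]
    exact add_mem (mul_mem hm (pow_mem t.2 n)) (mul_mem hn (pow_mem t.2 m))
  | mul x y _ _ hx hy =>
    obtain ⟨m, hm⟩ := hx
    obtain ⟨n, hn⟩ := hy
    refine ⟨m + n, ?_⟩
    have : (x * y) * (t : K) ^ (m + n) = (x * t ^ m) * (y * t ^ n) := by ring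
    rw [this]
    exact mul_mem hm hn

theorem IsOnExceptionalDivisor.exists_isChartPoint {P Q : LocalPoint R K}
    (hPQ : IsOnExceptionalDivisor P Q) : ∃ t : P.ring, IsChartPoint P Q t := by
  obtain ⟨t, ht, hu, q, hq, ⟨c, hcq, hct⟩, hQ⟩ := hPQ
  have ht0 : (t : K) ≠ 0 := hu.ne_zero
  have h1q : (1 : blowupChart P (t : K)) ∉ q := (Ideal.ne_top_iff_one q).1 hq.ne_top
  have hmem : ∀ x : K, x ∈ Q.ring ↔ ∃ a b : blowupChart P (t : K), b ∉ q ∧ x * (b : K) = a :=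
    fun x => Set.ext_iff.1 hQ x
  have hchart : ∀ a : blowupChart P (t : K), (a : K) ∈ Q.ring := fun a =>
    (hmem _).2 ⟨a, 1, h1q, by simp⟩
  have hle : P.ring ≤ Q.ring := fun x hx => hchart ⟨x, le_blowupChart P _ hx⟩
  refine ⟨t, ht, ht0, hle, fun z hz => hchart ⟨_, div_mem_blowupChart P ht0 hz⟩, ?_, ?_⟩
  -- If `t` had an inverse `a / b` with `b ∉ q`, then `b = t a` would lie in `q`.
  · rw [mem_maximalIdeal, mem_nonunits_iff]
    intro hunit
    obtain ⟨y, hy⟩ := hunit.exists_right_inv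
    obtain ⟨a, b, hb, hab⟩ := (hmem y).1 y.2
    have hy' : (t : K) * y = 1 := congrArg Subtype.val hy
    apply hb
    have : b = c * a := by
      apply Subtype.ext
      rw [MulMemClass.coe_mul, hct, ← hab]
      linear_combination -(b : K) * hy'
    rw [this]
    exact q.mul_mem_right _ hcq
  · intro x
    obtain ⟨a, b, hb, hab⟩ := (hmem x).1 x.2
    refine ⟨a, b, hchart b, ?_, hab⟩
    have hb0 : (b : K) ≠ 0 := fun h0 => hb (by
      have : b = 0 := Subtype.ext h0
      rw [this]; exact q.zero_mem)
    have hinv : (b : K)⁻¹ ∈ Q.ring := (hmem _).2 ⟨1, b, hb, by simp [hb0]⟩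
    exact IsUnit.of_mul_eq_one ⟨_, hinv⟩ (Subtype.ext (by simp [hb0]))

variable {P Q : LocalPoint R K} {t : P.ring}

theorem IsChartPoint.isLocalHom (h : IsChartPoint P Q t) {z : P.ring}
    (hz : z ∈ maximalIdeal P.ring) : Subalgebra.inclusion h.le z ∈ maximalIdeal Q.ring := by
  have : Subalgebra.inclusion h.le z = Subalgebra.inclusion h.le t * ⟨_, h.div_mem z hz⟩ :=
    Subtype.ext (by
      have := h.ne_zero
      simp only [Subalgebra.coe_inclusion, MulMemClass.coe_mul]
      field_simp)
  rw [this]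
  exact Ideal.mul_mem_right _ _ h.param_mem

/-- Clearing powers of `t` turns fractions of the chart into fractions over `P`. Up to a unit at `Q`
the new denominator is a power of `t`, which is the form needed to pass comparability from `P` to
`Q`. -/
theorem IsChartPoint.exists_frac (h : IsChartPoint P Q t) (x : Q.ring) :
    ∃ (a b : P.ring) (n : ℕ) (u : Q.ring), IsUnit u ∧ (b : K) = u * (t : K) ^ n ∧
      (x : K) * b = a := by
  obtain ⟨a, b, hb, hu, hab⟩ := h.exists_eq_div x
  obtain ⟨m, hm⟩ := exists_mul_pow_mem_of_mem_blowupChart P t a.2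
  obtain ⟨n, hn⟩ := exists_mul_pow_mem_of_mem_blowupChart P t b.2
  refine ⟨⟨_, mul_mem hm (pow_mem t.2 n)⟩, ⟨_, mul_mem hn (pow_mem t.2 m)⟩, n + m, ⟨b, hb⟩, hu, ?_,
    ?_⟩
  · simp only []; ring
  · simp only [← hab]; ring

end Points

/-! ## Infinitely near points and the curve cut out by a parameter of the base -/

section Curve

variable {A R K : Type*} [CommRing A] [CommRing R] [Field K] [Algebra A R] [Algebra R K]
  [Algebra A K] [IsScalarTower A R K] (h : A)

/-- The properties of infinitely near points that are used to compare their local rings with `R`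
along the prime divisor `h = 0` of the base. -/
structure IsComparable [IsLocalRing R] (P : LocalPoint R K) : Prop where
  isLocalHom : ∀ r ∈ maximalIdeal R, algebraMap R P.ring r ∈ maximalIdeal P.ring
  exists_frac : ∀ y : P.ring, ∃ (a r : R) (y' : P.ring), ∃ c ∉ Ideal.span {h},
    y * algebraMap R P.ring r = algebraMap R P.ring a ∧
      algebraMap R P.ring r * y' = algebraMap A P.ring c

theorem IsComparable.of_eq_bot [IsLocalRing R] (hh : Ideal.span {h} ≠ ⊤)
    {P : LocalPoint R K} (hP : P.ring = ⊥) (hinj : Function.Injective (algebraMap R K)) :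
    IsComparable h P := by
  have hsurj : ∀ y : P.ring, ∃ a, algebraMap R P.ring a = y := by
    intro y
    have hy : (y : K) ∈ (⊥ : Subalgebra R K) := by rw [← hP]; exact y.2
    obtain ⟨a, ha⟩ := Algebra.mem_bot.1 hy
    exact ⟨a, Subtype.ext ha⟩
  constructor
  · intro r hr
    rw [mem_maximalIdeal, mem_nonunits_iff] at hr ⊢
    intro hu
    apply hr
    obtain ⟨y, hy⟩ := hu.exists_right_inv
    obtain ⟨a, rfl⟩ := hsurj y
    refine IsUnit.of_mul_eq_one a (hinj ?_)
    rw [map_mul, map_one]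
    exact congrArg Subtype.val hy
  · intro y
    obtain ⟨a, rfl⟩ := hsurj y
    exact ⟨a, 1, 1, 1, (Ideal.ne_top_iff_one _).1 hh, by simp, by simp⟩

/-- The only new denominators are powers of `t`. Since `g` lies in the maximal ideal at `P`, `t`
divides `g` at `Q`, so these denominators divide powers of `g`, which stay outside the prime `(h)`.
-/
theorem IsComparable.of_isChartPoint [IsLocalRing R] [hp : (Ideal.span {h}).IsPrime] {g : A}
    (hg : algebraMap A R g ∈ maximalIdeal R) (hgh : g ∉ Ideal.span {h})
    {P Q : LocalPoint R K} {t : P.ring} (hP : IsComparable h P) (hPQ : IsChartPoint P Q t) :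
    IsComparable h Q := by
  have ht0 := hPQ.ne_zero
  refine ⟨fun r hr => hPQ.isLocalHom (hP.isLocalHom r hr), fun x => ?_⟩
  obtain ⟨a, b, n, u, hu, hb, hab⟩ := hPQ.exists_frac x
  obtain ⟨a₁, r₁, y₁, c₁, hc₁, h₁, h₁'⟩ := hP.exists_frac a
  obtain ⟨a₂, r₂, y₂, c₂, hc₂, h₂, h₂'⟩ := hP.exists_frac b
  obtain ⟨v, hv⟩ := hu.exists_right_inv
  have hgP := hP.isLocalHom _ hg
  -- The cofactor `g / t`; its `n`-th power completes `t^n` to `g^n`.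
  let w : Q.ring := ⟨_, hPQ.div_mem _ hgP⟩
  have hw : (w : K) * t = algebraMap A K g := by
    simp only [w]
    rw [div_mul_cancel₀ _ ht0, IsScalarTower.algebraMap_apply A R K]
    rfl
  have e1 : (a : K) * algebraMap R K r₁ = algebraMap R K a₁ := congrArg Subtype.val h₁
  have e1' : algebraMap R K r₁ * (y₁ : K) = algebraMap A K c₁ := congrArg Subtype.val h₁'
  have e2 : (b : K) * algebraMap R K r₂ = algebraMap R K a₂ := congrArg Subtype.val h₂
  have e2' : algebraMap R K r₂ * (y₂ : K) = algebraMap A K c₂ := congrArg Subtype.val h₂'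
  have ev : (u : K) * v = 1 := congrArg Subtype.val hv
  refine ⟨a₁ * r₂, r₁ * a₂, ⟨y₁, hPQ.le y₁.2⟩ * ⟨y₂, hPQ.le y₂.2⟩ * v * w ^ n, c₁ * c₂ * g ^ n, ?_,
    Subtype.ext ?_, Subtype.ext ?_⟩
  · intro hmem
    rcases hp.mem_or_mem hmem with hmem | hmem
    · exact (hp.mem_or_mem hmem).elim hc₁ hc₂
    · exact hgh (hp.mem_of_pow_mem n hmem)
  · change (x : K) * algebraMap R K (r₁ * a₂) = algebraMap R K (a₁ * r₂)
    rw [map_mul, map_mul, ← e1, ← e2, ← hab]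
    ring
  · change algebraMap R K (r₁ * a₂) * ((y₁ : K) * y₂ * v * (w : K) ^ n) =
      algebraMap A K (c₁ * c₂ * g ^ n)
    rw [map_mul, map_mul, map_mul, map_pow, ← hw, ← e1', ← e2', ← e2, hb]
    linear_combination (algebraMap R K r₁ * y₁ * algebraMap R K r₂ * y₂ * t ^ n * w ^ n) * ev

theorem mem_span_singleton_smul_top_iff {M : Type*} [AddCommGroup M] [Module A M] (x : M) :
    x ∈ (Ideal.span {h} • ⊤ : Submodule A M) ↔ ∃ y, h • y = x := by
  rw [Submodule.ideal_span_singleton_smul, Submodule.mem_smul_pointwise_iff_exists]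
  simp

variable (κ : Type*) [Field κ] [Algebra A κ] [Algebra (A ⧸ Ideal.span {h}) κ]
  [IsScalarTower A (A ⧸ Ideal.span {h}) κ] [IsFractionRing (A ⧸ Ideal.span {h}) κ]

/-- The strict transform is the kernel of the map to the generic fibre along `h = 0`. -/
theorem mem_strictTransform_iff [IsLocalRing R] {g : A}
    (hg : algebraMap A R g ∈ maximalIdeal R) (hgh : g ∉ Ideal.span {h})
    (hpar : ∀ c ∉ Ideal.span {h}, ∀ b ∈ maximalIdeal R, ∃ n,
      b ^ n ∈ Ideal.span {algebraMap A R h, algebraMap A R c})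
    (P : LocalPoint R K) (a : P.ring) :
    a ∈ strictTransform (algebraMap A R h) P ↔ (1 : κ) ⊗ₜ[A] a = 0 := by
  have hp : (Ideal.span {h}).IsPrime := by
    have : IsDomain (A ⧸ Ideal.span {h}) :=
      (FaithfulSMul.algebraMap_injective (A ⧸ Ideal.span {h}) κ).isDomain
    exact (Ideal.Quotient.isDomain_iff_prime _).1 this
  rw [one_tmul_eq_zero_iff (Ideal.span {h})]
  simp only [mem_span_singleton_smul_top_iff]
  constructor
  -- The single test function `g` suffices, its powers being units in the fibre.
  · intro ha
    obtain ⟨n, hn⟩ := ha _ hg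
    obtain ⟨y, hy⟩ := Ideal.mem_span_singleton'.1 hn
    refine ⟨g ^ n, fun hmem => hgh (hp.mem_of_pow_mem n hmem), y, ?_⟩
    rw [Algebra.smul_def, Algebra.smul_def, map_pow, mul_comm,
      IsScalarTower.algebraMap_apply A R P.ring, hy, IsScalarTower.algebraMap_apply A R P.ring]
  -- Conversely, `c a` is a multiple of `h` at `P`, and a power of every `b` in the maximal ideal of
  -- `R` is a combination of `h` and `c`.
  · rintro ⟨c, hc, y, hy⟩ b hb
    obtain ⟨n, hn⟩ := hpar c hc b hb
    obtain ⟨u, v, huv⟩ := Ideal.mem_span_pair.1 hn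
    refine ⟨n, ?_⟩
    rw [Ideal.mem_span_singleton']
    refine ⟨algebraMap R _ u * a + algebraMap R _ v * y, ?_⟩
    rw [Algebra.smul_def, Algebra.smul_def, IsScalarTower.algebraMap_apply A R P.ring,
      IsScalarTower.algebraMap_apply A R P.ring] at hy
    rw [← map_pow, ← huv, map_add, map_mul, map_mul]
    linear_combination algebraMap R P.ring v * hy

end Curve

/-! ## Integral elements and von Neumann regular rings -/

section Regular

open Polynomial

variable {A F F' : Type*} [CommRing A] [CommRing F] [CommRing F'] [Algebra A F] [Algebra A F']

theorem isIntegral_of_mul_self_eq {e : F} (he : e * e = e) : IsIntegral A e :=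
  ⟨X ^ 2 - X, (monic_X_pow_sub (n := 2) (degree_X_le.trans_lt (by norm_num))), by
    simp [pow_two, he]⟩

/-- Integral elements lift along surjections from von Neumann regular rings. -/
theorem exists_isIntegral_map_eq (hF : ∀ x : F, ∃ y, x * x * y = x) (ρ : F →ₐ[A] F')
    (hρ : Function.Surjective ρ) {x : F'} (hx : IsIntegral A x) :
    ∃ w, IsIntegral A w ∧ ρ w = x := by
  obtain ⟨w, rfl⟩ := hρ x
  obtain ⟨p, hp, hpw⟩ := hx
  obtain ⟨y, hy⟩ := hF (aeval w p)
  set u := aeval w p with hu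
  have hρu : ρ u = 0 := by rw [hu, ← aeval_algHom_apply]; exact hpw
  -- `u y` is the idempotent supporting the defect `u = p(w)`, and `ρ` kills it. The corrected lift
  -- is a root of `p` on the complementary component and is `0` on this one, whence the extra factor
  -- `X`.
  refine ⟨(1 - u * y) * w, ⟨X * p, monic_X.mul hp, ?_⟩, by simp [hρu]⟩
  have h1 : (1 - u * y) * w - w ∣ aeval ((1 - u * y) * w) p - u := by
    rw [hu]
    simpa only [eval_map_algebraMap] using
      sub_dvd_eval_sub ((1 - u * y) * w) w (p.map (algebraMap A F))
  obtain ⟨c, hc⟩ := h1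
  change aeval _ (X * p) = 0
  rw [map_mul, aeval_X, sub_eq_iff_eq_add.1 hc]
  linear_combination (-w + y * w * w * c) * hy

/-- An element of an algebra over a complete noetherian local ring is integral as soon as it is a
root of a polynomial with a unit coefficient and Krull's intersection theorem applies. -/
theorem isIntegral_of_aeval_eq_zero_of_isUnit [IsLocalRing A] [IsNoetherianRing A]
    [IsAdicComplete (maximalIdeal A) A] {x : F} {p : A[X]} (hp : aeval x p = 0) {i : ℕ}
    (hi : p.coeff i ∉ maximalIdeal A)
    (hx : ∀ r ∈ (maximalIdeal A).map (algebraMap A (Algebra.adjoin A {x})),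
      IsUnit (1 - (r : F))) : IsIntegral A x := by
  let C := Algebra.adjoin A {x}
  let I : Ideal C := (maximalIdeal A).map (algebraMap A C)
  let y : C := ⟨x, Algebra.self_mem_adjoin_singleton A x⟩
  have hnoeth : IsNoetherianRing C := by
    have : Algebra.FiniteType A C := (Subalgebra.fg_iff_finiteType _).1 ⟨{x}, by simp [C]⟩
    exact Algebra.FiniteType.isNoetherianRing A C
  have hsmul : ∀ n, ((maximalIdeal A) ^ n • ⊤ : Submodule A C) = (I ^ n).restrictScalars A := by
    intro n
    rw [Ideal.smul_top_eq_map, Ideal.map_pow]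
  -- By Krull, an element of all powers of `I` is killed by some `1 - r` with `r ∈ I`, and these are
  -- units in `F` by hypothesis.
  have hHaus : IsHausdorff (maximalIdeal A) C := by
    refine ⟨fun z hz => ?_⟩
    have hz' : z ∈ (⨅ i : ℕ, I ^ i • ⊤ : Submodule C C) := by
      rw [Submodule.mem_iInf]
      intro n
      have := hz n
      rw [SModEq.zero, hsmul] at this
      simpa using this
    rw [Ideal.mem_iInf_smul_pow_eq_bot_iff] at hz'
    obtain ⟨r, hr⟩ := hz'
    have h1 := hx r r.2
    have h2 : (1 - ((r : C) : F)) * (z : F) = 0 := by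
      have := congrArg (Subtype.val : C → F) hr
      simp only [smul_eq_mul, MulMemClass.coe_mul] at this
      linear_combination -this
    exact Subtype.ext ((h1.mul_right_eq_zero).1 h2)
  -- `C/I` is generated by one element over the residue field, and the unit coefficient makes the
  -- reduction of `p` a nonzero polynomial that it satisfies.
  have hfin : Module.Finite A (C ⧸ I) := by
    let k := A ⧸ maximalIdeal A
    let _ : Field k := Ideal.Quotient.field _
    let f : k →+* C ⧸ I := Ideal.quotientMap I (algebraMap A C) Ideal.le_comap_map
    let _ : Algebra k (C ⧸ I) := f.toAlgebra
    have : IsScalarTower A k (C ⧸ I) := .of_algebraMap_eq fun a => rfl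
    let z : C ⧸ I := Ideal.Quotient.mk I y
    have hpy : aeval y p = 0 := by
      apply Subtype.ext
      rw [← Subalgebra.coe_val, ← aeval_algHom_apply]
      exact hp
    have hz : IsIntegral A z := by
      have : IsAlgebraic k z := by
        refine ⟨p.map (algebraMap A k), fun h0 => hi ?_, ?_⟩
        · have := congrArg (fun q => q.coeff i) h0
          simp only [coeff_map, coeff_zero] at this
          exact Ideal.Quotient.eq_zero_iff_mem.1 this
        · rw [aeval_map_algebraMap]
          have : z = Ideal.Quotient.mkₐ A I y := rfl
          rw [this, aeval_algHom_apply, hpy, map_zero]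
      exact isIntegral_trans z this.isIntegral
    have h1 := hz.fg_adjoin_singleton
    have htop : Algebra.adjoin A {z} = ⊤ := by
      have h2 : Algebra.adjoin A {y} = ⊤ := by
        apply Subalgebra.map_injective (f := C.val) Subtype.val_injective
        rw [AlgHom.map_adjoin]
        simp [C, y, Subalgebra.range_val]
      have : Algebra.adjoin A {z} = (Algebra.adjoin A {y}).map (Ideal.Quotient.mkₐ A I) := by
        rw [AlgHom.map_adjoin]; simp [z]
      rw [this, h2, Algebra.map_top, AlgHom.range_eq_top]
      exact Ideal.Quotient.mkₐ_surjective A I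
    rw [htop] at h1
    exact ⟨h1⟩
  obtain ⟨n, s, hs⟩ := Module.Finite.exists_fin (R := A) (M := C ⧸ I)
  choose v hv using fun i => Ideal.Quotient.mk_surjective (s i)
  have hC := Module.Finite.of_isPrecomplete_of_isHausdorff (maximalIdeal A) v (fun m => by
    have : Ideal.Quotient.mk I m ∈ Submodule.span A (Set.range s) := by rw [hs]; trivial
    obtain ⟨c, hc⟩ := (Submodule.mem_span_range_iff_exists_fun A).1 this
    refine ⟨c, ?_⟩
    have h1 := hsmul 1
    rw [pow_one, pow_one] at h1
    rw [h1, Submodule.restrictScalars_mem, ← Ideal.Quotient.eq_zero_iff_mem, map_sub, ← hc,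
      map_sum, sub_eq_zero]
    refine Finset.sum_congr rfl fun j _ => ?_
    rw [← hv j]
    rfl)
  have hfinC : Module.Finite A C := by
    refine ⟨Submodule.fg_def.2 ⟨Set.range v, Set.finite_range v, ?_⟩⟩
    rw [eq_top_iff]
    intro m _
    obtain ⟨c, hc⟩ := hC m
    rw [hc]
    exact Submodule.sum_mem _ fun j _ => Submodule.smul_mem _ _ (Submodule.subset_span (by simp))
  exact (IsIntegral.of_finite A y).map C.val

/-- Clear denominators in an algebraic equation and divide by the content. A primitive polynomial is
not divisible by a generator of the maximal ideal, so some coefficient is a unit. -/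
theorem exists_aeval_eq_zero_coeff_notMem {V κ : Type*} [CommRing V] [IsDomain V]
    [IsLocalRing V] [IsPrincipalIdealRing V] [Field κ] [Algebra V κ] [IsFractionRing V κ]
    [Algebra V F] [Algebra κ F] [IsScalarTower V κ F] {x : F}
    (hx : IsAlgebraic κ x) : ∃ p : V[X], aeval x p = 0 ∧ ∃ i, p.coeff i ∉ maximalIdeal V := by
  let _ : NormalizedGCDMonoid V := Classical.choice inferInstance
  obtain ⟨q, hq0, hq⟩ := (IsFractionRing.isAlgebraic_iff V κ F).2 hx
  refine ⟨q.primPart, ?_, ?_⟩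
  · have h1 := hq
    rw [q.eq_C_content_mul_primPart, map_mul, aeval_C, IsScalarTower.algebraMap_apply V κ F] at h1
    have h2 : algebraMap V κ q.content ≠ 0 := by
      rw [Ne, IsFractionRing.to_map_eq_zero_iff]
      exact content_eq_zero_iff.not.2 hq0
    exact ((h2.isUnit.map (algebraMap κ F)).mul_right_eq_zero).1 h1
  · by_contra! hall
    obtain ⟨ϖ, hϖ⟩ := (IsPrincipalIdealRing.principal (maximalIdeal V)).principal
    have h1 : C ϖ ∣ q.primPart := by
      rw [C_dvd_iff_dvd_coeff]
      intro i
      have := hall i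
      rw [hϖ] at this
      exact Ideal.mem_span_singleton.1 this
    have h2 := q.isPrimitive_primPart ϖ h1
    have h3 : ϖ ∈ maximalIdeal V := by rw [hϖ]; exact Ideal.mem_span_singleton_self ϖ
    exact (mem_nonunits_iff.1 ((mem_maximalIdeal _).1 h3)) h2

end Regular

/-! ## Comparing an infinitely near point with the base along a curve -/

section Comparison

variable {A R K : Type*} [CommRing A] [CommRing R] [Field K] [Algebra A R] [Algebra R K]
  [Algebra A K] [IsScalarTower A R K] (κ : Type*) [Field κ] [Algebra A κ]

/-- The map from the fibre of the base to the fibre of an infinitely near point. -/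
def fibreMap (P : LocalPoint R K) : κ ⊗[A] R →ₐ[κ] κ ⊗[A] P.ring :=
  Algebra.TensorProduct.map (AlgHom.id κ κ) (IsScalarTower.toAlgHom A R P.ring)

/-- The map between the fibres of two comparable infinitely near points. -/
def fibreTransition {P Q : LocalPoint R K} (hle : P.ring ≤ Q.ring) :
    κ ⊗[A] P.ring →ₐ[κ] κ ⊗[A] Q.ring :=
  Algebra.TensorProduct.map (AlgHom.id κ κ) ((Subalgebra.inclusion hle).restrictScalars A)

theorem fibreMap_one_tmul (P : LocalPoint R K) (r : R) :
    fibreMap κ P ((1 : κ) ⊗ₜ[A] r) = 1 ⊗ₜ algebraMap R P.ring r := by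
  simp [fibreMap]

theorem fibreTransition_one_tmul {P Q : LocalPoint R K} (hle : P.ring ≤ Q.ring) (y : P.ring) :
    fibreTransition κ hle ((1 : κ) ⊗ₜ[A] y) = 1 ⊗ₜ Subalgebra.inclusion hle y := by
  simp [fibreTransition]

theorem fibreTransition_fibreMap {P Q : LocalPoint R K} (hle : P.ring ≤ Q.ring)
    (x : κ ⊗[A] R) : fibreTransition κ hle (fibreMap κ P x) = fibreMap κ Q x := by
  induction x with
  | zero => simp
  | add x y hx hy => rw [map_add, map_add, map_add, hx, hy]
  | tmul a r => simp [fibreMap, fibreTransition]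

/-- The elements of the integral closure of `A` in the fibre of the base which are functions at
an infinitely near point. -/
def pointOrder (A : Type*) {R K : Type*} [CommRing A] [CommRing R] [Field K] [Algebra A R]
    [Algebra R K] [Algebra A K] [IsScalarTower A R K] (κ : Type*) [Field κ] [Algebra A κ]
    (P : LocalPoint R K) : Submodule A (integralClosure A (κ ⊗[A] R)) :=
  (LinearMap.range
      (Algebra.TensorProduct.includeRight : P.ring →ₐ[A] κ ⊗[A] P.ring).toLinearMap).comap
    (((fibreMap κ P).restrictScalars A).toLinearMap ∘ₗ
      (integralClosure A (κ ⊗[A] R)).val.toLinearMap)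

theorem mem_pointOrder_iff {P : LocalPoint R K} {w : integralClosure A (κ ⊗[A] R)} :
    w ∈ pointOrder A κ P ↔
      ∃ y : P.ring, (1 : κ) ⊗ₜ[A] y = fibreMap κ P (w : κ ⊗[A] R) := Iff.rfl

theorem pointOrder_mono {P Q : LocalPoint R K} (hle : P.ring ≤ Q.ring) :
    pointOrder A κ P ≤ pointOrder A κ Q := by
  intro w hw
  obtain ⟨y, hy⟩ := (mem_pointOrder_iff κ).1 hw
  refine (mem_pointOrder_iff κ).2 ⟨Subalgebra.inclusion hle y, ?_⟩
  rw [← fibreTransition_one_tmul κ hle, hy, fibreTransition_fibreMap]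

theorem imageInIntegralClosure_le_pointOrder (P : LocalPoint R K) :
    imageInIntegralClosure A R κ ≤ pointOrder A κ P := by
  rintro w ⟨r, hr⟩
  refine (mem_pointOrder_iff κ).2 ⟨algebraMap R P.ring r, ?_⟩
  rw [← fibreMap_one_tmul]
  exact congrArg _ hr

theorem isUnit_algebraMap_fibre {B : Type*} [CommRing B] [Algebra A B] (p : Ideal A)
    [Algebra (A ⧸ p) κ] [IsScalarTower A (A ⧸ p) κ] [IsFractionRing (A ⧸ p) κ] {c : A}
    (hc : c ∉ p) : IsUnit (algebraMap A (κ ⊗[A] B) c) := by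
  rw [IsScalarTower.algebraMap_apply A κ (κ ⊗[A] B)]
  refine IsUnit.map _ (IsUnit.mk0 _ ?_)
  rw [Ne, algebraMap_fractionRing_quotient_eq_zero_iff p κ]
  exact hc

variable (h : A) [Algebra (A ⧸ Ideal.span {h}) κ] [IsScalarTower A (A ⧸ Ideal.span {h}) κ]
  [IsFractionRing (A ⧸ Ideal.span {h}) κ]

/-- At a comparable point every function is, in the fibre, a fraction of functions on the base. -/
theorem IsComparable.exists_fibre_frac [IsLocalRing R]
    {P : LocalPoint R K} (hP : IsComparable h P) (y : P.ring) :
    ∃ a r : R, y * algebraMap R P.ring r = algebraMap R P.ring a ∧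
      IsUnit ((1 : κ) ⊗ₜ[A] algebraMap R P.ring r) := by
  obtain ⟨a, r, y', c, hc, h1, h2⟩ := hP.exists_frac y
  refine ⟨a, r, h1, isUnit_of_mul_isUnit_left (y := (1 : κ) ⊗ₜ[A] y') ?_⟩
  rw [Algebra.TensorProduct.tmul_mul_tmul, one_mul, h2, ← Algebra.TensorProduct.algebraMap_apply']
  exact isUnit_algebraMap_fibre κ _ hc

variable (hF : ∀ x : κ ⊗[A] R, ∃ y, x * x * y = x)

include hF in
-- A function at `P` is a fraction `b / r` whose denominator becomes a unit in the fibre at `P`.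
-- Although `r` need not be a unit in `κ ⊗ R`, its quasi-inverse `v` maps to the inverse.
theorem IsComparable.fibreMap_surjective [IsLocalRing R] {P : LocalPoint R K}
    (hP : IsComparable h P) : Function.Surjective (fibreMap κ P : κ ⊗[A] R → κ ⊗[A] P.ring) := by
  rw [← AlgHom.range_eq_top, eq_top_iff]
  intro x _
  induction x with
  | zero => exact zero_mem _
  | add x y hx hy => exact add_mem (hx trivial) (hy trivial)
  | tmul a y =>
    have : a ⊗ₜ[A] y = a • ((1 : κ) ⊗ₜ[A] y) := by
      rw [TensorProduct.smul_tmul', smul_eq_mul, mul_one]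
    rw [this]
    refine Subalgebra.smul_mem _ ?_ a
    obtain ⟨b, r, h1, h2⟩ := hP.exists_fibre_frac κ h y
    obtain ⟨v, hv⟩ := hF (1 ⊗ₜ r)
    have h3 : fibreMap κ P (1 ⊗ₜ r) * fibreMap κ P v = 1 := by
      rw [← fibreMap_one_tmul] at h2
      apply h2.mul_left_cancel
      rw [← mul_assoc, ← map_mul, ← map_mul, hv, mul_one]
    refine ⟨1 ⊗ₜ b * v, ?_⟩
    change fibreMap κ P (1 ⊗ₜ b * v) = _
    rw [map_mul, fibreMap_one_tmul, ← h1]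
    have h4 : (1 : κ) ⊗ₜ[A] (y * algebraMap R P.ring r) =
        1 ⊗ₜ y * fibreMap κ P (1 ⊗ₜ r) := by
      rw [fibreMap_one_tmul, Algebra.TensorProduct.tmul_mul_tmul, one_mul]
    rw [h4, mul_assoc, h3, mul_one]

variable [IsLocalRing A] [IsNoetherianRing A] [IsAdicComplete (maximalIdeal A) A] [IsLocalRing R]
  [Module.Finite A R] [IsPrincipalIdealRing (A ⧸ Ideal.span {h})] [IsDomain (A ⧸ Ideal.span {h})]
  (hloc : ∀ a ∈ maximalIdeal A, algebraMap A R a ∈ maximalIdeal R)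

omit [IsNoetherianRing A] [IsAdicComplete (maximalIdeal A) A] [Module.Finite A R]
  [IsPrincipalIdealRing (A ⧸ Ideal.span {h})] [IsDomain (A ⧸ Ideal.span {h})] in
include h hloc in
theorem IsComparable.algebraMap_mem {P : LocalPoint R K} (hP : IsComparable h P) {a : A}
    (ha : a ∈ maximalIdeal A) : algebraMap A P.ring a ∈ maximalIdeal P.ring := by
  rw [IsScalarTower.algebraMap_apply A R P.ring]
  exact hP.isLocalHom _ (hloc a ha)

include hF hloc in
-- The fibre at `P` is finite over `κ`, so the element is algebraic and satisfies a polynomial over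
-- `A` with a unit coefficient. Elements of `𝔪_A A[y]` come from the maximal ideal of the local ring
-- of `P`, so `1` minus such an element is a unit; completeness of `A` then gives integrality.
theorem IsComparable.isIntegral_one_tmul {P : LocalPoint R K} (hP : IsComparable h P)
    (y : P.ring) : IsIntegral A ((1 : κ) ⊗ₜ[A] y) := by
  have hfin : Module.Finite κ (κ ⊗[A] P.ring) :=
    Module.Finite.of_surjective (fibreMap κ P).toLinearMap (hP.fibreMap_surjective κ h hF)
  have : IsLocalRing (A ⧸ Ideal.span {h}) :=
    .of_surjective' (Ideal.Quotient.mk _) Ideal.Quotient.mk_surjective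
  have : IsLocalHom (Ideal.Quotient.mk (Ideal.span {h})) :=
    .of_surjective _ Ideal.Quotient.mk_surjective
  obtain ⟨p, hp, i, hi⟩ := exists_aeval_eq_zero_coeff_notMem (V := A ⧸ Ideal.span {h}) (κ := κ)
    (Algebra.IsAlgebraic.isAlgebraic ((1 : κ) ⊗ₜ[A] y))
  obtain ⟨q, rfl⟩ := Polynomial.map_surjective _ Ideal.Quotient.mk_surjective p
  refine isIntegral_of_aeval_eq_zero_of_isUnit (p := q) (i := i) ?_ (fun hmem => hi ?_) ?_
  · rw [← Polynomial.aeval_map_algebraMap (A ⧸ Ideal.span {h})]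
    exact hp
  · rw [Polynomial.coeff_map]
    exact map_nonunit _ _ hmem
  · have hrange : Algebra.adjoin A {(1 : κ) ⊗ₜ[A] y} ≤
        (Algebra.TensorProduct.includeRight : P.ring →ₐ[A] κ ⊗[A] P.ring).range :=
      Algebra.adjoin_le (Set.singleton_subset_iff.2 ⟨y, rfl⟩)
    intro r hr
    have : ∃ s ∈ maximalIdeal P.ring, (1 : κ) ⊗ₜ[A] s = (r : κ ⊗[A] P.ring) := by
      induction hr using Submodule.span_induction with
      | mem x hx =>
        obtain ⟨a, ha, rfl⟩ := hx
        exact ⟨_, hP.algebraMap_mem h hloc ha, (Algebra.TensorProduct.algebraMap_apply' a).symm⟩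
      | zero => exact ⟨0, zero_mem _, by simp⟩
      | add x y _ _ hx hy =>
        obtain ⟨s, hs, hs'⟩ := hx
        obtain ⟨t, ht, ht'⟩ := hy
        exact ⟨s + t, add_mem hs ht, by rw [TensorProduct.tmul_add, hs', ht']; rfl⟩
      | smul c x _ hx =>
        obtain ⟨s, hs, hs'⟩ := hx
        obtain ⟨d, hd⟩ := hrange c.2
        refine ⟨d * s, Ideal.mul_mem_left _ _ hs, ?_⟩
        rw [smul_eq_mul, MulMemClass.coe_mul, ← hs', ← hd]
        simp
    obtain ⟨s, hs, hs'⟩ := this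
    have hu : IsUnit (1 - s) := by
      by_contra hn
      have h1 : (1 - s) + s ∈ maximalIdeal P.ring :=
        add_mem ((mem_maximalIdeal _).2 hn) hs
      rw [sub_add_cancel] at h1
      exact (Ideal.ne_top_iff_one _).1 (maximalIdeal.isMaximal P.ring).ne_top h1
    have := hu.map (Algebra.TensorProduct.includeRight : P.ring →ₐ[A] κ ⊗[A] P.ring)
    rw [← hs']
    simpa [TensorProduct.tmul_sub, Algebra.TensorProduct.one_def] using this

include hF hloc in
theorem IsComparable.exists_integral_lift {P : LocalPoint R K} (hP : IsComparable h P)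
    (y : P.ring) : ∃ w : integralClosure A (κ ⊗[A] R),
      fibreMap κ P (w : κ ⊗[A] R) = 1 ⊗ₜ y := by
  obtain ⟨w, hw, hwy⟩ := exists_isIntegral_map_eq hF ((fibreMap κ P).restrictScalars A)
    (hP.fibreMap_surjective κ h hF) (hP.isIntegral_one_tmul κ h hF hloc y)
  exact ⟨⟨w, hw⟩, hwy⟩

end Comparison

/-! ## Regularity of the strict transform -/

section Regularity

theorem isNoetherianRing_of_algebra_finite (A S : Type*) [CommRing A] [IsNoetherianRing A]
    [CommRing S] [Algebra A S] [Module.Finite A S] : IsNoetherianRing S :=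
  IsNoetherianRing.of_finite A S

/-- A non-zero-divisor in the maximal ideal forces dimension at least one, which already equals the
number of generators allowed. -/
theorem isRegularLocalRing_of_maximalIdeal_eq_span {S : Type*} [CommRing S] [IsLocalRing S]
    [IsNoetherianRing S] {t c : S} (ht : maximalIdeal S = Ideal.span {t})
    (hc : c ∈ nonZeroDivisors S) (hcm : c ∈ maximalIdeal S) : IsRegularLocalRing S := by
  apply IsRegularLocalRing.of_spanFinrank_maximalIdeal_le
  have h1 : (maximalIdeal S).spanFinrank ≤ 1 := by
    rw [ht]
    exact (Submodule.spanFinrank_span_le_ncard_of_finite (Set.finite_singleton t)).trans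
      (Set.ncard_singleton t).le
  have h2 := ringKrullDim_quotient_succ_le_of_nonZeroDivisor hc
  have : Nontrivial (S ⧸ Ideal.span {c}) := Ideal.Quotient.nontrivial_iff.2 (by
    intro h
    exact hcm (Ideal.span_singleton_eq_top.1 h))
  have h3 : (0 : WithBot ℕ∞) ≤ ringKrullDim (S ⧸ Ideal.span {c}) := ringKrullDim_nonneg_of_nontrivial
  calc ((maximalIdeal S).spanFinrank : WithBot ℕ∞) ≤ ((1 : ℕ) : WithBot ℕ∞) := by exact_mod_cast h1
    _ = 0 + 1 := by simp
    _ ≤ _ := (add_le_add h3 le_rfl).trans h2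

variable {A R K : Type*} [CommRing A] [CommRing R] [Field K] [Algebra A R] [Algebra R K]
  [Algebra A K] [IsScalarTower A R K] (κ : Type*) [Field κ] [Algebra A κ]

/-- The functions at an infinitely near point that vanish on the fibre. -/
def fibreKernel (A : Type*) {R K : Type*} [CommRing A] [CommRing R] [Field K] [Algebra A R]
    [Algebra R K] [Algebra A K] [IsScalarTower A R K] (κ : Type*) [Field κ] [Algebra A κ]
    (P : LocalPoint R K) : Ideal P.ring :=
  RingHom.ker (Algebra.TensorProduct.includeRight : P.ring →ₐ[A] κ ⊗[A] P.ring)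

theorem mem_fibreKernel {P : LocalPoint R K} {y : P.ring} :
    y ∈ fibreKernel A κ P ↔ (1 : κ) ⊗ₜ[A] y = 0 := Iff.rfl

/-- The ring of functions of the strict transform, inside the fibre. -/
def fibreKernelQuotientMap (P : LocalPoint R K) :
    (P.ring ⧸ fibreKernel A κ P) →ₐ[A] κ ⊗[A] P.ring :=
  Ideal.Quotient.liftₐ _ Algebra.TensorProduct.includeRight fun _ ha => ha

theorem fibreKernelQuotientMap_mk (P : LocalPoint R K) (y : P.ring) :
    fibreKernelQuotientMap κ P (Ideal.Quotient.mk (fibreKernel A κ P) y) = 1 ⊗ₜ y := rfl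

theorem fibreKernelQuotientMap_injective (P : LocalPoint R K) :
    Function.Injective (fibreKernelQuotientMap κ P : (P.ring ⧸ fibreKernel A κ P) →ₐ[A] _) := by
  rw [injective_iff_map_eq_zero]
  intro a ha
  obtain ⟨y, rfl⟩ := Ideal.Quotient.mk_surjective a
  exact Ideal.Quotient.eq_zero_iff_mem.2 ha

theorem fibreKernel_ne_top (P : LocalPoint R K) [Nontrivial (κ ⊗[A] P.ring)] :
    fibreKernel A κ P ≠ ⊤ := by
  rw [Ne, Ideal.eq_top_iff_one, mem_fibreKernel]
  exact one_ne_zero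

/-- In a local ring `y` or `1 - y` is a unit, so an idempotent of the fibre that is a function at
`P` is trivial: the curve is connected at a point. -/
theorem one_tmul_eq_zero_or_eq_one {P : LocalPoint R K} {y : P.ring}
    (hy : ((1 : κ) ⊗ₜ[A] y) * (1 ⊗ₜ y) = (1 : κ) ⊗ₜ[A] y) :
    (1 : κ) ⊗ₜ[A] y = 0 ∨ (1 : κ) ⊗ₜ[A] y = 1 := by
  have h1 : ((1 : κ) ⊗ₜ[A] y) * (1 ⊗ₜ (1 - y)) = 0 := by
    rw [TensorProduct.tmul_sub, mul_sub, hy, Algebra.TensorProduct.tmul_mul_tmul]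
    simp
  by_cases hu : IsUnit y
  · right
    have h2 := hu.map (Algebra.TensorProduct.includeRight : P.ring →ₐ[A] κ ⊗[A] P.ring)
    have h3 := (h2.mul_right_eq_zero).1 h1
    rw [TensorProduct.tmul_sub, sub_eq_zero] at h3
    exact h3.symm
  · left
    have hu' : IsUnit (1 - y) := by
      by_contra hn
      have h4 : (1 - y) + y ∈ maximalIdeal P.ring :=
        add_mem ((mem_maximalIdeal _).2 hn) ((mem_maximalIdeal _).2 hu)
      rw [sub_add_cancel] at h4
      exact (Ideal.ne_top_iff_one _).1 (maximalIdeal.isMaximal P.ring).ne_top h4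
    have h2 := hu'.map (Algebra.TensorProduct.includeRight : P.ring →ₐ[A] κ ⊗[A] P.ring)
    exact (h2.mul_left_eq_zero).1 h1

variable (h : A) [Algebra (A ⧸ Ideal.span {h}) κ] [IsScalarTower A (A ⧸ Ideal.span {h}) κ]
  [IsFractionRing (A ⧸ Ideal.span {h}) κ]
  (hF : ∀ x : κ ⊗[A] R, ∃ y, x * x * y = x)

theorem mul_self_mul_eq_of_mul_mul_eq {F : Type*} [CommRing F] {x y : F} (hy : x * x * y = x) :
    (x * y) * (x * y) = x * y := by
  linear_combination y * hy

variable [IsLocalRing A] [IsNoetherianRing A] [IsAdicComplete (maximalIdeal A) A] [IsLocalRing R]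
  [Module.Finite A R] [IsPrincipalIdealRing (A ⧸ Ideal.span {h})] [IsDomain (A ⧸ Ideal.span {h})]
  (hloc : ∀ a ∈ maximalIdeal A, algebraMap A R a ∈ maximalIdeal R)
  [Module.Finite A (integralClosure A (κ ⊗[A] R))]

include hF hloc in
-- All functions on the curve at `P` lift to integral elements of `κ ⊗ R`, so they embed in the
-- image of the finite module of such elements.
theorem IsComparable.finite_quotient_fibreKernel {P : LocalPoint R K} (hP : IsComparable h P) :
    Module.Finite A (P.ring ⧸ fibreKernel A κ P) := by
  let f : integralClosure A (κ ⊗[A] R) →ₗ[A] κ ⊗[A] P.ring :=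
    ((fibreMap κ P).restrictScalars A).toLinearMap ∘ₗ
      (integralClosure A (κ ⊗[A] R)).val.toLinearMap
  let j : (P.ring ⧸ fibreKernel A κ P) →ₗ[A] LinearMap.range f :=
    LinearMap.codRestrict _ (fibreKernelQuotientMap κ P).toLinearMap (by
      intro c
      obtain ⟨y, rfl⟩ := Ideal.Quotient.mk_surjective c
      obtain ⟨w, hw⟩ := hP.exists_integral_lift κ h hF hloc y
      exact ⟨w, hw⟩)
  refine Module.Finite.of_injective j fun a b hab => ?_
  exact fibreKernelQuotientMap_injective κ P (congrArg Subtype.val hab)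

/-- If blowing up a point does not enlarge the ring of functions on the curve, the curve is regular
at this point. -/
theorem IsComparable.isRegularLocalRing_of_pointOrder_le {g : A}
    (hg : g ∈ maximalIdeal A) (hgh : g ∉ Ideal.span {h}) {P Q : LocalPoint R K} {t : P.ring}
    (hP : IsComparable h P) (hQ : IsComparable h Q) (hPQ : IsChartPoint P Q t)
    [Nontrivial (κ ⊗[A] Q.ring)] (hle : pointOrder A κ Q ≤ pointOrder A κ P)
    (hF : ∀ x : κ ⊗[A] R, ∃ y, x * x * y = x)
    (hloc : ∀ a ∈ maximalIdeal A, algebraMap A R a ∈ maximalIdeal R) :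
    IsRegularLocalRing (P.ring ⧸ fibreKernel A κ P) := by
  let τ := fibreTransition (A := A) κ hPQ.le
  -- No component of the curve is lost from `P` to `Q`. The support idempotent of an element killed
  -- at `Q` vanishes at `Q`, so by `hle` it is a function at `P`; locality makes it `0` or `1`
  -- there, and `1` is excluded because the fibre at `Q` is nonzero.
  have hτinj : ∀ x, τ x = 0 → x = 0 := by
    intro x hx
    obtain ⟨f, rfl⟩ := hP.fibreMap_surjective κ h hF x
    obtain ⟨y, hy⟩ := hF f
    have hee := mul_self_mul_eq_of_mul_mul_eq hy
    let e : integralClosure A (κ ⊗[A] R) := ⟨f * y, isIntegral_of_mul_self_eq hee⟩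
    have he : e ∈ pointOrder A κ Q := by
      refine (mem_pointOrder_iff κ).2 ⟨0, ?_⟩
      change _ = fibreMap κ Q (f * y)
      rw [map_mul, ← fibreTransition_fibreMap κ hPQ.le, hx, zero_mul, TensorProduct.tmul_zero]
    obtain ⟨s, hs⟩ := (mem_pointOrder_iff κ).1 (hle he)
    change (1 : κ) ⊗ₜ[A] s = fibreMap κ P (f * y) at hs
    have hfe : fibreMap κ P f = fibreMap κ P (f * y) * fibreMap κ P f := by
      rw [← map_mul]; congr 1; linear_combination -hy
    rcases one_tmul_eq_zero_or_eq_one κ (by rw [hs, ← map_mul, hee]) with h0 | h1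
    · rw [hfe, ← hs, h0, zero_mul]
    · exfalso
      have h2 : τ ((1 : κ) ⊗ₜ[A] s) = 0 := by
        rw [hs, map_mul, map_mul, hx, zero_mul]
      rw [h1, map_one] at h2
      exact one_ne_zero h2
  have : Nontrivial (κ ⊗[A] P.ring) := τ.toRingHom.domain_nontrivial
  have hnt : Nontrivial (P.ring ⧸ fibreKernel A κ P) :=
    Ideal.Quotient.nontrivial_iff.2 (fibreKernel_ne_top κ P)
  have : IsLocalRing (P.ring ⧸ fibreKernel A κ P) :=
    .of_surjective' (Ideal.Quotient.mk _) Ideal.Quotient.mk_surjective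
  have hmk : IsLocalHom (Ideal.Quotient.mk (fibreKernel A κ P)) :=
    .of_surjective _ Ideal.Quotient.mk_surjective
  have := hP.finite_quotient_fibreKernel κ h hF hloc
  have : IsNoetherianRing (P.ring ⧸ fibreKernel A κ P) :=
    isNoetherianRing_of_algebra_finite A _
  have hgP := hP.algebraMap_mem h hloc hg
  refine isRegularLocalRing_of_maximalIdeal_eq_span
    (t := Ideal.Quotient.mk (fibreKernel A κ P) t)
    (c := Ideal.Quotient.mk (fibreKernel A κ P) (algebraMap A P.ring g)) ?_ ?_
    (map_nonunit _ _ hgP)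
  -- For `z` in the maximal ideal at `P`, `z / t` is a function at `Q`; by `hle` it agrees on the
  -- curve with a function `s` at `P`, so `z` is a multiple of `t` on the curve.
  · apply le_antisymm
    · intro z hz
      obtain ⟨z, rfl⟩ := Ideal.Quotient.mk_surjective z
      have hz' : z ∈ maximalIdeal P.ring := by
        rw [mem_maximalIdeal, mem_nonunits_iff] at hz ⊢
        exact fun hu => hz (hu.map _)
      obtain ⟨w, hw⟩ := hQ.exists_integral_lift κ h hF hloc ⟨_, hPQ.div_mem z hz'⟩
      obtain ⟨s, hs⟩ := (mem_pointOrder_iff κ).1 (hle ((mem_pointOrder_iff κ).2 ⟨_, hw.symm⟩))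
      rw [Ideal.mem_span_singleton']
      refine ⟨Ideal.Quotient.mk _ s, ?_⟩
      rw [← map_mul, Ideal.Quotient.eq, mem_fibreKernel]
      apply hτinj
      have h1 : τ (1 ⊗ₜ s) = 1 ⊗ₜ (⟨_, hPQ.div_mem z hz'⟩ : Q.ring) := by
        rw [hs, ← hw]; exact fibreTransition_fibreMap κ hPQ.le _
      have h2 : (1 : κ) ⊗ₜ[A] (s * t - z) = (1 ⊗ₜ s) * (1 ⊗ₜ t) - 1 ⊗ₜ z := by
        rw [Algebra.TensorProduct.tmul_mul_tmul, one_mul, TensorProduct.tmul_sub]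
      rw [h2, map_sub, map_mul, h1, fibreTransition_one_tmul, fibreTransition_one_tmul,
        Algebra.TensorProduct.tmul_mul_tmul, one_mul, sub_eq_zero]
      congr 1
      exact Subtype.ext (div_mul_cancel₀ _ hPQ.ne_zero)
    · rw [Ideal.span_singleton_le_iff_mem]
      exact map_nonunit _ _ hPQ.mem_maximalIdeal
  -- `g ∉ (h)` becomes a unit in the fibre, in which the functions on the curve embed.
  · rw [mem_nonZeroDivisors_iff_right]
    intro x hx
    apply fibreKernelQuotientMap_injective κ P
    have h1 := congrArg (fibreKernelQuotientMap κ P) hx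
    rw [map_mul, map_zero, fibreKernelQuotientMap_mk,
      ← Algebra.TensorProduct.algebraMap_apply'] at h1
    rw [map_zero]
    exact ((isUnit_algebraMap_fibre κ _ hgh).mul_left_eq_zero).1 h1

include hF hloc in
/-- If every integral element of the fibre is a function at `P`, the curve is regular at `P`. -/
theorem IsComparable.isRegularLocalRing_of_pointOrder_eq_top {P : LocalPoint R K}
    (hP : IsComparable h P) [Nontrivial (κ ⊗[A] P.ring)] (htop : pointOrder A κ P = ⊤) :
    IsRegularLocalRing (P.ring ⧸ fibreKernel A κ P) := by
  have hsurj := hP.fibreMap_surjective κ h hF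
  have hint : ∀ x : κ ⊗[A] P.ring, IsIntegral A x → ∃ y : P.ring, 1 ⊗ₜ y = x := by
    intro x hx
    obtain ⟨w, hw, rfl⟩ := exists_isIntegral_map_eq hF ((fibreMap κ P).restrictScalars A) hsurj hx
    exact (mem_pointOrder_iff κ).1 (show ⟨w, hw⟩ ∈ pointOrder A κ P by rw [htop]; trivial)
  -- The support idempotent of `x` is integral, hence a function at `P`, hence `0` or `1`: the fibre
  -- at `P` is a field.
  have hunit : ∀ x : κ ⊗[A] P.ring, x ≠ 0 → IsUnit x := by
    intro x hx
    obtain ⟨f, rfl⟩ := hsurj x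
    obtain ⟨y, hy⟩ := hF f
    have hee := mul_self_mul_eq_of_mul_mul_eq (congrArg (fibreMap κ P) hy |> fun h => by
      rwa [map_mul, map_mul] at h)
    obtain ⟨s, hs⟩ := hint _ (isIntegral_of_mul_self_eq hee)
    rcases one_tmul_eq_zero_or_eq_one κ (by rw [hs, hee]) with h0 | h1
    · refine absurd ?_ hx
      rw [← hy, map_mul, map_mul, mul_assoc, ← hs, h0, mul_zero]
    · exact IsUnit.of_mul_eq_one _ (hs.symm.trans h1)
  let S := P.ring ⧸ fibreKernel A κ P
  let j : S →ₐ[A] κ ⊗[A] P.ring := fibreKernelQuotientMap κ P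
  have hj : Function.Injective j := fibreKernelQuotientMap_injective κ P
  have : NoZeroDivisors (κ ⊗[A] P.ring) := ⟨fun {a b} hab => by
    by_contra! hne
    exact hne.2 (((hunit a hne.1).mul_right_eq_zero).1 hab)⟩
  have : IsDomain (κ ⊗[A] P.ring) := NoZeroDivisors.to_isDomain _
  have : IsDomain S := hj.isDomain j.toRingHom
  have : Nontrivial S := IsDomain.toNontrivial
  have : IsLocalRing S := .of_surjective' (Ideal.Quotient.mk _) Ideal.Quotient.mk_surjective
  have hfin : Module.Finite A S := hP.finite_quotient_fibreKernel κ h hF hloc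
  have : IsNoetherianRing S := isNoetherianRing_of_algebra_finite A S
  -- The fraction field of `S` maps to the fibre, where every element integral over `A` is by
  -- hypothesis a function at `P`.
  have hclosed : IsIntegrallyClosed S := by
    rw [isIntegrallyClosed_iff (FractionRing S)]
    intro z hz
    have hjunit : ∀ y : nonZeroDivisors S, IsUnit (j.toRingHom y) := fun y =>
      hunit _ fun h0 => nonZeroDivisors.ne_zero y.2 (hj (h0.trans (map_zero j).symm))
    let φ : FractionRing S →+* κ ⊗[A] P.ring := IsLocalization.lift hjunit
    have hφ : ∀ s : S, φ (algebraMap S _ s) = j s := IsLocalization.lift_eq hjunit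
    have hzA : IsIntegral A z := isIntegral_trans z hz
    have h1 : IsIntegral A (φ z) := hzA.map_of_comp_eq (RingHom.id A) φ (by
      ext a
      rw [RingHom.comp_apply, RingHom.comp_apply, IsScalarTower.algebraMap_apply A S (FractionRing S), hφ]
      exact (j.commutes a).symm)
    obtain ⟨y, hy⟩ := hint _ h1
    refine ⟨Ideal.Quotient.mk _ y, φ.injective ?_⟩
    rw [hφ, ← hy]
    rfl
  have hV : ∀ a ∈ Ideal.span {h}, algebraMap A S a = 0 := by
    intro a ha
    apply hj
    rw [map_zero, j.commutes, IsScalarTower.algebraMap_apply A κ,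
      (algebraMap_fractionRing_quotient_eq_zero_iff (Ideal.span {h}) κ a).2 ha, map_zero]
  -- `S` is integral over `A/hA`, so its dimension is at most one; being normal and local it is a
  -- principal ideal domain.
  let _ : Algebra (A ⧸ Ideal.span {h}) S := (Ideal.Quotient.lift _ (algebraMap A S) hV).toAlgebra
  have : IsScalarTower A (A ⧸ Ideal.span {h}) S := .of_algebraMap_eq fun _ => rfl
  have : Algebra.IsIntegral (A ⧸ Ideal.span {h}) S :=
    ⟨fun s => (IsIntegral.of_finite A s).tower_top⟩
  have : Ring.DimensionLEOne S := .of_isIntegral (A ⧸ Ideal.span {h}) S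
  have : IsDedekindRing S := {}
  have : IsDedekindDomain S := {}
  have : IsPrincipalIdealRing S :=
    ((tfae_of_isNoetherianRing_of_isLocalRing_of_isDomain S).out 0 2).2 ‹IsDedekindDomain S›
  infer_instance

end Regularity

/-! ## Finiteness of the points at which the strict transform passes -/

section Children

theorem finite_setOf_isMaximal_of_finite (A W : Type*) [CommRing A] [IsLocalRing A] [CommRing W]
    [Algebra A W] [Module.Finite A W] : {n : Ideal W | n.IsMaximal}.Finite := by
  refine (Algebra.QuasiFinite.finite_primesOver (S := W) (maximalIdeal A)).subset fun n hn => ?_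
  have : n.IsMaximal := hn
  refine ⟨hn.isPrime, ⟨?_⟩⟩
  exact (eq_maximalIdeal (Ideal.isMaximal_comap_of_isIntegral_of_isMaximal (R := A) n)).symm

variable {A R K : Type*} [CommRing A] [CommRing R] [Field K] [Algebra A R] [Algebra R K]
  [Algebra A K] [IsScalarTower A R K] (κ : Type*) [Field κ] [Algebra A κ]

/-- A maximal ideal of the integral closure lying over an infinitely near point. -/
structure IsCentredAt (A : Type*) {R K : Type*} [CommRing A] [CommRing R] [Field K] [Algebra A R]
    [Algebra R K] [Algebra A K] [IsScalarTower A R K] (κ : Type*) [Field κ] [Algebra A κ]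
    (n : Ideal (integralClosure A (κ ⊗[A] R))) (P : LocalPoint R K) : Prop where
  isMaximal : n.IsMaximal
  mem_of_mem : ∀ y ∈ maximalIdeal P.ring, ∀ w : integralClosure A (κ ⊗[A] R),
    fibreMap κ P (w : κ ⊗[A] R) = 1 ⊗ₜ y → w ∈ n

variable (h : A) [Algebra (A ⧸ Ideal.span {h}) κ] [IsScalarTower A (A ⧸ Ideal.span {h}) κ]
  [IsFractionRing (A ⧸ Ideal.span {h}) κ]
  (hF : ∀ x : κ ⊗[A] R, ∃ y, x * x * y = x)
  [IsLocalRing A] [IsNoetherianRing A] [IsAdicComplete (maximalIdeal A) A] [IsLocalRing R]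
  [Module.Finite A R] [IsPrincipalIdealRing (A ⧸ Ideal.span {h})] [IsDomain (A ⧸ Ideal.span {h})]
  (hloc : ∀ a ∈ maximalIdeal A, algebraMap A R a ∈ maximalIdeal R)

include hF hloc in
-- The image of the integral closure in the fibre at `P` contains the functions at `P` and is
-- integral over them, so a maximal ideal lies over that of `P`.
theorem IsComparable.exists_isCentredAt {P : LocalPoint R K} (hP : IsComparable h P)
    [Nontrivial (κ ⊗[A] P.ring)] : ∃ n, IsCentredAt A κ n P := by
  let f : integralClosure A (κ ⊗[A] R) →ₐ[A] κ ⊗[A] P.ring :=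
    ((fibreMap κ P).restrictScalars A).comp (integralClosure A (κ ⊗[A] R)).val
  let φ : P.ring →ₐ[A] f.range :=
    (Algebra.TensorProduct.includeRight : P.ring →ₐ[A] κ ⊗[A] P.ring).codRestrict f.range (by
      intro y
      obtain ⟨w, hw⟩ := hP.exists_integral_lift κ h hF hloc y
      exact ⟨w, hw⟩)
  let _ : Algebra P.ring f.range := φ.toRingHom.toAlgebra
  have : IsScalarTower A P.ring f.range := .of_algebraMap_eq fun a => (φ.commutes a).symm
  have : Algebra.IsIntegral P.ring f.range := by
    refine ⟨fun b => ?_⟩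
    obtain ⟨w, hw⟩ := f.rangeRestrict_surjective b
    have h1 : IsIntegral A w := (isIntegral_algHom_iff (integralClosure A (κ ⊗[A] R)).val
      Subtype.val_injective).1 w.2
    rw [← hw]
    exact (h1.map f.rangeRestrict).tower_top
  obtain ⟨M, hM, hMP⟩ := Ideal.exists_ideal_over_maximal_of_isIntegral (S := f.range)
    (maximalIdeal P.ring) (le_maximalIdeal (RingHom.ker_ne_top _))
  refine ⟨M.comap f.rangeRestrict, ?_, fun y hy w hw => ?_⟩
  · exact Ideal.comap_isMaximal_of_surjective f.rangeRestrict f.rangeRestrict_surjective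
  · rw [← hMP] at hy
    rw [Ideal.mem_comap] at hy ⊢
    have : f.rangeRestrict w = algebraMap P.ring f.range y := Subtype.ext hw
    rwa [this]

omit [IsLocalRing A] [IsNoetherianRing A] [IsAdicComplete (maximalIdeal A) A]
  [Module.Finite A R] [IsPrincipalIdealRing (A ⧸ Ideal.span {h})]
  [IsDomain (A ⧸ Ideal.span {h})] in
include hF in
-- Near `n` the integral element `w` is an honest fraction `a / r` of elements of `R`. The
-- idempotent `E` removes the components where `w r ≠ a` and those where `r` is not invertible; the
-- corresponding idempotents vanish at `P`, so they lie in `n` and `E` does not.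
theorem IsComparable.exists_local_frac {P : LocalPoint R K} (hP : IsComparable h P)
    {n : Ideal (integralClosure A (κ ⊗[A] R))} (hn : IsCentredAt A κ n P) (y : P.ring)
    {w : integralClosure A (κ ⊗[A] R)} (hw : fibreMap κ P (w : κ ⊗[A] R) = 1 ⊗ₜ y) :
    ∃ (a r : R) (E : integralClosure A (κ ⊗[A] R)) (v : κ ⊗[A] R), E ∉ n ∧
      y * algebraMap R P.ring r = algebraMap R P.ring a ∧
      E.1 * w.1 * (1 ⊗ₜ r) = E.1 * (1 ⊗ₜ a) ∧ E.1 * (1 ⊗ₜ r) * v = E.1 := by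
  obtain ⟨a, r, h1, h2⟩ := hP.exists_fibre_frac κ h y
  obtain ⟨v, hv⟩ := hF (1 ⊗ₜ r)
  obtain ⟨z, hz⟩ := hF (w.1 * 1 ⊗ₜ r - 1 ⊗ₜ a)
  set x := w.1 * 1 ⊗ₜ r - 1 ⊗ₜ a with hx
  have hρx : fibreMap κ P x = 0 := by
    rw [hx, map_sub, map_mul, hw, fibreMap_one_tmul, fibreMap_one_tmul,
      Algebra.TensorProduct.tmul_mul_tmul, one_mul, h1, sub_self]
  have h3 : fibreMap κ P (1 ⊗ₜ r) * fibreMap κ P v = 1 := by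
    rw [← fibreMap_one_tmul] at h2
    apply h2.mul_left_cancel
    rw [← mul_assoc, ← map_mul, ← map_mul, hv, mul_one]
  let e₁ : integralClosure A (κ ⊗[A] R) :=
    ⟨x * z, isIntegral_of_mul_self_eq (mul_self_mul_eq_of_mul_mul_eq hz)⟩
  let e₂ : integralClosure A (κ ⊗[A] R) :=
    1 - ⟨1 ⊗ₜ r * v, isIntegral_of_mul_self_eq (mul_self_mul_eq_of_mul_mul_eq hv)⟩
  have he₁ : e₁ ∈ n := hn.mem_of_mem 0 (zero_mem _) _ (by
    change fibreMap κ P (x * z) = _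
    rw [map_mul, hρx, zero_mul, TensorProduct.tmul_zero])
  have he₂ : e₂ ∈ n := hn.mem_of_mem 0 (zero_mem _) _ (by
    change fibreMap κ P (1 - 1 ⊗ₜ r * v) = _
    rw [map_sub, map_mul, h3, map_one, sub_self, TensorProduct.tmul_zero])
  have hprime := hn.isMaximal.isPrime
  have hsub : ∀ e ∈ n, 1 - e ∉ n := fun e he h0 => (Ideal.ne_top_iff_one n).1 hprime.ne_top (by
    have := add_mem h0 he
    rwa [sub_add_cancel] at this)
  have hE : (((1 - e₁) * (1 - e₂) : integralClosure A (κ ⊗[A] R)) : κ ⊗[A] R) =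
      (1 - x * z) * (1 ⊗ₜ r * v) := by
    change (1 - x * z) * (1 - (1 - 1 ⊗ₜ r * v)) = _
    rw [sub_sub_cancel]
  refine ⟨a, r, (1 - e₁) * (1 - e₂), v, fun hmem => ?_, h1, ?_, ?_⟩
  · exact (hprime.mem_or_mem hmem).elim (hsub _ he₁) (hsub _ he₂)
  · rw [hE]
    have h4 : w.1 * 1 ⊗ₜ r = x + 1 ⊗ₜ a := by rw [hx]; ring
    rw [mul_assoc, h4]
    linear_combination (-(1 ⊗ₜ r * v)) * hz
  · rw [hE]
    linear_combination (1 - x * z) * v * hv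

include hF hloc in
-- Lift `y` and `y'` to integral elements `w` and `w'`. The relation `y y' = 1` in `K` is one
-- between elements of `R`, so it passes to the fibre and gives `w w' = 1` near `n`. If `y` were not
-- a unit, `w` would lie in `n`, a contradiction.
theorem IsComparable.isUnit_of_isCentredAt (hinj : Function.Injective (algebraMap R K))
    {P Q : LocalPoint R K} (hP : IsComparable h P) (hQ : IsComparable h Q)
    {n : Ideal (integralClosure A (κ ⊗[A] R))} (hnP : IsCentredAt A κ n P)
    (hnQ : IsCentredAt A κ n Q) (y : P.ring) (y' : Q.ring) (hyy : (y : K) * y' = 1) :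
    IsUnit y := by
  by_contra hy
  obtain ⟨w, hw⟩ := hP.exists_integral_lift κ h hF hloc y
  obtain ⟨w', hw'⟩ := hQ.exists_integral_lift κ h hF hloc y'
  have hwn := hnP.mem_of_mem y ((mem_maximalIdeal _).2 hy) w hw
  obtain ⟨a, r, E, v, hE, h1, h2, h3⟩ := hP.exists_local_frac κ h hF hnP y hw
  obtain ⟨a', r', E', v', hE', h1', h2', h3'⟩ := hQ.exists_local_frac κ h hF hnQ y' hw'
  have hprime := hnP.isMaximal.isPrime
  have haa : a * a' = r * r' := by
    apply hinj
    have e1 : (y : K) * algebraMap R K r = algebraMap R K a := congrArg Subtype.val h1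
    have e2 : (y' : K) * algebraMap R K r' = algebraMap R K a' := congrArg Subtype.val h1'
    rw [map_mul, map_mul, ← e1, ← e2]
    linear_combination algebraMap R K r * algebraMap R K r' * hyy
  have haa' : ((1 : κ) ⊗ₜ[A] a) * (1 ⊗ₜ a') = (1 ⊗ₜ r) * (1 ⊗ₜ r') := by
    rw [Algebra.TensorProduct.tmul_mul_tmul, Algebra.TensorProduct.tmul_mul_tmul, haa]
  have hkey : E * E' * (1 - w * w') = 0 := by
    apply Subtype.ext
    change E.1 * E'.1 * (1 - w.1 * w'.1) = 0
    have e1 : E.1 * E'.1 * (1 - w.1 * w'.1) * ((1 ⊗ₜ r) * (1 ⊗ₜ r')) = 0 := by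
      linear_combination (-(E'.1 * w'.1 * (1 ⊗ₜ r')) : κ ⊗[A] R) * h2 -
        (E.1 * (1 ⊗ₜ a) : κ ⊗[A] R) * h2' - (E.1 * E'.1 : κ ⊗[A] R) * haa'
    have e2 : E.1 * E'.1 * (1 - w.1 * w'.1) =
        E.1 * E'.1 * (1 - w.1 * w'.1) * ((1 ⊗ₜ r) * (1 ⊗ₜ r')) * (v * v') := by
      linear_combination (-(E'.1 * (1 - w.1 * w'.1)) : κ ⊗[A] R) * h3 -
        (E.1 * (1 ⊗ₜ r) * v * (1 - w.1 * w'.1) : κ ⊗[A] R) * h3'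
    rw [e2, e1, zero_mul]
  have hmem : E * E' * (1 - w * w') ∈ n := hkey ▸ zero_mem n
  rcases hprime.mem_or_mem hmem with hmem | hmem
  · exact (hprime.mem_or_mem hmem).elim hE hE'
  · refine (Ideal.ne_top_iff_one n).1 hprime.ne_top ?_
    have := add_mem hmem (n.mul_mem_right w' hwn)
    rwa [sub_add_cancel] at this

include hF hloc in
-- A separatedness argument. An element of the ring of `Q'` whose inverse lies in the ring of `Q`
-- belongs to the ring of `Q`. Applied to `t / t'` this puts the chart of `t'` inside the ring of
-- `Q`; applied to inverses of denominators it does the same for the localisation.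
theorem IsChartPoint.ring_le_of_isCentredAt (hinj : Function.Injective (algebraMap R K))
    {P Q Q' : LocalPoint R K} {t t' : P.ring} (hPQ : IsChartPoint P Q t)
    (hPQ' : IsChartPoint P Q' t') (hQ : IsComparable h Q) (hQ' : IsComparable h Q')
    {n : Ideal (integralClosure A (κ ⊗[A] R))} (hn : IsCentredAt A κ n Q)
    (hn' : IsCentredAt A κ n Q') : Q'.ring ≤ Q.ring := by
  have ht := hPQ.ne_zero
  have ht' := hPQ'.ne_zero
  have hinv : ∀ y : Q.ring, ∀ y' : Q'.ring, (y : K) * y' = 1 → (y' : K) ∈ Q.ring := by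
    intro y y' hyy
    obtain ⟨z, hz⟩ := (hQ.isUnit_of_isCentredAt κ h hF hloc hinj hQ' hn hn' y y'
      hyy).exists_right_inv
    have hz' : (y : K) * z = 1 := congrArg Subtype.val hz
    have : (y' : K) = z := by linear_combination (z : K) * hyy - (y' : K) * hz'
    rw [this]
    exact z.2
  have h1 : (t : K) / t' ∈ Q.ring := hinv ⟨_, hPQ.div_mem _ hPQ'.mem_maximalIdeal⟩
    ⟨_, hPQ'.div_mem _ hPQ.mem_maximalIdeal⟩ (by simp only []; field_simp)
  have hchart : blowupChart P (t' : K) ≤ Q.ring := by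
    refine blowupChart_le P Q ht' hPQ.le fun z hz => ?_
    have : (z : K) / t' = z / t * (t / t') := by field_simp
    rw [this]
    exact mul_mem (hPQ.div_mem z hz) h1
  intro x hx
  obtain ⟨a, b, hb, hu, hab⟩ := hPQ'.exists_eq_div ⟨x, hx⟩
  obtain ⟨c, hc⟩ := hu.exists_right_inv
  have hc' : (b : K) * c = 1 := congrArg Subtype.val hc
  have h2 : (c : K) ∈ Q.ring := hinv ⟨b, hchart b.2⟩ c hc'
  have : x = a * c := by
    rw [← hab]
    linear_combination -x * hc'
  rw [this]
  exact mul_mem (hchart a.2) h2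

include hF hloc in
/-- Only finitely many points infinitely near to `P` of the first order lie on the strict
transform. -/
theorem IsComparable.finite_children (hinj : Function.Injective (algebraMap R K)) {g : A}
    (hg : g ∈ maximalIdeal A) (hgh : g ∉ Ideal.span {h})
    [Module.Finite A (integralClosure A (κ ⊗[A] R))]
    {P : LocalPoint R K} (hP : IsComparable h P) :
    {Q | IsOnExceptionalDivisor P Q ∧ Nontrivial (κ ⊗[A] Q.ring)}.Finite := by
  have hprime : (Ideal.span {h}).IsPrime := (Ideal.Quotient.isDomain_iff_prime _).1 inferInstance
  have hex : ∀ Q : {Q | IsOnExceptionalDivisor P Q ∧ Nontrivial (κ ⊗[A] Q.ring)},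
      ∃ n, IsCentredAt A κ n Q.1 ∧ IsComparable h Q.1 := by
    rintro ⟨Q, hPQ, hQ⟩
    obtain ⟨t, ht⟩ := hPQ.exists_isChartPoint
    have hQc := hP.of_isChartPoint h (hloc g hg) hgh ht
    obtain ⟨n, hn⟩ := hQc.exists_isCentredAt κ h hF hloc
    exact ⟨n, hn, hQc⟩
  choose n hn hc using hex
  have := (finite_setOf_isMaximal_of_finite A (integralClosure A (κ ⊗[A] R))).to_subtype
  refine Set.finite_coe_iff.1 ?_
  refine Finite.of_injective (β := {n : Ideal (integralClosure A (κ ⊗[A] R)) | n.IsMaximal})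
    (fun Q => ⟨n Q, (hn Q).isMaximal⟩) fun Q Q' hQQ => ?_
  have hnn : n Q = n Q' := congrArg Subtype.val hQQ
  obtain ⟨t, ht⟩ := Q.2.1.exists_isChartPoint
  obtain ⟨t', ht'⟩ := Q'.2.1.exists_isChartPoint
  have hn' := hn Q'
  rw [← hnn] at hn'
  exact Subtype.ext (LocalPoint.ext_ring (le_antisymm
    (ht'.ring_le_of_isCentredAt κ h hF hloc hinj ht (hc Q') (hc Q) hn' (hn Q))
    (ht.ring_le_of_isCentredAt κ h hF hloc hinj ht' (hc Q) (hc Q') (hn Q) hn')))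

end Children

/-! ## Blowup sequences governed by a decreasing measure -/

section Sequences

theorem Module.length_quotient_lt_of_lt {A M : Type*} [CommRing A] [AddCommGroup M] [Module A M]
    {p q : Submodule A M} (hpq : p < q) (hfin : Module.length A (M ⧸ p) ≠ ⊤) :
    Module.length A (M ⧸ q) < Module.length A (M ⧸ p) := by
  rw [Module.length_ne_top_iff, isFiniteLength_iff_isNoetherian_isArtinian] at hfin
  obtain ⟨_, _⟩ := hfin
  have := Submodule.length_quotient_lt (R := A) (q.map p.mkQ) (by
    rw [Ne, eq_bot_iff, Submodule.map_le_iff_le_comap, Submodule.comap_bot, Submodule.ker_mkQ]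
    exact hpq.not_ge)
  rwa [(Submodule.quotientQuotientEquivQuotient p q hpq.le).length_eq] at this

variable {R K : Type*} [CommRing R] [CommRing K] [Algebra R K]

/-- Blow up in the order of decreasing `d`: the point of least value comes last, and the point below
it, having a larger value, has already been blown up. -/
theorem exists_isBlowupSequence (T : Finset (LocalPoint R K)) (d : LocalPoint R K → ℕ)
    (hT : ∀ P ∈ T, P.ring = ⊥ ∨ ∃ Q ∈ T, IsOnExceptionalDivisor Q P ∧ d P < d Q) :
    ∃ l, IsBlowupSequence l ∧ ∀ P, P ∈ l ↔ P ∈ T := by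
  classical
  induction T using Finset.induction_on_min_value d with
  | empty => exact ⟨[], .nil, by simp⟩
  | insert a s ha hmin ih =>
    obtain ⟨l, hl, hls⟩ := ih (fun P hP => (hT P (Finset.mem_insert_of_mem hP)).imp id (by
      rintro ⟨Q, hQ, hQP, hlt⟩
      refine ⟨Q, (Finset.mem_insert.1 hQ).resolve_left ?_, hQP, hlt⟩
      rintro rfl
      exact (hmin P hP).not_gt hlt))
    refine ⟨a :: l, .cons hl ⟨?_, fun h => ha ((hls a).1 h)⟩, fun P => ?_⟩
    · refine (hT a (Finset.mem_insert_self a s)).imp id ?_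
      rintro ⟨Q, hQ, hQa, hlt⟩
      refine ⟨Q, (hls Q).2 ((Finset.mem_insert.1 hQ).resolve_left ?_), hQa⟩
      rintro rfl
      exact hlt.false
    · rw [List.mem_cons, Finset.mem_insert, hls]

theorem length_le_of_isChain (T : Set (LocalPoint R K)) (d : LocalPoint R K → ℕ)
    (hpos : ∀ P ∈ T, 1 ≤ d P)
    (hlt : ∀ P ∈ T, ∀ Q ∈ T, IsOnExceptionalDivisor P Q → d Q < d P) :
    ∀ (P : LocalPoint R K) (c : List (LocalPoint R K)), (∀ Q ∈ P :: c, Q ∈ T) →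
      (P :: c).IsChain IsOnExceptionalDivisor → (P :: c).length ≤ d P := by
  intro P c
  induction c generalizing P with
  | nil => exact fun h _ => hpos P (h P (by simp))
  | cons Q c ih =>
    intro h hc
    rw [List.isChain_cons_cons] at hc
    have h1 := ih Q (fun Q' hQ' => h Q' (List.mem_cons_of_mem _ hQ')) hc.2
    have h2 := hlt P (h P (by simp)) Q (h Q (by simp)) hc.1
    simp only [List.length_cons] at h1 ⊢
    omega

/-- The curve `V(f)` is not resolved at the point `P`. -/
def IsUnresolvedAt [IsLocalRing R] (f : R) (P : LocalPoint R K) : Prop :=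
  ¬ (strictTransform f P = ⊤ ∨ IsRegularLocalRing (P.ring ⧸ strictTransform f P))

/-- The unresolved points infinitely near to the closed point, to a given order. -/
def unresolvedLevel [IsLocalRing R] (f : R) (K : Type*) [CommRing K] [Algebra R K] :
    ℕ → Set (LocalPoint R K)
  | 0 => {P | P.ring = ⊥ ∧ IsUnresolvedAt f P}
  | i + 1 => {Q | ∃ P ∈ unresolvedLevel f K i, IsOnExceptionalDivisor P Q ∧ IsUnresolvedAt f Q}

/-- Blow up all unresolved infinitely near points that are reached through unresolved ones. The
measure makes this set finite and bounds its chains; any closed point left over is resolved, since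
otherwise it would belong to the set. -/
theorem resolutionStages_le_of_measure {R : Type*} [CommRing R] [IsLocalRing R] (f : R)
    (good : LocalPoint R (FractionRing R) → Prop) (d : LocalPoint R (FractionRing R) → ℕ) (N : ℕ)
    (hbot : ∀ P, P.ring = ⊥ → good P ∧ d P ≤ N)
    (hgood : ∀ P Q, good P → IsOnExceptionalDivisor P Q → good Q)
    (hdrop : ∀ P Q, good P → IsUnresolvedAt f P → IsOnExceptionalDivisor P Q →
      IsUnresolvedAt f Q → d Q < d P)
    (hpos : ∀ P, good P → IsUnresolvedAt f P → 1 ≤ d P)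
    (hfin : ∀ P, good P → {Q | IsOnExceptionalDivisor P Q ∧ IsUnresolvedAt f Q}.Finite) :
    resolutionStages R f ≤ N := by
  have hlev : ∀ i, ∀ P ∈ unresolvedLevel f (FractionRing R) i,
      good P ∧ IsUnresolvedAt f P ∧ d P + i ≤ N := by
    intro i
    induction i with
    | zero => exact fun P hP => ⟨(hbot P hP.1).1, hP.2, (hbot P hP.1).2⟩
    | succ i ih =>
      rintro Q ⟨P, hP, hPQ, hQ⟩
      obtain ⟨h1, h2, h3⟩ := ih P hP
      have := hdrop P Q h1 h2 hPQ hQ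
      exact ⟨hgood P Q h1 hPQ, hQ, by omega⟩
  have hlevfin : ∀ i, (unresolvedLevel f (FractionRing R) i).Finite := by
    intro i
    induction i with
    | zero =>
      refine Set.Subsingleton.finite fun P hP Q hQ => ?_
      have hring : P.ring = Q.ring := hP.1.trans hQ.1.symm
      exact LocalPoint.ext_ring hring
    | succ i ih =>
      refine (ih.biUnion fun P hP => hfin P (hlev i P hP).1).subset ?_
      rintro Q ⟨P, hP, hPQ⟩
      exact Set.mem_biUnion hP hPQ
  -- Levels above `N` are empty because `d P + i ≤ N` at level `i`.
  let T : Set (LocalPoint R (FractionRing R)) :=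
    ⋃ i ∈ Set.Iic N, unresolvedLevel f (FractionRing R) i
  have hTfin : T.Finite := (Set.finite_Iic N).biUnion fun i _ => hlevfin i
  have hTmem : ∀ P, P ∈ T ↔ ∃ i, P ∈ unresolvedLevel f (FractionRing R) i := by
    intro P
    refine ⟨fun hP => ?_, fun ⟨i, hi⟩ => ?_⟩
    · obtain ⟨i, -, hi⟩ := Set.mem_iUnion₂.1 hP
      exact ⟨i, hi⟩
    · have := (hlev i P hi).2.2
      exact Set.mem_biUnion (show i ≤ N by omega) hi
  have hTgood : ∀ P ∈ T, good P ∧ IsUnresolvedAt f P ∧ d P ≤ N := by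
    intro P hP
    obtain ⟨i, hi⟩ := (hTmem P).1 hP
    obtain ⟨h1, h2, h3⟩ := hlev i P hi
    exact ⟨h1, h2, by omega⟩
  have hTlt : ∀ P ∈ T, ∀ Q ∈ T, IsOnExceptionalDivisor P Q → d Q < d P := fun P hP Q hQ hPQ =>
    hdrop P Q (hTgood P hP).1 (hTgood P hP).2.1 hPQ (hTgood Q hQ).2.1
  obtain ⟨l, hl, hlT⟩ := exists_isBlowupSequence hTfin.toFinset d (by
    intro P hP
    rw [Set.Finite.mem_toFinset] at hP
    obtain ⟨i, hi⟩ := (hTmem P).1 hP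
    cases i with
    | zero => exact Or.inl hi.1
    | succ i =>
      obtain ⟨Q, hQ, hQP, -⟩ := hi
      have hQT := (hTmem Q).2 ⟨i, hQ⟩
      exact Or.inr ⟨Q, (Set.Finite.mem_toFinset _).2 hQT, hQP, hTlt Q hQT P hP hQP⟩)
  have hlT' : ∀ P, P ∈ l ↔ P ∈ T := fun P => (hlT P).trans (Set.Finite.mem_toFinset _)
  have hres : ResolvesCurve f l := by
    intro P hP
    by_contra hn
    refine hP.2 ((hlT' P).2 ((hTmem P).2 ?_))
    rcases hP.1 with hb | ⟨Q, hQ, hQP⟩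
    · exact ⟨0, hb, hn⟩
    · obtain ⟨i, hi⟩ := (hTmem Q).1 ((hlT' Q).1 hQ)
      exact ⟨i + 1, Q, hi, hQP, hn⟩
  refine (iInf_le _ ⟨l, hl, hres⟩).trans (iSup_le ?_)
  rintro ⟨c, hc, hchain⟩
  cases c with
  | nil => simp
  | cons P c =>
    have h1 := length_le_of_isChain T d (fun P hP => hpos P (hTgood P hP).1 (hTgood P hP).2.1) hTlt
      P c (fun Q hQ => (hlT' Q).1 (hc Q hQ)) hchain
    have h2 := (hTgood P ((hlT' P).1 (hc P (by simp)))).2.2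
    exact_mod_cast h1.trans h2

end Sequences

/-! ## The bound on the number of blowup stages for a finite extension of local rings -/

section Bound

/-- The maximal ideal has a single generator `ϖ`, which is not nilpotent since the dimension is one.
By Krull's intersection theorem every nonzero element is a unit times a power of `ϖ`, so there are
no zero divisors. -/
theorem IsRegularLocalRing.isDomain_and_isPrincipalIdealRing_of_ringKrullDim_eq_one {V : Type*}
    [CommRing V] [IsRegularLocalRing V] (hV : ringKrullDim V = 1) :
    IsDomain V ∧ IsPrincipalIdealRing V := by
  have h1 : (maximalIdeal V).spanFinrank = 1 := by
    have := IsRegularLocalRing.spanFinrank_maximalIdeal (R := V)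
    rw [hV] at this
    exact_mod_cast this
  obtain ⟨ϖ, hϖ⟩ := ((Submodule.spanFinrank_eq_one_iff _).1 h1).1.principal
  change maximalIdeal V = Ideal.span {ϖ} at hϖ
  have hnil : ∀ n, ϖ ^ n ≠ 0 := by
    intro n hn
    have : Ring.KrullDimLE 0 V := by
      refine Ring.krullDimLE_zero_iff.2 fun q hq => ?_
      have : maximalIdeal V ≤ q := by
        rw [hϖ, Ideal.span_singleton_le_iff_mem]
        exact hq.mem_of_pow_mem n (hn ▸ zero_mem q)
      rw [← (maximalIdeal.isMaximal V).eq_of_le hq.ne_top this]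
      infer_instance
    rw [Ring.krullDimLE_iff, hV] at this
    exact absurd this (by norm_num)
  have hform : ∀ a : V, a ≠ 0 → ∃ (n : ℕ) (u : V), IsUnit u ∧ a = u * ϖ ^ n := by
    intro a ha
    have h2 : ∃ n, a ∉ maximalIdeal V ^ n := by
      by_contra! hall
      have : a ∈ ⨅ n, maximalIdeal V ^ n := Ideal.mem_iInf.2 hall
      rw [Ideal.iInf_pow_eq_bot_of_isLocalRing _ (maximalIdeal.isMaximal V).ne_top] at this
      exact ha this
    classical
    obtain ⟨n, hn⟩ : ∃ n, Nat.find h2 = n + 1 := Nat.exists_eq_succ_of_ne_zero fun h0 => by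
      have := Nat.find_spec h2
      rw [h0, pow_zero] at this
      exact this (by simp)
    have h3 : a ∈ maximalIdeal V ^ n := by
      by_contra h4
      have := Nat.find_min' h2 h4
      omega
    rw [hϖ, Ideal.span_singleton_pow] at h3
    obtain ⟨u, rfl⟩ := Ideal.mem_span_singleton'.1 h3
    refine ⟨n, u, ?_, rfl⟩
    by_contra hu
    have h5 : u ∈ maximalIdeal V := (mem_maximalIdeal _).2 hu
    refine Nat.find_spec h2 ?_
    rw [hn, pow_succ', hϖ, Ideal.span_singleton_pow, ← hϖ]
    exact Ideal.mul_mem_mul h5 (Ideal.mem_span_singleton_self _)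
  have : NoZeroDivisors V := ⟨fun {a b} hab => by
    by_contra! hne
    obtain ⟨n, u, hu, rfl⟩ := hform a hne.1
    obtain ⟨m, v, hv, rfl⟩ := hform b hne.2
    refine hnil (n + m) (((hu.mul hv).mul_right_eq_zero).1 ?_)
    rw [pow_add, ← hab]
    ring⟩
  have hdom : IsDomain V := NoZeroDivisors.to_isDomain V
  exact ⟨hdom, ((tfae_of_isNoetherianRing_of_isLocalRing_of_isDomain V).out 0 4
    (a := IsPrincipalIdealRing V) (b := (maximalIdeal V).IsPrincipal)).2 ⟨ϖ, hϖ⟩⟩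

/-! ### Primes and lengths over a base with principal quotient `A/hA` -/

section Base

variable {A : Type*} [CommRing A] [IsLocalRing A] {h : A}
  [IsDomain (A ⧸ Ideal.span {h})] [IsPrincipalIdealRing (A ⧸ Ideal.span {h})]

/-- The image of `p` in the principal ideal domain `A/hA` is a nonzero prime, hence maximal. -/
theorem Ideal.eq_maximalIdeal_of_mem_of_notMem {p : Ideal A} [hp : p.IsPrime] {c : A}
    (hhp : h ∈ p) (hcp : c ∈ p) (hc : c ∉ Ideal.span {h}) : p = maximalIdeal A := by
  apply eq_maximalIdeal
  have hle : RingHom.ker (Ideal.Quotient.mk (Ideal.span {h})) ≤ p := by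
    rw [Ideal.mk_ker, Ideal.span_singleton_le_iff_mem]
    exact hhp
  have hcomap := Ideal.comap_map_of_surjective' (Ideal.Quotient.mk (Ideal.span {h}))
    Ideal.Quotient.mk_surjective p
  rw [sup_eq_left.2 hle] at hcomap
  have hpr : (p.map (Ideal.Quotient.mk (Ideal.span {h}))).IsPrime :=
    Ideal.map_isPrime_of_surjective Ideal.Quotient.mk_surjective hle
  have hne : p.map (Ideal.Quotient.mk (Ideal.span {h})) ≠ ⊥ := by
    intro h0
    have := Ideal.mem_map_of_mem (Ideal.Quotient.mk (Ideal.span {h})) hcp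
    rw [h0, Ideal.mem_bot] at this
    exact hc (Ideal.Quotient.eq_zero_iff_mem.1 this)
  have := hpr.isMaximal hne
  rw [← hcomap]
  exact Ideal.comap_isMaximal_of_surjective _ Ideal.Quotient.mk_surjective

theorem length_quotient_span_pair_ne_top [IsNoetherianRing A] {g : A}
    (hg : g ∉ Ideal.span {h}) : Module.length A (A ⧸ Ideal.span {g, h}) ≠ ⊤ := by
  have : Ring.KrullDimLE 0 (A ⧸ Ideal.span {g, h}) := by
    refine Ring.krullDimLE_zero_iff.2 fun q hq => ?_
    have h1 : (q.comap (Ideal.Quotient.mk (Ideal.span {g, h}))) = maximalIdeal A := by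
      refine Ideal.eq_maximalIdeal_of_mem_of_notMem (h := h) (c := g) ?_ ?_ hg <;>
      · rw [Ideal.mem_comap, Ideal.Quotient.eq_zero_iff_mem.2 (Ideal.subset_span (by simp))]
        exact zero_mem _
    have h2 : (q.comap (Ideal.Quotient.mk (Ideal.span {g, h}))).IsMaximal := by
      rw [h1]; infer_instance
    exact Ideal.isMaximal_of_isIntegral_of_isMaximal_comap (R := A) q h2
  have : IsArtinianRing (A ⧸ Ideal.span {g, h}) := isArtinianRing_iff_krullDimLE_zero.2 this
  have h2 : IsArtinian A (A ⧸ Ideal.span {g, h}) :=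
    isArtinian_of_surjective_algebraMap (Ideal.Quotient.mk_surjective (I := .span {g, h}))
  rw [Module.length_ne_top_iff, isFiniteLength_iff_isNoetherian_isArtinian]
  exact ⟨inferInstance, h2⟩

theorem exists_pow_mem_span_pair {R : Type*} [CommRing R] [IsLocalRing R] [Algebra A R]
    [Module.Finite A R] {c : A} (hc : c ∉ Ideal.span {h}) {b : R} (hb : b ∈ maximalIdeal R) :
    ∃ n, b ^ n ∈ Ideal.span {algebraMap A R h, algebraMap A R c} := by
  change b ∈ (Ideal.span {algebraMap A R h, algebraMap A R c}).radical
  rw [Ideal.radical_eq_sInf, Ideal.mem_sInf]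
  rintro q ⟨hle, hq⟩
  have h1 : q.comap (algebraMap A R) = maximalIdeal A :=
    Ideal.eq_maximalIdeal_of_mem_of_notMem (h := h) (c := c)
      (hle (Ideal.subset_span (by simp))) (hle (Ideal.subset_span (by simp))) hc
  have h2 : q.IsMaximal := Ideal.isMaximal_of_isIntegral_of_isMaximal_comap (R := A) q (by
    rw [h1]; infer_instance)
  rw [eq_maximalIdeal h2]
  exact hb

end Base

/-! ### The δ-invariant bounds the number of stages -/

section Delta

variable {A R : Type*} [CommRing A] [CommRing R] [IsDomain R] [Algebra A R]
  (κ : Type*) [Field κ] [Algebra A κ]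
  (h : A) [Algebra (A ⧸ Ideal.span {h}) κ] [IsScalarTower A (A ⧸ Ideal.span {h}) κ]
  [IsFractionRing (A ⧸ Ideal.span {h}) κ]
  [IsLocalRing A] [IsNoetherianRing A] [IsAdicComplete (maximalIdeal A) A] [IsLocalRing R]
  [Module.Finite A R] [IsPrincipalIdealRing (A ⧸ Ideal.span {h})] [IsDomain (A ⧸ Ideal.span {h})]
  [Module.Finite A (integralClosure A (κ ⊗[A] R))]

theorem resolutionStages_le_length (hF : ∀ x : κ ⊗[A] R, ∃ y, x * x * y = x)
    (hloc : ∀ a ∈ maximalIdeal A, algebraMap A R a ∈ maximalIdeal R)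
    {g : A} (hg : g ∈ maximalIdeal A) (hgh : g ∉ Ideal.span {h})
    (hfin : Module.length A (integralClosure A (κ ⊗[A] R) ⧸ imageInIntegralClosure A R κ) ≠ ⊤) :
    resolutionStages R (algebraMap A R h) ≤
      Module.length A (integralClosure A (κ ⊗[A] R) ⧸ imageInIntegralClosure A R κ) := by
  let K := FractionRing R
  have hinj : Function.Injective (algebraMap R K) := IsFractionRing.injective R K
  have hprime : (Ideal.span {h}).IsPrime := (Ideal.Quotient.isDomain_iff_prime _).1 inferInstance
  -- The part of the δ-invariant still missing at `P`: it is at most the full δ because every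
  -- element of `R` is a function at `P`.
  let d : LocalPoint R K → ℕ∞ := fun P =>
    Module.length A (integralClosure A (κ ⊗[A] R) ⧸ pointOrder A κ P)
  have hdle : ∀ P, d P ≤
      Module.length A (integralClosure A (κ ⊗[A] R) ⧸ imageInIntegralClosure A R κ) := fun P =>
    Module.length_le_of_surjective
      (Submodule.factor (imageInIntegralClosure_le_pointOrder κ P))
      (Submodule.factor_surjective _)
  have hdfin : ∀ P, d P ≠ ⊤ := fun P => ((hdle P).trans_lt (lt_top_iff_ne_top.2 hfin)).ne
  have hkernel : ∀ P : LocalPoint R K, strictTransform (algebraMap A R h) P = fibreKernel A κ P :=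
    fun P => Ideal.ext fun a => mem_strictTransform_iff h κ (hloc g hg) hgh
      (fun c hc b hb => exists_pow_mem_span_pair hc hb) P a
  have hnt : ∀ P : LocalPoint R K, IsUnresolvedAt (algebraMap A R h) P →
      Nontrivial (κ ⊗[A] P.ring) := by
    intro P hP
    by_contra hn
    rw [not_nontrivial_iff_subsingleton] at hn
    refine hP (Or.inl ?_)
    rw [hkernel, Ideal.eq_top_iff_one, mem_fibreKernel]
    exact Subsingleton.elim _ _
  have hsing : ∀ P : LocalPoint R K, IsUnresolvedAt (algebraMap A R h) P →
      ¬ IsRegularLocalRing (P.ring ⧸ fibreKernel A κ P) := by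
    intro P hP hreg
    exact hP (Or.inr (by rw [hkernel]; exact hreg))
  rw [← ENat.natCast_toNat hfin]
  refine resolutionStages_le_of_measure _ (IsComparable h) (fun P => (d P).toNat) _ ?_ ?_ ?_ ?_ ?_
  · exact fun P hP => ⟨.of_eq_bot h hprime.ne_top hP hinj, ENat.toNat_le_toNat (hdle P) hfin⟩
  · intro P Q hP hPQ
    obtain ⟨t, ht⟩ := hPQ.exists_isChartPoint
    exact hP.of_isChartPoint h (hloc g hg) hgh ht
  · intro P Q hP hPs hPQ hQs
    obtain ⟨t, ht⟩ := hPQ.exists_isChartPoint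
    have hQ := hP.of_isChartPoint h (hloc g hg) hgh ht
    have := hnt Q hQs
    -- Equality would make the curve regular at `P`.
    have hlt : pointOrder A κ P < pointOrder A κ Q :=
      lt_of_le_not_ge (pointOrder_mono κ ht.le) fun hle =>
        hsing P hPs (hP.isRegularLocalRing_of_pointOrder_le κ h hg hgh hQ ht hle hF hloc)
    have h1 : d Q < d P := Module.length_quotient_lt_of_lt hlt (hdfin P)
    rw [← ENat.natCast_toNat (hdfin P), ← ENat.natCast_toNat (hdfin Q)] at h1
    exact_mod_cast h1
  · intro P hP hPs
    have := hnt P hPs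
    by_contra h0
    have h1 : d P = 0 := by
      rw [← ENat.natCast_toNat (hdfin P)]
      have : (d P).toNat = 0 := by omega
      rw [this]; rfl
    have h2 : pointOrder A κ P = ⊤ := by
      rw [Module.length_eq_zero_iff] at h1
      exact Submodule.Quotient.subsingleton_iff.1 h1
    exact hsing P hPs (hP.isRegularLocalRing_of_pointOrder_eq_top κ h hF hloc h2)
  · intro P hP
    exact (hP.finite_children κ h hF hloc hinj hg hgh).subset fun Q hQ => ⟨hQ.1, hnt Q hQ.2⟩

end Delta

/-- The bound on the number of blowup stages for a finite extension of complete local rings which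
is unramified outside `g = 0`. -/
theorem resolutionStages_le_of_finite {A R : Type u} [CommRing A] [IsLocalRing A]
    [IsNoetherianRing A] [IsAdicComplete (maximalIdeal A) A] [CommRing R] [IsLocalRing R]
    [IsDomain R] [Algebra A R] [Module.Finite A R]
    (hinj : Function.Injective (algebraMap A R))
    (hloc : ∀ a ∈ maximalIdeal A, algebraMap A R a ∈ maximalIdeal R)
    {x y : R} (hx : Prime x) (hyx : y ∉ Ideal.span {x}) (hxm : x ∈ maximalIdeal R)
    (hym : y ∈ maximalIdeal R) {g h : A}
    (hg : g ∈ maximalIdeal A) (hh : h ∈ maximalIdeal A) (hh0 : h ≠ 0)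
    (hC : IsRegularLocalRing (A ⧸ Ideal.span {h}))
    (hC1 : ringKrullDim (A ⧸ Ideal.span {h}) = 1) (hgh : g ∉ Ideal.span {h})
    (hunr : ∀ (p : Ideal A) [p.IsPrime], g ∉ p →
      Algebra.FormallyUnramified p.ResidueField (p.ResidueField ⊗[A] R)) :
    (annihilatingExponents (FractionRing A) R g).Nonempty ∧
    Module.Finite A (CodifferentQuotient A (FractionRing A) R) ∧
    Module.length A (A ⧸ Ideal.span {g, h}) ≠ ⊤ ∧
    resolutionStages R (algebraMap A R h) ≤
      (leastExponent (FractionRing A) R g : ℕ∞) *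
        (codifferentGenerators A (FractionRing A) R : ℕ∞) *
        Module.length A (A ⧸ Ideal.span {g, h}) := by
  classical
  obtain ⟨hdom, hpid⟩ :=
    IsRegularLocalRing.isDomain_and_isPrincipalIdealRing_of_ringKrullDim_eq_one hC1
  have hdomA : IsDomain A := hinj.isDomain (algebraMap A R)
  have hprime : (Ideal.span {h}).IsPrime := (Ideal.Quotient.isDomain_iff_prime _).1 hdom
  have hhR : algebraMap A R h ≠ 0 := fun h0 => hh0 (hinj (h0.trans (map_zero _).symm))
  have hspan : ∀ r : R, r ∈ (Ideal.span {h} • ⊤ : Submodule A R) ↔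
      r ∈ Ideal.span {algebraMap A R h} := by
    intro r
    rw [mem_span_singleton_smul_top_iff, Ideal.mem_span_singleton']
    simp only [Algebra.smul_def, mul_comm]
  -- Torsion-freeness of `R/hR`: if `c r ∈ hR` with `c ∉ (h)`, then powers of `x` and `y`, lying in
  -- `(h, c)R`, also multiply `r` into `hR`, and depth two gives `r ∈ hR`.
  have hfree : Module.Free A R := by
    refine Module.free_of_isTorsionFree_quotient h hh (fun r hr => ?_) fun c hc r hr => ?_
    · rw [Algebra.smul_def] at hr
      exact (mul_eq_zero.1 hr).resolve_left hhR
    · rw [hspan] at hr ⊢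
      have key : ∀ b ∈ maximalIdeal R, ∃ n, b ^ n * r ∈ Ideal.span {algebraMap A R h} := by
        intro b hb
        obtain ⟨n, hn⟩ := exists_pow_mem_span_pair (R := R) hc hb
        obtain ⟨u, v, huv⟩ := Ideal.mem_span_pair.1 hn
        refine ⟨n, ?_⟩
        have : b ^ n * r = u * r * algebraMap A R h + v * (c • r) := by
          rw [← huv, Algebra.smul_def]; ring
        rw [this]
        exact add_mem (Ideal.mul_mem_left _ _ (Ideal.mem_span_singleton_self _))
          (Ideal.mul_mem_left _ _ hr)
      obtain ⟨m, hm⟩ := key x hxm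
      obtain ⟨n, hn⟩ := key y hym
      refine mem_span_of_pow_mul_mem hx hyx hhR (n := m + n) ?_ ?_
      · rw [pow_add, mul_comm (x ^ m), mul_assoc]; exact Ideal.mul_mem_left _ _ hm
      · rw [pow_add, mul_assoc]; exact Ideal.mul_mem_left _ _ hn
  let b := Module.Free.chooseBasis A R
  obtain ⟨n, hn⟩ := exists_discr_dvd_pow b g hunr
  let κ := FractionRing (A ⧸ Ideal.span {h})
  let K := FractionRing A
  have hκ : ∀ a : A, algebraMap A κ a = 0 ↔ a ∈ Ideal.span {h} :=
    algebraMap_fractionRing_quotient_eq_zero_iff (Ideal.span {h}) κ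
  -- The discriminant divides `g^n`, and `g` lies outside the prime `(h)`.
  have hdκ : algebraMap A κ (Algebra.discr A b) ≠ 0 := by
    rw [Ne, hκ]
    intro hd
    exact hgh (hprime.mem_of_pow_mem n (Ideal.mem_of_dvd _ hn hd))
  have hK : Function.Injective (algebraMap A K) := IsFractionRing.injective A K
  have hdK : algebraMap A K (Algebra.discr A b) ≠ 0 := fun h0 => hdκ (by
    rw [hK (h0.trans (map_zero _).symm), map_zero])
  have hne : (annihilatingExponents K R g).Nonempty :=
    ⟨n, mem_annihilatingExponents_of_discr_dvd b K hdK hn⟩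
  have hfin : Module.Finite A (CodifferentQuotient A K R) := CodifferentQuotient.finite b K hdK hK
  have hlen := length_quotient_span_pair_ne_top hgh
  refine ⟨hne, hfin, hlen, ?_⟩
  have := integralClosure_fibre_finite b (Ideal.span {h}) κ hdκ
  have hbound := (length_integralClosure_quotient_le_functionalQuotient b (Ideal.span {h}) κ
    hdκ).trans (length_functionalQuotient_le b K κ g h ((hκ h).2 (Ideal.mem_span_singleton_self h))
      hdK hK hne)
  refine (resolutionStages_le_length κ h (exists_mul_mul_eq_self_fibre b κ hdκ) hloc hg hgh
    (hbound.trans_lt (lt_top_iff_ne_top.2 ?_)).ne).trans hbound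
  exact WithTop.mul_ne_top (WithTop.mul_ne_top (ENat.natCast_ne_top _) (ENat.natCast_ne_top _)) hlen

end Bound

/-! ## Completions of formally smooth local algebras -/

section FormallySmoothCompletion

open KaehlerDifferential

/-- Local coordinates on a formally smooth local algebra with trivial residue field extension,
with the coordinate derivations at the closed point. -/
theorem exists_local_coordinates {k O : Type u} [Field k] [CommRing O] [IsLocalRing O]
    [IsNoetherianRing O] [Algebra k O] [Algebra.FormallySmooth k O] {n : ℕ}
    (b : Module.Basis (Fin n) O Ω[O⁄k])
    (hres : Function.Bijective (algebraMap k (ResidueField O))) :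
    ∃ (c : O →ₐ[k] k) (δ : Fin n → O →ₗ[k] k) (x : Fin n → O),
      (∀ a, c a = 0 ↔ a ∈ maximalIdeal O) ∧
      (∀ i a a', δ i (a * a') = c a * δ i a' + c a' * δ i a) ∧
      (∀ i j, δ i (x j) = if i = j then 1 else 0) ∧
      maximalIdeal O = Ideal.span (Set.range x) := by
  classical
  let F := ResidueField O
  let e : k ≃ₐ[k] F := AlgEquiv.ofBijective (Algebra.ofId k F) hres
  let c : O →ₐ[k] k := e.symm.toAlgHom.comp (IsScalarTower.toAlgHom k O F)
  have hc : ∀ a, e (c a) = algebraMap O F a := fun a => e.apply_symm_apply _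
  have hker : RingHom.ker (algebraMap O F) = maximalIdeal O := ker_residue
  have hc0 : ∀ a, c a = 0 ↔ a ∈ maximalIdeal O := by
    intro a
    rw [← hker, RingHom.mem_ker, ← hc]
    exact (map_eq_zero_iff e e.injective).symm
  let bF := b.baseChange F
  let d : O →ₗ[k] F ⊗[O] Ω[O⁄k] :=
    ((TensorProduct.mk O F Ω[O⁄k] 1).restrictScalars k).comp (D k O).toLinearMap
  have hd : ∀ a, d a = 1 ⊗ₜ D k O a := fun _ => rfl
  let δ : Fin n → O →ₗ[k] k := fun i =>
    e.symm.toLinearMap.comp (((bF.coord i).restrictScalars k).comp d)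
  have hδ : ∀ i a, e (δ i a) = bF.repr (d a) i := fun i a => e.apply_symm_apply _
  have hsmul : ∀ (a : O) (ω : Ω[O⁄k]), (1 : F) ⊗ₜ[O] (a • ω) = algebraMap O F a • (1 ⊗ₜ[O] ω) := by
    intro a ω
    rw [TensorProduct.tmul_smul, algebraMap_smul]
  -- Each function differs from a constant by an element of the maximal ideal, and constants have
  -- zero differential.
  have hN : LinearMap.range (kerToTensor k O F) = ⊤ := by
    have hD : ∀ a, (1 : F) ⊗ₜ[O] D k O a ∈ LinearMap.range (kerToTensor k O F) := by
      intro a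
      have ha : a - algebraMap k O (c a) ∈ RingHom.ker (algebraMap O F) := by
        rw [hker, ← hc0, map_sub, AlgHom.commutes]
        exact sub_self _
      refine ⟨⟨_, ha⟩, ?_⟩
      change (1 : F) ⊗ₜ[O] D k O (a - algebraMap k O (c a)) = _
      rw [map_sub, Derivation.map_algebraMap, sub_zero]
    have h1 : ∀ ω : Ω[O⁄k], (1 : F) ⊗ₜ[O] ω ∈ LinearMap.range (kerToTensor k O F) := by
      intro ω
      have hω : ω ∈ Submodule.span O (Set.range (D k O)) := by
        rw [span_range_derivation]; trivial
      induction hω using Submodule.span_induction with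
      | mem x hx => obtain ⟨a, rfl⟩ := hx; exact hD a
      | zero => rw [TensorProduct.tmul_zero]; exact zero_mem _
      | add x y _ _ hx hy => rw [TensorProduct.tmul_add]; exact add_mem hx hy
      | smul a x _ hx => rw [TensorProduct.tmul_smul]; exact Submodule.smul_mem _ a hx
    rw [eq_top_iff]
    intro m _
    induction m with
    | zero => exact zero_mem _
    | add x y hx hy => exact add_mem (hx trivial) (hy trivial)
    | tmul s ω =>
      obtain ⟨a, rfl⟩ := IsLocalRing.residue_surjective (R := O) s
      have : residue O a ⊗ₜ[O] ω = a • ((1 : F) ⊗ₜ[O] ω) := by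
        rw [TensorProduct.smul_tmul', Algebra.smul_def, mul_one]; rfl
      rw [this]
      exact Submodule.smul_mem _ a (h1 ω)
  have hx : ∀ j, ∃ x : RingHom.ker (algebraMap O F), kerToTensor k O F x = bF j := fun j => by
    have : bF j ∈ LinearMap.range (kerToTensor k O F) := by rw [hN]; trivial
    exact this
  choose x hx using hx
  have hdx : ∀ j, d (x j : O) = bF j := hx
  refine ⟨c, δ, fun j => x j, hc0, fun i a a' => e.injective ?_, fun i j => e.injective ?_, ?_⟩
  · have hmul : d (a * a') = algebraMap O F a • d a' + algebraMap O F a' • d a := by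
      rw [hd, Derivation.leibniz, TensorProduct.tmul_add, hsmul, hsmul, hd, hd]
    rw [hδ, hmul, map_add e, map_mul e, map_mul e, hδ, hδ, hc, hc, map_add, map_smul, map_smul]
    rfl
  · rw [hδ, hdx, Module.Basis.repr_self, Finsupp.single_apply]
    by_cases hij : i = j
    · simp [hij]
    · rw [if_neg hij, if_neg (Ne.symm hij), map_zero]
  · have hle : Ideal.span (Set.range fun j => (x j : O)) ≤ maximalIdeal O := by
      rw [Ideal.span_le]
      rintro _ ⟨j, rfl⟩
      rw [← hker]
      exact (x j).2
    refine le_antisymm ?_ hle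
    -- The residue field is `k`, hence formally smooth, so `𝔪/𝔪²` injects into `F ⊗ Ω`. Elements
    -- with the same differential at the closed point thus agree modulo `𝔪²`, and Nakayama shows
    -- that the coordinates generate.
    have hH : Subsingleton (Algebra.H1Cotangent k F) := by
      have : Algebra.FormallySmooth k F := Algebra.FormallySmooth.of_equiv e
      infer_instance
    have hinj := (Algebra.FormallySmooth.kerCotangentToTensor_injective_iff (R := k) (P := O)
      (A := F) IsLocalRing.residue_surjective).2 hH
    refine Submodule.le_of_le_smul_of_le_jacobson_bot (I := maximalIdeal O)
      (IsNoetherian.noetherian _) (maximalIdeal_le_jacobson _) ?_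
    intro y hy
    choose a ha using fun j => IsLocalRing.residue_surjective (R := O) (bF.repr (d y) j)
    have hsum : ∑ j, a j * (x j : O) ∈ Ideal.span (Set.range fun j => (x j : O)) :=
      Submodule.sum_mem _ fun j _ => Ideal.mul_mem_left _ _ (Ideal.subset_span ⟨j, rfl⟩)
    have hyk : y - ∑ j, a j * (x j : O) ∈ RingHom.ker (algebraMap O F) :=
      hker.ge (sub_mem hy (hle hsum))
    have h0 : kerToTensor k O F ⟨_, hyk⟩ = 0 := by
      have : (⟨_, hyk⟩ : RingHom.ker (algebraMap O F)) =
          ⟨y, hker ▸ hy⟩ - ∑ j, a j • x j := Subtype.ext (by simp)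
      rw [this, map_sub, map_sum, sub_eq_zero]
      have h2 : kerToTensor k O F ⟨y, hker ▸ hy⟩ = d y := rfl
      rw [h2, ← bF.sum_repr (d y)]
      refine Finset.sum_congr rfl fun j _ => ?_
      rw [map_smul, hx, ← ha j]
      rfl
    have h1 : Ideal.toCotangent _ (⟨_, hyk⟩ : RingHom.ker (algebraMap O F)) = 0 :=
      hinj (by rw [map_zero]; exact h0)
    rw [Ideal.toCotangent_eq_zero] at h1
    have hsq : RingHom.ker (algebraMap O F) ^ 2 ≤ maximalIdeal O • maximalIdeal O := by
      rw [hker, pow_two]; rfl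
    rw [← sub_add_cancel y (∑ j, a j * (x j : O)), add_comm]
    exact Submodule.add_mem_sup hsum (hsq h1)

/-- The kernels of the iterates stabilise. An element of the kernel is `f^n y`, so `y` is killed by
`f^(n+1)`, hence already by `f^n`. -/
theorem injective_of_surjective_of_isNoetherianRing {P : Type*} [CommRing P] [IsNoetherianRing P]
    (f : P →+* P) (hf : Function.Surjective f) : Function.Injective f := by
  rw [injective_iff_map_eq_zero]
  intro a ha
  let K : ℕ →o Ideal P := ⟨fun n => RingHom.ker (f ^ n), monotone_nat_of_le_succ fun n x hx => by
    rw [RingHom.mem_ker] at hx ⊢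
    rw [pow_succ', RingHom.mul_def, RingHom.comp_apply, hx, map_zero]⟩
  obtain ⟨n, hn⟩ := monotone_stabilizes_iff_noetherian.2 ‹IsNoetherianRing P› K
  have hsurj : Function.Surjective (f ^ n) := by
    rw [RingHom.coe_pow]
    exact hf.iterate n
  obtain ⟨y, rfl⟩ := hsurj a
  have h1 : y ∈ K (n + 1) := by
    change y ∈ RingHom.ker (f ^ (n + 1))
    rw [RingHom.mem_ker, pow_succ', RingHom.mul_def, RingHom.comp_apply, ha]
  rw [← hn (n + 1) n.le_succ] at h1
  exact h1

/-- The powers of `M^2` are cofinal among those of `M`. This permits lifting homomorphisms from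
`P/M²`. -/
theorem IsAdicComplete.pow_two {P : Type*} [CommRing P] (M : Ideal P) [IsAdicComplete M P] :
    IsAdicComplete (M ^ 2) P where
  haus' x hx := by
    refine IsHausdorff.haus' (I := M) x fun n => ?_
    have := hx n
    rw [SModEq.zero] at this ⊢
    refine Submodule.smul_mono_left ?_ this
    rw [← pow_mul]
    exact Ideal.pow_le_pow_right (by omega)
  prec' f hf := by
    have hle : ∀ n, (M ^ 2) ^ n ≤ M ^ n := fun n => by
      rw [← pow_mul]
      exact Ideal.pow_le_pow_right (by omega)
    obtain ⟨L, hL⟩ := IsPrecomplete.prec' (I := M) (M := P) f fun {m n} hmn =>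
      SModEq.mono (Submodule.smul_mono_left (hle m)) (hf hmn)
    refine ⟨L, fun n => (hf (show n ≤ 2 * n by omega)).trans ?_⟩
    have := hL (2 * n)
    rwa [pow_mul] at this

theorem MvPowerSeries.sub_C_constantCoeff_mem {k σ : Type*} [Field k] [Finite σ]
    (p : MvPowerSeries σ k) :
    p - C (constantCoeff p) ∈ Ideal.span (Set.range (X : σ → MvPowerSeries σ k)) := by
  set q := p - C (constantCoeff p) with hq
  have hmap : Ideal.map (toAdicCompletionAlgEquiv σ k).toRingEquiv (Ideal.span (Set.range X)) =
      (MvPolynomial.idealOfVars σ k).map (algebraMap ..) := by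
    simp_rw [Ideal.map_span, ← Set.range_comp]
    congr 2; ext1
    simp [AdicCompletion.algebraMap_apply, ← MvPolynomial.coe_X, toAdicCompletion_coe]
  have h0 : truncTotal 1 q = 0 := by
    ext d
    by_cases hd : d.degree < 1
    · have : d = 0 := by
        rw [← Finsupp.degree_eq_zero_iff]; omega
      subst this
      rw [coeff_truncTotal _ hd, hq]
      simp
    · rw [coeff_truncTotal_eq_zero _ (not_lt.1 hd)]
      simp
  have h1 : toAdicCompletion σ k q ∈ LinearMap.ker (AdicCompletion.eval
      (MvPolynomial.idealOfVars σ k) (MvPolynomial σ k) 1) := by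
    change (toAdicCompletion σ k q).val 1 = 0
    rw [toAdicCompletion_apply_eq_mk_truncTotal, h0]
    rfl
  rw [← AdicCompletion.pow_smul_top_eq_ker_eval (MvPolynomial.idealOfVars_fg σ k), pow_one,
    Ideal.smul_top_eq_map, Submodule.restrictScalars_mem, ← hmap] at h1
  obtain ⟨r, hr, hrq⟩ := (Ideal.mem_map_of_equiv _ _).1 h1
  rwa [← (toAdicCompletionAlgEquiv σ k).injective hrq]

/-- The completion of a formally smooth local algebra with trivial residue field extension is a
power series ring. -/
theorem exists_ringEquiv_mvPowerSeries {k O : Type u} [Field k] [CommRing O] [IsLocalRing O]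
    [IsNoetherianRing O] [Algebra k O] [Algebra.FormallySmooth k O] {n : ℕ}
    (b : Module.Basis (Fin n) O Ω[O⁄k])
    (hres : Function.Bijective (algebraMap k (ResidueField O))) :
    Nonempty (MvPowerSeries (Fin n) k ≃+* AdicCompletion (maximalIdeal O) O) := by
  classical
  obtain ⟨c, δ, x, hc, hδ, hδx, hx⟩ := exists_local_coordinates b hres
  let P := MvPowerSeries (Fin n) k
  let M : Ideal P := Ideal.span (Set.range MvPowerSeries.X)
  let m := maximalIdeal O
  have hcx : ∀ j, c (x j) = 0 := fun j => (hc _).2 (hx ▸ Ideal.subset_span ⟨j, rfl⟩)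
  have hXM : ∀ j, (MvPowerSeries.X j : P) ∈ M := fun j => Ideal.subset_span ⟨j, rfl⟩
  -- the map from power series
  let α : MvPolynomial (Fin n) k →ₐ[k] O := MvPolynomial.aeval x
  have hα : ∀ i, MvPolynomial.idealOfVars (Fin n) k ^ i ≤ (m ^ i).comap α := by
    intro i
    rw [← Ideal.map_le_iff_le_comap, Ideal.map_pow]
    refine Ideal.pow_right_mono ?_ i
    rw [Ideal.map_le_iff_le_comap, MvPolynomial.idealOfVars, Ideal.span_le]
    rintro _ ⟨j, rfl⟩
    change α (MvPolynomial.X j) ∈ m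
    rw [MvPolynomial.aeval_X, ← hc, hcx]
  let θi : ∀ i, P →+* O ⧸ m ^ i := fun i =>
    (Ideal.quotientMap (m ^ i) α.toRingHom (hα i)).comp
      (MvPowerSeries.truncTotalAlgHom (Fin n) k i).toRingHom
  have hθi : ∀ i p, θi i p = Ideal.Quotient.mk (m ^ i) (α (MvPowerSeries.truncTotal i p)) :=
    fun _ _ => rfl
  let θ : P →+* AdicCompletion m O := AdicCompletion.liftRingHom m θi (fun {i j} hij => by
    ext p
    rw [RingHom.comp_apply, hθi, hθi]
    simp only [Ideal.Quotient.factorPow, Ideal.Quotient.factor_mk]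
    rw [Ideal.Quotient.eq, ← map_sub]
    exact hα i (MvPowerSeries.truncTotal_sub_truncTotal_mem_pow_idealOfVars hij le_rfl p))
  have hθp : ∀ p : MvPolynomial (Fin n) k, θ p = algebraMap O _ (α p) := by
    intro p
    apply AdicCompletion.ext_evalₐ
    intro i
    rw [AdicCompletion.evalₐ_liftRingHom, AlgHom.commutes, hθi]
    change _ = Ideal.Quotient.mk _ _
    rw [Ideal.Quotient.eq, ← map_sub]
    refine hα i ((MvPolynomial.mem_pow_idealOfVars_iff' ..).mpr fun d hd => ?_)
    rw [MvPolynomial.coeff_sub, MvPowerSeries.coeff_truncTotal _ hd, MvPolynomial.coeff_coe,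
      sub_self]
  have hθX : ∀ j, θ (MvPowerSeries.X j) = algebraMap O _ (x j) := by
    intro j
    rw [← MvPolynomial.coe_X, hθp, MvPolynomial.aeval_X]
  have hθC : ∀ a, θ (MvPowerSeries.C a) = algebraMap O _ (algebraMap k O a) := by
    intro a
    rw [← MvPolynomial.coe_C, hθp, MvPolynomial.algHom_C]
  have hMθ : M.map θ = maximalIdeal (AdicCompletion m O) := by
    have h := congrArg (Ideal.map (algebraMap O (AdicCompletion m O))) hx
    rw [Ideal.map_span, ← Set.range_comp] at h
    rw [AdicCompletion.maximalIdeal_eq_map, Ideal.map_span, ← Set.range_comp]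
    refine Eq.trans ?_ h.symm
    congr 2
    funext j
    exact hθX j
  have hθsurj : Function.Surjective θ := by
    have : IsHausdorff (M.map θ) (AdicCompletion m O) := by rw [hMθ]; infer_instance
    -- By completeness it is enough to hit residues modulo the maximal ideal, and these are
    -- constants.
    refine surjective_of_mk_map_comp_surjective (I := M) θ fun y => ?_
    obtain ⟨y, rfl⟩ := Ideal.Quotient.mk_surjective y
    obtain ⟨s, hs⟩ := (AdicCompletion.residueField_map_bijective O).2 (residue _ y)
    obtain ⟨a, rfl⟩ := IsLocalRing.residue_surjective s
    rw [ResidueField.map_residue] at hs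
    refine ⟨MvPowerSeries.C (c a), ?_⟩
    rw [RingHom.comp_apply, Ideal.Quotient.eq, hMθ, hθC]
    have h1 : algebraMap k O (c a) - a ∈ m := by
      rw [← hc, map_sub, AlgHom.commutes]; exact sub_self _
    have h2 : algebraMap O (AdicCompletion m O) (algebraMap k O (c a) - a) ∈
        maximalIdeal (AdicCompletion m O) := by
      rw [AdicCompletion.maximalIdeal_eq_map]; exact Ideal.mem_map_of_mem _ h1
    have h3 : algebraMap O (AdicCompletion m O) a - y ∈ maximalIdeal (AdicCompletion m O) := by
      rw [← residue_eq_zero_iff, map_sub, hs, sub_self]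
    rw [map_sub] at h2
    have := add_mem h2 h3
    rwa [sub_add_sub_cancel] at this
  -- the map to power series
  have hM2 : IsAdicComplete (M ^ 2) P := IsAdicComplete.pow_two M
  -- The first-order Taylor polynomial. It is multiplicative modulo `M²`, since the product of two
  -- linear parts lies there, so formal smoothness lifts it to `ψ : O → P`.
  let σ : O →ₗ[k] P := (Algebra.linearMap k P).comp c.toLinearMap +
    ∑ j, (LinearMap.mulRight k (MvPowerSeries.X j : P)).comp
      ((Algebra.linearMap k P).comp (δ j))
  have hσ : ∀ a, σ a = algebraMap k P (c a) + ∑ j, algebraMap k P (δ j a) * MvPowerSeries.X j := by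
    intro a
    simp [σ]
  have hsumM : ∀ a, ∑ j, algebraMap k P (δ j a) * MvPowerSeries.X j ∈ M := fun a =>
    Submodule.sum_mem _ fun j _ => Ideal.mul_mem_left _ _ (hXM j)
  have hδ1 : ∀ j, δ j 1 = 0 := by
    intro j
    have := hδ j 1 1
    simpa using this
  let f : O →ₐ[k] P ⧸ M ^ 2 := AlgHom.ofLinearMap
    ((Ideal.Quotient.mkₐ k (M ^ 2)).toLinearMap.comp σ)
    (by
      change Ideal.Quotient.mk (M ^ 2) (σ 1) = 1
      rw [hσ]
      simp [hδ1])
    (by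
      intro a a'
      change Ideal.Quotient.mk (M ^ 2) (σ (a * a')) =
        Ideal.Quotient.mk (M ^ 2) (σ a) * Ideal.Quotient.mk (M ^ 2) (σ a')
      rw [← map_mul, eq_comm, Ideal.Quotient.eq]
      have : σ a * σ a' - σ (a * a') = (∑ j, algebraMap k P (δ j a) * MvPowerSeries.X j) *
          (∑ j, algebraMap k P (δ j a') * MvPowerSeries.X j) := by
        rw [hσ, hσ, hσ]
        have h3 : ∑ j, algebraMap k P (δ j (a * a')) * MvPowerSeries.X j =
            algebraMap k P (c a) * ∑ j, algebraMap k P (δ j a') * MvPowerSeries.X j +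
            algebraMap k P (c a') * ∑ j, algebraMap k P (δ j a) * MvPowerSeries.X j := by
          rw [Finset.mul_sum, Finset.mul_sum, ← Finset.sum_add_distrib]
          refine Finset.sum_congr rfl fun j _ => ?_
          rw [hδ, map_add, map_mul, map_mul]
          ring
        rw [h3, map_mul, map_mul]
        ring
      rw [this, pow_two]
      exact Ideal.mul_mem_mul (hsumM a) (hsumM a'))
  obtain ⟨ψ, hψ⟩ := Algebra.FormallySmooth.exists_mkₐ_comp_eq_of_isAdicComplete f
  have hψσ : ∀ a, ψ a - σ a ∈ M ^ 2 := by
    intro a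
    rw [← Ideal.Quotient.eq]
    exact congrArg (fun f : O →ₐ[k] P ⧸ M ^ 2 => f a) hψ
  have hM2le : M ^ 2 ≤ M := Ideal.pow_le_self two_ne_zero
  have hψm : ∀ i, m ^ i ≤ (M ^ i).comap ψ := by
    intro i
    rw [← Ideal.map_le_iff_le_comap, Ideal.map_pow]
    refine Ideal.pow_right_mono ?_ i
    rw [Ideal.map_le_iff_le_comap]
    intro a ha
    change ψ a ∈ M
    rw [← sub_add_cancel (ψ a) (σ a)]
    refine add_mem (hM2le (hψσ a)) ?_
    rw [hσ, (hc a).2 ha, map_zero, zero_add]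
    exact hsumM a
  let ψi : ∀ i, AdicCompletion m O →+* P ⧸ M ^ i := fun i =>
    (Ideal.quotientMap (M ^ i) ψ.toRingHom (hψm i)).comp
      (AdicCompletion.evalₐ m i : _ →+* O ⧸ m ^ i)
  let Ψ : AdicCompletion m O →+* P := IsAdicComplete.liftRingHom M ψi (fun {i j} hij => by
    ext y
    obtain ⟨y, rfl⟩ := AdicCompletion.mk_surjective m O y
    simp only [ψi, RingHom.comp_apply, RingHom.coe_coe, AdicCompletion.evalₐ_mk]
    change Ideal.Quotient.mk (M ^ i) (ψ (y j)) = Ideal.Quotient.mk (M ^ i) (ψ (y i))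
    rw [Ideal.Quotient.eq, ← map_sub]
    refine hψm i ?_
    have h := y.2 hij
    rw [SModEq.sub_mem] at h
    simpa using neg_mem h)
  have hΨ : ∀ a, Ψ (algebraMap O _ a) = ψ a := by
    intro a
    rw [← sub_eq_zero]
    refine IsHausdorff.haus' (I := M) _ fun i => ?_
    rw [SModEq.zero, smul_eq_mul, Ideal.mul_top, ← Ideal.Quotient.eq_zero_iff_mem, map_sub,
      sub_eq_zero, IsAdicComplete.mk_liftRingHom]
    simp only [ψi, RingHom.comp_apply, RingHom.coe_coe, AlgHom.commutes]
    rfl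
  -- `φ` fixes constants and is the identity on the variables modulo `M²`, so it is surjective,
  -- hence injective by noetherianity; therefore `θ` is injective.
  let φ : P →+* P := Ψ.comp θ
  have hφX : ∀ j, φ (MvPowerSeries.X j) - MvPowerSeries.X j ∈ M ^ 2 := by
    intro j
    have h1 : σ (x j) = MvPowerSeries.X j := by
      rw [hσ, hcx, map_zero, zero_add]
      simp [hδx]
    have h2 : φ (MvPowerSeries.X j) = ψ (x j) := by
      change Ψ (θ _) = _
      rw [hθX, hΨ]
    rw [h2, ← h1]
    exact hψσ (x j)
  have hMφ : M.map φ = M := by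
    apply le_antisymm
    · rw [Ideal.map_span, Ideal.span_le]
      rintro _ ⟨_, ⟨j, rfl⟩, rfl⟩
      have := add_mem (hM2le (hφX j)) (hXM j)
      rwa [sub_add_cancel] at this
    · refine Submodule.le_of_le_smul_of_le_jacobson_bot (I := M) (IsNoetherian.noetherian _)
        (IsAdicComplete.le_jacobson_bot M) ?_
      refine Ideal.span_le.2 ?_
      rintro _ ⟨j, rfl⟩
      have h1 : φ (MvPowerSeries.X j) ∈ M.map φ := Ideal.mem_map_of_mem _ (hXM j)
      have h2 : MvPowerSeries.X j - φ (MvPowerSeries.X j) ∈ M • M := by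
        have := neg_mem (hφX j)
        rw [neg_sub, pow_two] at this
        exact this
      have := Submodule.add_mem_sup h1 h2
      rwa [add_sub_cancel] at this
  have hφsurj : Function.Surjective φ := by
    have : IsHausdorff (M.map φ) P := by rw [hMφ]; infer_instance
    refine surjective_of_mk_map_comp_surjective (I := M) φ fun y => ?_
    obtain ⟨y, rfl⟩ := Ideal.Quotient.mk_surjective y
    refine ⟨MvPowerSeries.C (MvPowerSeries.constantCoeff y), ?_⟩
    rw [RingHom.comp_apply, eq_comm, Ideal.Quotient.eq, hMφ]
    have h1 : φ (MvPowerSeries.C (MvPowerSeries.constantCoeff y)) =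
        MvPowerSeries.C (MvPowerSeries.constantCoeff y) := by
      change Ψ (θ _) = _
      rw [hθC, hΨ, AlgHom.commutes]
      rfl
    rw [h1]
    exact MvPowerSeries.sub_C_constantCoeff_mem y
  have hφinj := injective_of_surjective_of_isNoetherianRing φ hφsurj
  exact ⟨RingEquiv.ofBijective θ
    ⟨Function.Injective.of_comp (f := Ψ) (g := θ) hφinj, hθsurj⟩⟩

end FormallySmoothCompletion

/-! ## Power series rings over a field -/

section PowerSeriesCoordinates

instance (k : Type*) [Field k] (σ : Type*) : IsDomain (MvPowerSeries σ k) :=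
  NoZeroDivisors.to_isDomain _

/-- In a power series ring in two variables over a field the first variable is prime and does not
divide the second. -/
theorem MvPowerSeries.prime_X_zero_and_X_one_notMem (k : Type*) [Field k] :
    Prime (X 0 : MvPowerSeries (Fin 2) k) ∧
      (X 1 : MvPowerSeries (Fin 2) k) ∉ Ideal.span {(X 0 : MvPowerSeries (Fin 2) k)} := by
  let e := finSuccEquiv k 1
  have h0 : e (X 0) = PowerSeries.X := by simp [e, finSuccEquiv_X_zero]
  have h1 : e (X 1) = PowerSeries.C (X 0) := by
    have := finSuccEquiv_X_succ (R := k) (n := 1) 0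
    simpa [e] using this
  constructor
  · have : Prime (e (X 0)) := h0 ▸ PowerSeries.X_prime
    exact (MulEquiv.prime_iff e.toMulEquiv).1 this
  · intro h
    rw [Ideal.mem_span_singleton] at h
    have h2 := map_dvd e h
    rw [h0, h1, PowerSeries.X_dvd_iff] at h2
    have h3 := congrArg (coeff (Finsupp.single 0 1)) h2
    simp at h3

theorem MvPowerSeries.ringKrullDim_le (k : Type*) [Field k] (n : ℕ) :
    ringKrullDim (MvPowerSeries (Fin n) k) ≤ n := by
  classical
  refine (ringKrullDim_le_spanFinrank_maximalIdeal _).trans ?_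
  have h : maximalIdeal (MvPowerSeries (Fin n) k) = Ideal.span (Set.range X) := by
    apply le_antisymm
    · intro p hp
      have h0 : constantCoeff p = 0 := by
        by_contra h0
        exact (IsLocalRing.mem_maximalIdeal _).1 hp
          (isUnit_iff_constantCoeff.2 (isUnit_iff_ne_zero.2 h0))
      have := sub_C_constantCoeff_mem p
      rwa [h0, map_zero, sub_zero] at this
    · rw [Ideal.span_le]
      rintro _ ⟨j, rfl⟩
      refine (IsLocalRing.mem_maximalIdeal _).2 fun hu => ?_
      rw [isUnit_iff_constantCoeff] at hu
      simp at hu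
  have h2 : (maximalIdeal (MvPowerSeries (Fin n) k)).spanFinrank ≤ n := by
    rw [h]
    refine (Submodule.spanFinrank_span_le_ncard_of_finite (Set.finite_range _)).trans ?_
    rw [← Set.image_univ]
    refine (Set.ncard_image_le Set.finite_univ).trans ?_
    simp
  exact_mod_cast h2

theorem notMem_span_singleton_of_ringEquiv {P Q : Type*} [CommRing P] [CommRing Q] (e : P ≃+* Q)
    {x y : P} (h : y ∉ Ideal.span {x}) : e y ∉ Ideal.span {e x} := by
  rw [Ideal.mem_span_singleton] at h ⊢
  exact fun h1 => h ((map_dvd_iff e).1 h1)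

end PowerSeriesCoordinates

/-! ## Dimensions of integral extensions -/

section Dimension

theorem ringKrullDim_le_of_isIntegral (A R : Type*) [CommRing A] [CommRing R] [Algebra A R]
    [Algebra.IsIntegral A R] : ringKrullDim R ≤ ringKrullDim A := by
  refine Order.krullDim_le_of_strictMono (PrimeSpectrum.comap (algebraMap A R)) ?_
  intro p q hpq
  exact Ideal.IsIntegral.comap_lt_comap (R := A) hpq

theorem two_le_ringKrullDim_of_prime {R : Type*} [CommRing R] [IsDomain R] [IsLocalRing R]
    {x y : R} (hx : Prime x) (hyx : y ∉ Ideal.span {x}) (hym : y ∈ maximalIdeal R) :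
    2 ≤ ringKrullDim R := by
  have : (Ideal.span {x}).IsPrime := (Ideal.span_singleton_prime hx.ne_zero).2 hx
  have h1 := ringKrullDim_quotient_succ_le_of_nonZeroDivisor
    (mem_nonZeroDivisors_of_ne_zero hx.ne_zero)
  let y' := Ideal.Quotient.mk (Ideal.span {x}) y
  have hy' : y' ≠ 0 := fun h => hyx (Ideal.Quotient.eq_zero_iff_mem.1 h)
  have h3 := ringKrullDim_quotient_succ_le_of_nonZeroDivisor
    (mem_nonZeroDivisors_of_ne_zero hy')
  have : Nontrivial ((R ⧸ Ideal.span {x}) ⧸ Ideal.span {y'}) := by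
    refine Ideal.Quotient.nontrivial_iff.2 fun h => ?_
    rw [Ideal.span_singleton_eq_top] at h
    have hloc : IsLocalHom (Ideal.Quotient.mk (Ideal.span {x})) :=
      IsLocalHom.of_surjective _ Ideal.Quotient.mk_surjective
    exact (mem_maximalIdeal _).1 hym (hloc.map_nonunit _ h)
  have h4 : (0 : WithBot ℕ∞) ≤ ringKrullDim ((R ⧸ Ideal.span {x}) ⧸ Ideal.span {y'}) :=
    ringKrullDim_nonneg_of_nontrivial
  calc (2 : WithBot ℕ∞) = 0 + 1 + 1 := by norm_num
    _ ≤ _ := add_le_add (add_le_add h4 le_rfl) le_rfl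
    _ ≤ _ := add_le_add h3 le_rfl
    _ ≤ _ := h1

/-- An integral homomorphism from a domain of dimension at most two to a domain of dimension at
least two is injective. -/
theorem algebraMap_injective_of_ringKrullDim_le_two {A R : Type*} [CommRing A] [IsDomain A]
    [CommRing R] [IsDomain R] [Algebra A R] [Algebra.IsIntegral A R]
    (hA : ringKrullDim A ≤ 2) (h2 : 2 ≤ ringKrullDim R) :
    Function.Injective (algebraMap A R) := by
  rw [injective_iff_map_eq_zero]
  intro a ha
  by_contra h0
  -- A nonzero element of the kernel would make `R` integral over a quotient of `A` of dimension at
  -- most one.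
  have h1 := ringKrullDim_quotient_succ_le_of_nonZeroDivisor (mem_nonZeroDivisors_of_ne_zero h0)
  let I := RingHom.ker (algebraMap A R)
  have h3 : ringKrullDim (A ⧸ I) ≤ ringKrullDim (A ⧸ Ideal.span {a}) :=
    ringKrullDim_le_of_surjective
      (Ideal.Quotient.factor ((Ideal.span_singleton_le_iff_mem _).2 ha))
      (Ideal.Quotient.factor_surjective _)
  let : Algebra (A ⧸ I) R := (RingHom.kerLift (algebraMap A R)).toAlgebra
  have : IsScalarTower A (A ⧸ I) R := IsScalarTower.of_algebraMap_eq fun _ => rfl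
  have : Algebra.IsIntegral (A ⧸ I) R := Algebra.IsIntegral.tower_top A
  have h4 := ringKrullDim_le_of_isIntegral (A ⧸ I) R
  have h5 : (2 : WithBot ℕ∞) + 1 ≤ 2 :=
    (add_le_add (h2.trans (h4.trans h3)) le_rfl).trans (h1.trans hA)
  exact absurd h5 (by decide)

end Dimension

/-! ## Finiteness of completed integral extensions -/

section Finiteness

/-- Every power of the maximal ideal has a complement that is finitely generated over a coefficient
field. -/
theorem exists_span_sub_mem_maximalIdeal_pow {k O' : Type*} [Field k] [CommRing O'] [IsLocalRing O']
    [IsNoetherianRing O'] [Algebra k O']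
    (hres : Function.Surjective (algebraMap k (ResidueField O'))) (N : ℕ) :
    ∃ s : Set O', s.Finite ∧ ∀ a, ∃ t ∈ Submodule.span k s, a - t ∈ maximalIdeal O' ^ N := by
  induction N with
  | zero => exact ⟨∅, Set.finite_empty, fun a => ⟨0, zero_mem _, by simp⟩⟩
  | succ N ih =>
    obtain ⟨s, hs, h⟩ := ih
    obtain ⟨w, hw⟩ := (IsNoetherian.noetherian (maximalIdeal O' ^ N) : (maximalIdeal O' ^ N).FG)
    refine ⟨s ∪ w, hs.union w.finite_toSet, fun a => ?_⟩
    obtain ⟨t, ht, hat⟩ := h a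
    have key : ∀ b ∈ maximalIdeal O' ^ N,
        ∃ t ∈ Submodule.span k (s ∪ w), b - t ∈ maximalIdeal O' ^ (N + 1) := by
      intro b hb
      rw [← hw] at hb
      induction hb using Submodule.span_induction with
      | mem b hb => exact ⟨b, Submodule.subset_span (Or.inr hb), by simp⟩
      | zero => exact ⟨0, zero_mem _, by simp⟩
      | add b c _ _ hb hc =>
        obtain ⟨t, ht, h1⟩ := hb
        obtain ⟨u, hu, h2⟩ := hc
        refine ⟨t + u, add_mem ht hu, ?_⟩
        rw [add_sub_add_comm]
        exact add_mem h1 h2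
      | smul c b hbw hb =>
        obtain ⟨t, ht, h1⟩ := hb
        obtain ⟨e, he⟩ := hres (residue O' c)
        refine ⟨e • t, Submodule.smul_mem _ _ ht, ?_⟩
        have h2 : c - algebraMap k O' e ∈ maximalIdeal O' := by
          rw [← residue_eq_zero_iff, map_sub, sub_eq_zero, ← he]
          rfl
        have h3 : c • b - e • t = (c - algebraMap k O' e) * b + algebraMap k O' e * (b - t) := by
          rw [smul_eq_mul, Algebra.smul_def]; ring
        rw [h3]
        refine add_mem ?_ (Ideal.mul_mem_left _ _ h1)
        rw [pow_succ']
        refine Ideal.mul_mem_mul h2 ?_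
        rw [← hw]
        exact hbw
    obtain ⟨u, hu, h2⟩ := key _ hat
    refine ⟨t + u, add_mem (Submodule.span_mono Set.subset_union_left ht) hu, ?_⟩
    rwa [← sub_sub]

/-- Modulo `𝔪_A R` an element of `R` is a function in `O'` modulo a power of the maximal ideal,
hence a `k`-combination of finitely many functions. Completeness of `A` turns this into generation;
that the generators come from `O'` is used for unramifiedness. -/
theorem exists_fin_generators_of_maximalIdeal_pow_le {k O O' A R : Type*} [Field k] [CommRing O]
    [IsLocalRing O] [CommRing O'] [IsLocalRing O'] [IsNoetherianRing O'] [Algebra k O]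
    [Algebra k O'] [Algebra O O'] [IsScalarTower k O O']
    (hres : Function.Surjective (algebraMap k (ResidueField O'))) {N : ℕ}
    (hN : maximalIdeal O' ^ N ≤ (maximalIdeal O).map (algebraMap O O'))
    [CommRing A] [IsLocalRing A] [IsAdicComplete (maximalIdeal A) A] [CommRing R]
    [Algebra A R] [Algebra O A] [Algebra O' R] [Algebra O R] [IsScalarTower O A R]
    [IsScalarTower O O' R] (hA : (maximalIdeal O).map (algebraMap O A) ≤ maximalIdeal A)
    (hR : IsHausdorff (maximalIdeal A) R)
    (hd : ∀ r : R, ∃ a : O', r - algebraMap O' R a ∈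
      (maximalIdeal O' ^ N).map (algebraMap O' R)) :
    ∃ (n : ℕ) (v : Fin n → O'), ∀ r : R, ∃ c : Fin n → A,
      r = ∑ i, c i • algebraMap O' R (v i) := by
  obtain ⟨s, hs, h⟩ := exists_span_sub_mem_maximalIdeal_pow hres N
  obtain ⟨n, v, rfl⟩ : ∃ (n : ℕ) (v : Fin n → O'), Set.range v = s := by
    obtain ⟨n, v, -, hv⟩ := hs.fin_param
    exact ⟨n, v, hv⟩
  have hle : (maximalIdeal O' ^ N).map (algebraMap O' R) ≤
      (maximalIdeal A).map (algebraMap A R) := by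
    refine (Ideal.map_mono hN).trans ?_
    rw [Ideal.map_map, ← IsScalarTower.algebraMap_eq, IsScalarTower.algebraMap_eq O A R,
      ← Ideal.map_map]
    exact Ideal.map_mono hA
  refine ⟨n, v, Module.Finite.of_isPrecomplete_of_isHausdorff (maximalIdeal A) _ fun r => ?_⟩
  obtain ⟨a, ha⟩ := hd r
  obtain ⟨t, ht, hat⟩ := h a
  obtain ⟨c, rfl⟩ := (Submodule.mem_span_range_iff_exists_fun k).1 ht
  refine ⟨fun i => algebraMap O A (algebraMap k O (c i)), ?_⟩
  rw [Ideal.smul_top_eq_map, Submodule.restrictScalars_mem]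
  refine hle ?_
  have h1 := add_mem ha (Ideal.mem_map_of_mem (algebraMap O' R) hat)
  rw [map_sub, sub_add_sub_cancel, map_sum] at h1
  convert h1 using 2
  refine Finset.sum_congr rfl fun i _ => ?_
  rw [algebraMap_smul, Algebra.smul_def, Algebra.smul_def, map_mul,
    IsScalarTower.algebraMap_apply k O O', ← IsScalarTower.algebraMap_apply O O' R]

/-- If `S → S'` is integral, then some power of the maximal ideal at a prime of `S'` is generated
by the maximal ideal of the local ring at the prime below. -/
theorem exists_maximalIdeal_pow_le_map_of_isIntegral {S S' O O' : Type*} [CommRing S] [CommRing S']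
    [Algebra S S'] [Algebra.IsIntegral S S'] [CommRing O] [IsLocalRing O] [CommRing O']
    [IsLocalRing O'] [IsNoetherianRing O'] [Algebra S O] [Algebra S' O'] [Algebra O O']
    [Algebra S O'] [IsScalarTower S O O'] [IsScalarTower S S' O'] (p' : Ideal S') [p'.IsPrime]
    [IsLocalization.AtPrime O' p'] [(p'.under S).IsPrime]
    [IsLocalization.AtPrime O (p'.under S)] :
    ∃ N, maximalIdeal O' ^ N ≤ (maximalIdeal O).map (algebraMap O O') := by
  refine Ideal.exists_pow_le_of_le_radical_of_fg ?_ (IsNoetherian.noetherian _)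
  rw [Ideal.radical_eq_sInf]
  refine le_sInf ?_
  -- A prime over `𝔪_O O'` contracts to a prime inside `p'` with the same trace on `S`;
  -- incomparability for integral extensions makes it equal to `p'`.
  rintro Q ⟨hQ, hQp⟩
  have h1 : Q.comap (algebraMap S' O') ≤ p' := by
    rw [← IsLocalization.AtPrime.under_maximalIdeal O' p']
    exact Ideal.comap_mono (le_maximalIdeal hQp.ne_top)
  have h2 : p' ≤ Q.comap (algebraMap S' O') := by
    have h3 : p'.comap (algebraMap S S') ≤ (Q.comap (algebraMap S' O')).comap (algebraMap S S') := by
      intro a ha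
      change algebraMap S' O' (algebraMap S S' a) ∈ Q
      rw [← IsScalarTower.algebraMap_apply, IsScalarTower.algebraMap_apply S O O']
      refine hQ (Ideal.mem_map_of_mem _ ?_)
      have := IsLocalization.AtPrime.under_maximalIdeal O (p'.under S)
      rw [Ideal.ext_iff] at this
      exact (this a).2 ha
    by_contra h4
    have hlt : Q.comap (algebraMap S' O') < p' := lt_of_le_not_ge h1 h4
    exact absurd h3 (Ideal.IsIntegral.comap_lt_comap (R := S) hlt).not_ge
  rw [← IsLocalization.AtPrime.map_eq_maximalIdeal p' O', Ideal.map_le_iff_le_comap]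
  exact h2

end Finiteness

/-! ## Differentials and unramified fibres -/

section Unramified

open KaehlerDifferential

/-- The differentials of an algebra that is unramified away from `d` are killed by powers
of `d`. -/
theorem exists_pow_smul_D_eq_zero {S S' Sd S'd : Type*} [CommRing S] [CommRing S'] [Algebra S S']
    [CommRing Sd] [CommRing S'd] [Algebra S Sd] [Algebra S' S'd] [Algebra Sd S'd] [Algebra S S'd]
    [IsScalarTower S Sd S'd] [IsScalarTower S S' S'd] (d : S) [IsLocalization.Away d Sd]
    [IsLocalization.Away (algebraMap S S' d) S'd] [Algebra.FormallyUnramified Sd S'd] (a : S') :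
    ∃ n : ℕ, algebraMap S S' d ^ n • D S S' a = 0 := by
  have h1 := Algebra.FormallyUnramified.of_isLocalization (R := S) (Rₘ := Sd) (Submonoid.powers d)
  have h2 := Algebra.FormallyUnramified.comp S Sd S'd
  have h3 : map S S S' S'd (D S S' a) = 0 := Subsingleton.elim _ _
  obtain ⟨⟨_, n, rfl⟩, hc⟩ := (IsLocalizedModule.eq_zero_iff
    (Submonoid.powers (algebraMap S S' d)) (map S S S' S'd)).1 h3
  exact ⟨n, hc⟩

/-- Let `R` be generated as a module over `A` by elements of a localization `O'` of `S'`. If `S'` is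
unramified over `S` away from `d`, then `R` is unramified over `A` at the primes not
containing `d`. -/
theorem formallyUnramified_residueField_tensorProduct {S S' O' A R : Type*} [CommRing S]
    [CommRing S'] [CommRing O'] [CommRing A] [CommRing R] [Algebra S S'] [Algebra S A] [Algebra S R]
    [Algebra S' O'] [Algebra S' R] [Algebra O' R] [Algebra A R] [IsScalarTower S S' R]
    [IsScalarTower S A R] [IsScalarTower S' O' R] (W : Submonoid S') [IsLocalization W O']
    {n : ℕ} (v : Fin n → O') (hv : ∀ r : R, ∃ c : Fin n → A, r = ∑ i, c i • algebraMap O' R (v i))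
    (P : Ideal A) [P.IsPrime] (d : S) (hdP : algebraMap S A d ∉ P)
    (hd : ∀ a : S', ∃ n : ℕ, algebraMap S S' d ^ n • D S S' a = 0) :
    Algebra.FormallyUnramified P.ResidueField (P.ResidueField ⊗[A] R) := by
  let κ := P.ResidueField
  let ι : R →ₐ[A] κ ⊗[A] R := Algebra.TensorProduct.includeRight
  let : Algebra S' (κ ⊗[A] R) := (ι.toRingHom.comp (algebraMap S' R)).toAlgebra
  have hS' : ∀ a, algebraMap S' (κ ⊗[A] R) a = ι (algebraMap S' R a) := fun _ => rfl
  have : IsScalarTower S S' (κ ⊗[A] R) := IsScalarTower.of_algebraMap_eq fun a => by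
    rw [hS', ← IsScalarTower.algebraMap_apply S S' R, IsScalarTower.algebraMap_apply S A R,
      AlgHom.commutes, IsScalarTower.algebraMap_apply S A (κ ⊗[A] R)]
  -- `d` is nonzero in the residue field `κ`, so a differential killed by a power of `d` vanishes
  -- over `κ`. The vanishing then spreads to fractions in `O'` and to `A`-combinations.
  have h0 : ∀ a : S', D κ (κ ⊗[A] R) (ι (algebraMap S' R a)) = 0 := by
    intro a
    obtain ⟨m, hm⟩ := hd a
    have h1 := congrArg (map S κ S' (κ ⊗[A] R)) hm
    rw [map_smul, map_D, map_zero, hS', ← algebraMap_smul (κ ⊗[A] R), map_pow,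
      ← IsScalarTower.algebraMap_apply, IsScalarTower.algebraMap_apply S κ (κ ⊗[A] R), ← map_pow,
      algebraMap_smul] at h1
    refine (smul_eq_zero_iff_right ?_).1 h1
    refine pow_ne_zero _ ?_
    rw [IsScalarTower.algebraMap_apply S A κ]
    intro h2
    exact hdP (Ideal.algebraMap_residueField_eq_zero.1 h2)
  have h1 : ∀ b : O', D κ (κ ⊗[A] R) (ι (algebraMap O' R b)) = 0 := by
    intro b
    obtain ⟨⟨a, s⟩, hb⟩ := IsLocalization.surj W b
    have hu : IsUnit (ι (algebraMap S' R s)) := by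
      rw [IsScalarTower.algebraMap_apply S' O' R]
      exact ((IsLocalization.map_units O' s).map (algebraMap O' R)).map ι
    have h2 := congrArg (fun z => D κ (κ ⊗[A] R) (ι (algebraMap O' R z))) hb
    simp only [map_mul, ← IsScalarTower.algebraMap_apply S' O' R, Derivation.leibniz, h0,
      smul_zero, zero_add] at h2
    exact hu.smul_eq_zero.1 h2
  have h2 : ∀ r : R, D κ (κ ⊗[A] R) (ι r) = 0 := by
    intro r
    obtain ⟨c, rfl⟩ := hv r
    rw [map_sum, map_sum]
    refine Finset.sum_eq_zero fun i _ => ?_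
    rw [map_smul, ← algebraMap_smul κ, Derivation.map_smul, h1, smul_zero]
  refine ⟨subsingleton_of_forall_eq 0 fun z => ?_⟩
  have hz : z ∈ (⊤ : Submodule (κ ⊗[A] R) Ω[κ ⊗[A] R⁄κ]) := trivial
  rw [← span_range_derivation] at hz
  have hle : Submodule.span (κ ⊗[A] R) (Set.range (D κ (κ ⊗[A] R))) ≤ ⊥ := by
    rw [Submodule.span_le]
    rintro _ ⟨y, rfl⟩
    change D κ (κ ⊗[A] R) y = 0
    induction y using TensorProduct.induction_on with
    | zero => exact map_zero _
    | add x y hx hy => rw [map_add, hx, hy, add_zero]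
    | tmul c r =>
      have : c ⊗ₜ[A] r = c • ι r := by
        rw [Algebra.TensorProduct.includeRight_apply, TensorProduct.smul_tmul', smul_eq_mul, mul_one]
      rw [this, Derivation.map_smul, h2, smul_zero]
  exact hle hz

end Unramified

/-! ## Ranks of modules of differentials -/

section Rank

/-- Two `k`-algebras with a common formally étale extension have the same number of
differentials. -/
theorem eq_of_basis_kaehlerDifferential {k O O' T : Type*} [CommRing k] [CommRing O] [CommRing O']
    [CommRing T] [Nontrivial T] [Algebra k O] [Algebra k O'] [Algebra k T] [Algebra O T]
    [Algebra O' T] [IsScalarTower k O T] [IsScalarTower k O' T] [Algebra.FormallyEtale O T]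
    [Algebra.FormallyEtale O' T] {m n : ℕ} (b : Module.Basis (Fin m) O Ω[O⁄k])
    (b' : Module.Basis (Fin n) O' Ω[O'⁄k]) : m = n := by
  let c := (b.baseChange T).map (KaehlerDifferential.tensorKaehlerEquivOfFormallyEtale k O T)
  let c' := (b'.baseChange T).map (KaehlerDifferential.tensorKaehlerEquivOfFormallyEtale k O' T)
  simpa using Fintype.card_congr (c.indexEquiv c')

/-- The local rings at corresponding points of an étale covering have the same number of
differentials, even at the points over the branch locus. -/
theorem eq_of_basis_kaehlerDifferential_of_formallyEtale_away {k S S' Sd S'd O O' : Type*} (T : Type*) [Field k]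
    [CommRing S] [CommRing S'] [CommRing Sd] [CommRing S'd] [CommRing O] [CommRing O'] [IsDomain O']
    [Field T] [Algebra O' T] [IsFractionRing O' T]
    [Algebra S S'] [Algebra S Sd] [Algebra S' S'd] [Algebra Sd S'd] [Algebra S S'd]
    [IsScalarTower S Sd S'd] [IsScalarTower S S' S'd] (d : S) [IsLocalization.Away d Sd]
    [IsLocalization.Away (algebraMap S S' d) S'd] [Algebra.FormallyEtale Sd S'd]
    [Algebra k O] [Algebra k O'] [Algebra S O] [Algebra S' O'] [Algebra O O'] [Algebra S O']
    [IsScalarTower S O O'] [IsScalarTower S S' O'] [IsScalarTower k O O']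
    (W : Submonoid S) [IsLocalization W O] (W' : Submonoid S') [IsLocalization W' O']
    (hd : algebraMap S O' d ≠ 0) {m n : ℕ} (b : Module.Basis (Fin m) O Ω[O⁄k])
    (b' : Module.Basis (Fin n) O' Ω[O'⁄k]) : m = n := by
  let : Algebra S T := ((algebraMap O' T).comp (algebraMap S O')).toAlgebra
  let : Algebra S' T := ((algebraMap O' T).comp (algebraMap S' O')).toAlgebra
  let : Algebra O T := ((algebraMap O' T).comp (algebraMap O O')).toAlgebra
  let : Algebra k T := ((algebraMap O' T).comp (algebraMap k O')).toAlgebra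
  have : IsScalarTower S' O' T := IsScalarTower.of_algebraMap_eq fun _ => rfl
  have : IsScalarTower O O' T := IsScalarTower.of_algebraMap_eq fun _ => rfl
  have : IsScalarTower k O' T := IsScalarTower.of_algebraMap_eq fun _ => rfl
  have : IsScalarTower S O' T := IsScalarTower.of_algebraMap_eq fun _ => rfl
  have : IsScalarTower k O T := IsScalarTower.of_algebraMap_eq fun x => by
    rw [IsScalarTower.algebraMap_apply k O' T, IsScalarTower.algebraMap_apply k O O',
      ← IsScalarTower.algebraMap_apply O O' T]
  have : IsScalarTower S O T := IsScalarTower.of_algebraMap_eq fun x => by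
    rw [IsScalarTower.algebraMap_apply S O' T, IsScalarTower.algebraMap_apply S O O',
      ← IsScalarTower.algebraMap_apply O O' T]
  have : IsScalarTower S S' T := IsScalarTower.of_algebraMap_eq fun x => by
    rw [IsScalarTower.algebraMap_apply S O' T, IsScalarTower.algebraMap_apply S S' O',
      ← IsScalarTower.algebraMap_apply S' O' T]
  have hu : IsUnit (algebraMap S' T (algebraMap S S' d)) := by
    rw [← IsScalarTower.algebraMap_apply S S' T, IsScalarTower.algebraMap_apply S O' T,
      isUnit_iff_ne_zero]
    exact (map_ne_zero_iff _ (IsFractionRing.injective O' T)).2 hd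
  let : Algebra S'd T := (IsLocalization.Away.lift (algebraMap S S' d) hu).toAlgebra
  have : IsScalarTower S' S'd T := IsScalarTower.of_algebraMap_eq fun x =>
    (IsLocalization.Away.lift_eq _ hu x).symm
  let : Algebra Sd T := ((algebraMap S'd T).comp (algebraMap Sd S'd)).toAlgebra
  have : IsScalarTower Sd S'd T := IsScalarTower.of_algebraMap_eq fun _ => rfl
  have : IsScalarTower S Sd T := IsScalarTower.of_algebraMap_eq fun x => by
    rw [IsScalarTower.algebraMap_apply Sd S'd T, ← IsScalarTower.algebraMap_apply S Sd S'd,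
      IsScalarTower.algebraMap_apply S S' S'd, ← IsScalarTower.algebraMap_apply S' S'd T,
      ← IsScalarTower.algebraMap_apply S S' T]
  -- `T` is formally étale over `S'`, hence over `S'd` by cancellation, then over `Sd` and `S` by
  -- composition, and over `O` by a second cancellation.
  have : Algebra.FormallyEtale O' T := Algebra.FormallyEtale.of_isLocalization (nonZeroDivisors O')
  have : Algebra.FormallyEtale S' O' := Algebra.FormallyEtale.of_isLocalization W'
  have : Algebra.FormallyEtale S O := Algebra.FormallyEtale.of_isLocalization W
  have : Algebra.FormallyEtale S' S'd :=
    Algebra.FormallyEtale.of_isLocalization (Submonoid.powers (algebraMap S S' d))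
  have : Algebra.FormallyEtale S Sd :=
    Algebra.FormallyEtale.of_isLocalization (Submonoid.powers d)
  have : Algebra.FormallyEtale S' T := Algebra.FormallyEtale.comp S' O' T
  have : Algebra.FormallyEtale S'd T := Algebra.FormallyEtale.of_restrictScalars (R := S')
  have : Algebra.FormallyEtale Sd T := Algebra.FormallyEtale.comp Sd S'd T
  have : Algebra.FormallyEtale S T := Algebra.FormallyEtale.comp S Sd T
  have : Algebra.FormallyEtale O T := Algebra.FormallyEtale.of_restrictScalars (R := S)
  exact eq_of_basis_kaehlerDifferential (T := T) b b'

end Rank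

/-! ## Completed local rings of smooth algebras -/

section LocalCompletion

/-- The equation of a regular curve does not divide the equation of a curve without common
component. -/
theorem notMem_span_singleton_of_disjoint_minimalPrimes {A : Type*} [CommRing A] [IsLocalRing A]
    [IsNoetherianRing A] {g h : A} (hg : g ≠ 0) (hh : h ∈ maximalIdeal A)
    [hp : (Ideal.span {h}).IsPrime]
    (hdisj : Disjoint (Ideal.span {h}).minimalPrimes (Ideal.span {g}).minimalPrimes) :
    g ∉ Ideal.span {h} := by
  intro hgh
  obtain ⟨p, hpm, hle⟩ := Ideal.exists_minimalPrimes_le ((Ideal.span_singleton_le_iff_mem _).2 hgh)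
  have hpp : p.IsPrime := hpm.1.1
  have hhp : h ∉ p := by
    intro h1
    have h2 : p = Ideal.span {h} := le_antisymm hle ((Ideal.span_singleton_le_iff_mem _).2 h1)
    refine Set.disjoint_left.1 hdisj ?_ hpm
    rw [h2, Ideal.minimalPrimes_eq_subsingleton_self]
    rfl
  -- Here `p ⊆ (h)` and `h ∉ p`, so `p = h p`; Nakayama gives `p = 0` and with it `g = 0`.
  have h3 : p ≤ Ideal.span {h} • p := by
    intro a ha
    obtain ⟨b, rfl⟩ := Ideal.mem_span_singleton.1 (hle ha)
    exact Ideal.mul_mem_mul (Ideal.mem_span_singleton_self h)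
      ((hpp.mem_or_mem ha).resolve_left hhp)
  have h4 : p = ⊥ := Submodule.eq_bot_of_le_smul_of_le_jacobson_bot _ _
    (IsNoetherian.noetherian p) h3
    (((Ideal.span_singleton_le_iff_mem _).2 hh).trans (maximalIdeal_le_jacobson _))
  rw [h4] at hpm
  exact hg ((Submodule.mem_bot A).1 (hpm.1.2 (Ideal.mem_span_singleton_self g)))

variable {k O : Type u} [Field k] [CommRing O] [IsLocalRing O] [IsNoetherianRing O] [Algebra k O]
  [Algebra.FormallySmooth k O]

theorem isDomain_adicCompletion_of_basis_kaehlerDifferential {n : ℕ}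
    (b : Module.Basis (Fin n) O Ω[O⁄k]) (hres : Function.Bijective (algebraMap k (ResidueField O))) :
    IsDomain (AdicCompletion (maximalIdeal O) O) := by
  obtain ⟨e⟩ := exists_ringEquiv_mvPowerSeries b hres
  exact e.symm.toMulEquiv.isDomain _

theorem isDomain_of_basis_kaehlerDifferential {n : ℕ}
    (b : Module.Basis (Fin n) O Ω[O⁄k]) (hres : Function.Bijective (algebraMap k (ResidueField O))) :
    IsDomain O := by
  have := isDomain_adicCompletion_of_basis_kaehlerDifferential b hres
  exact Function.Injective.isDomain (algebraMap O (AdicCompletion (maximalIdeal O) O))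
    (AdicCompletion.of_injective (maximalIdeal O) O)

theorem isNoetherianRing_adicCompletion_of_basis_kaehlerDifferential {n : ℕ}
    (b : Module.Basis (Fin n) O Ω[O⁄k]) (hres : Function.Bijective (algebraMap k (ResidueField O))) :
    IsNoetherianRing (AdicCompletion (maximalIdeal O) O) := by
  obtain ⟨e⟩ := exists_ringEquiv_mvPowerSeries b hres
  exact isNoetherianRing_of_ringEquiv _ e

theorem ringKrullDim_adicCompletion_le {n : ℕ}
    (b : Module.Basis (Fin n) O Ω[O⁄k]) (hres : Function.Bijective (algebraMap k (ResidueField O))) :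
    ringKrullDim (AdicCompletion (maximalIdeal O) O) ≤ n := by
  obtain ⟨e⟩ := exists_ringEquiv_mvPowerSeries b hres
  rw [← ringKrullDim_eq_of_ringEquiv e]
  exact MvPowerSeries.ringKrullDim_le k n

theorem exists_prime_and_notMem_adicCompletion
    (b : Module.Basis (Fin 2) O Ω[O⁄k]) (hres : Function.Bijective (algebraMap k (ResidueField O))) :
    ∃ x y : AdicCompletion (maximalIdeal O) O, Prime x ∧ y ∉ Ideal.span {x} ∧
      x ∈ maximalIdeal _ ∧ y ∈ maximalIdeal _ := by
  obtain ⟨e⟩ := exists_ringEquiv_mvPowerSeries b hres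
  obtain ⟨h1, h2⟩ := MvPowerSeries.prime_X_zero_and_X_one_notMem k
  have hm : ∀ i : Fin 2, e (MvPowerSeries.X i) ∈
      maximalIdeal (AdicCompletion (maximalIdeal O) O) := by
    intro i
    rw [mem_maximalIdeal, mem_nonunits_iff, MulEquiv.isUnit_map,
      MvPowerSeries.isUnit_iff_constantCoeff]
    simp
  exact ⟨e (MvPowerSeries.X 0), e (MvPowerSeries.X 1), (MulEquiv.prime_iff e.toMulEquiv).2 h1,
    notMem_span_singleton_of_ringEquiv e h2, hm 0, hm 1⟩

theorem AdicCompletion.exists_sub_algebraMap_mem_map_pow {O : Type*} [CommRing O] [IsLocalRing O]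
    [IsNoetherianRing O] (N : ℕ) (r : AdicCompletion (maximalIdeal O) O) :
    ∃ a : O, r - algebraMap O _ a ∈
      (maximalIdeal O ^ N).map (algebraMap O (AdicCompletion (maximalIdeal O) O)) := by
  obtain ⟨a, ha⟩ := Ideal.Quotient.mk_surjective (AdicCompletion.evalₐ (maximalIdeal O) N r)
  refine ⟨a, ?_⟩
  have h := AdicCompletion.pow_smul_top_eq_ker_eval (M := O) (n := N)
    (IsNoetherian.noetherian (maximalIdeal O))
  rw [Ideal.smul_top_eq_map] at h
  have h1 : r - algebraMap O _ a ∈ LinearMap.ker (AdicCompletion.eval (maximalIdeal O) O N) := by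
    rw [LinearMap.mem_ker, map_sub, sub_eq_zero]
    refine Eq.trans ?_ (AdicCompletion.eval_of (maximalIdeal O) O N a).symm
    rw [← AdicCompletion.factor_evalₐ_eq_eval _ r (by simp), ← ha, Ideal.Quotient.factor_mk]
    rfl
  rw [← h] at h1
  exact h1

end LocalCompletion

/-! ## The bound for completions of integral extensions -/

section Assembly

theorem isHausdorff_of_map_le {A R : Type*} [CommRing A] [CommRing R] [Algebra A R] {I : Ideal A}
    {J : Ideal R} (h : I.map (algebraMap A R) ≤ J) [IsHausdorff J R] : IsHausdorff I R where
  haus' r hr := by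
    refine IsHausdorff.haus' (I := J) r fun n => ?_
    have := hr n
    rw [SModEq.zero] at this ⊢
    rw [Ideal.smul_top_eq_map, Submodule.restrictScalars_mem, Ideal.map_pow] at this
    rw [smul_eq_mul, Ideal.mul_top]
    exact Ideal.pow_right_mono h n this

/-- The interface to geometry: `S → S'` is the normalisation over an affine open, `O → O'` the map
of local rings, `A → R` that of their completions. What remains is to derive finiteness, injectivity
and unramifiedness from these data. -/
theorem resolutionStages_le_of_isIntegral {k S S' O O' : Type*} {A R : Type u} [Field k]
    [CommRing S] [CommRing S'] [CommRing O] [IsLocalRing O] [CommRing O'] [IsLocalRing O']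
    [IsNoetherianRing O'] [Algebra k O] [Algebra k O'] [Algebra S S'] [Algebra S O] [Algebra S' O']
    [Algebra O O'] [Algebra S O'] [IsScalarTower S O O'] [IsScalarTower S S' O']
    [IsScalarTower k O O'] [Algebra.IsIntegral S S']
    (p' : Ideal S') [p'.IsPrime] [IsLocalization.AtPrime O' p'] [(p'.under S).IsPrime]
    [IsLocalization.AtPrime O (p'.under S)]
    (hres' : Function.Surjective (algebraMap k (ResidueField O')))
    [CommRing A] [IsLocalRing A] [IsDomain A] [IsNoetherianRing A]
    [IsAdicComplete (maximalIdeal A) A] [CommRing R] [IsLocalRing R] [IsDomain R]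
    [IsNoetherianRing R] [Algebra O A] [Algebra O' R] [Algebra A R]
    (hcomm : ∀ a : O, algebraMap A R (algebraMap O A a) = algebraMap O' R (algebraMap O O' a))
    (hAO : (maximalIdeal O).map (algebraMap O A) ≤ maximalIdeal A)
    (hAR : (maximalIdeal A).map (algebraMap A R) ≤ maximalIdeal R)
    (hd : ∀ (N : ℕ) (r : R), ∃ a : O', r - algebraMap O' R a ∈
      (maximalIdeal O' ^ N).map (algebraMap O' R))
    (hdim : ringKrullDim A = 2)
    {x y : R} (hx : Prime x) (hyx : y ∉ Ideal.span {x}) (hxm : x ∈ maximalIdeal R)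
    (hym : y ∈ maximalIdeal R) {g h : A} (hg : g ∈ maximalIdeal A) (hg0 : g ≠ 0)
    (hh : h ∈ maximalIdeal A) (hC : IsRegularLocalRing (A ⧸ Ideal.span {h}))
    (hC1 : ringKrullDim (A ⧸ Ideal.span {h}) = 1)
    (hCD : Disjoint (Ideal.span {h}).minimalPrimes (Ideal.span {g}).minimalPrimes)
    (hunr : ∀ P : Ideal A, P.IsPrime → g ∉ P → ∃ d : S, algebraMap O A (algebraMap S O d) ∉ P ∧
      ∀ a : S', ∃ n : ℕ, algebraMap S S' d ^ n • KaehlerDifferential.D S S' a = 0) :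
    (annihilatingExponents (FractionRing A) R g).Nonempty ∧
    Module.Finite A (CodifferentQuotient A (FractionRing A) R) ∧
    Module.length A (A ⧸ Ideal.span {g, h}) ≠ ⊤ ∧
    resolutionStages R (algebraMap A R h) ≤
      (leastExponent (FractionRing A) R g : ℕ∞) *
        (codifferentGenerators A (FractionRing A) R : ℕ∞) *
        Module.length A (A ⧸ Ideal.span {g, h}) := by
  have hR : IsHausdorff (maximalIdeal A) R := isHausdorff_of_map_le hAR
  let : Algebra O R := ((algebraMap O' R).comp (algebraMap O O')).toAlgebra
  have : IsScalarTower O O' R := IsScalarTower.of_algebraMap_eq fun _ => rfl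
  have : IsScalarTower O A R := IsScalarTower.of_algebraMap_eq fun a => (hcomm a).symm
  let : Algebra S' R := ((algebraMap O' R).comp (algebraMap S' O')).toAlgebra
  have : IsScalarTower S' O' R := IsScalarTower.of_algebraMap_eq fun _ => rfl
  let : Algebra S R := ((algebraMap S' R).comp (algebraMap S S')).toAlgebra
  have : IsScalarTower S S' R := IsScalarTower.of_algebraMap_eq fun _ => rfl
  let : Algebra S A := ((algebraMap O A).comp (algebraMap S O)).toAlgebra
  have : IsScalarTower S O A := IsScalarTower.of_algebraMap_eq fun _ => rfl
  have : IsScalarTower S A R := IsScalarTower.of_algebraMap_eq fun a => by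
    rw [IsScalarTower.algebraMap_apply S S' R, IsScalarTower.algebraMap_apply S' O' R,
      ← IsScalarTower.algebraMap_apply S S' O', IsScalarTower.algebraMap_apply S O O',
      IsScalarTower.algebraMap_apply S O A, hcomm]
  obtain ⟨N, hN⟩ := exists_maximalIdeal_pow_le_map_of_isIntegral (S := S) (O := O) (O' := O') p'
  obtain ⟨n, v, hv⟩ := exists_fin_generators_of_maximalIdeal_pow_le hres' hN hAO hR (hd N)
  have hfin : Module.Finite A R := by
    refine ⟨Submodule.fg_iff_exists_fin_generating_family.2
      ⟨n, fun i => algebraMap O' R (v i), eq_top_iff.2 fun r _ => ?_⟩⟩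
    obtain ⟨c, rfl⟩ := hv r
    exact Submodule.sum_mem _ fun i _ => Submodule.smul_mem _ _ (Submodule.subset_span ⟨i, rfl⟩)
  have hinj : Function.Injective (algebraMap A R) :=
    algebraMap_injective_of_ringKrullDim_le_two hdim.le (two_le_ringKrullDim_of_prime hx hyx hym)
  -- For `h = 0` the quotient would have dimension two.
  have hh0 : h ≠ 0 := by
    rintro rfl
    have e : A ≃+* A ⧸ Ideal.span {(0 : A)} :=
      ((Ideal.quotEquivOfEq Ideal.span_singleton_zero).trans (RingEquiv.quotientBot A)).symm
    rw [← ringKrullDim_eq_of_ringEquiv e, hdim] at hC1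
    exact absurd hC1 (by decide)
  have hprime : (Ideal.span {h}).IsPrime := (Ideal.Quotient.isDomain_iff_prime _).1
    (IsRegularLocalRing.isDomain_and_isPrincipalIdealRing_of_ringKrullDim_eq_one hC1).1
  refine resolutionStages_le_of_finite hinj (fun a ha => hAR (Ideal.mem_map_of_mem _ ha)) hx hyx hxm
    hym hg hh hh0 hC hC1 (notMem_span_singleton_of_disjoint_minimalPrimes hg0 hh hCD) ?_
  intro P hP hgP
  obtain ⟨d, hdP, hdn⟩ := hunr P hP hgP
  exact formallyUnramified_residueField_tensorProduct p'.primeCompl v hv P d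
    (by rwa [IsScalarTower.algebraMap_apply S O A]) hdn

theorem map_maximalIdeal_completionMap_le {O O' : Type*} [CommRing O] [IsLocalRing O]
    [IsNoetherianRing O] [CommRing O'] [IsLocalRing O'] [IsNoetherianRing O'] (φ : O →+* O')
    [IsLocalHom φ] :
    (maximalIdeal (AdicCompletion (maximalIdeal O) O)).map (completionMap φ) ≤
      maximalIdeal (AdicCompletion (maximalIdeal O') O') := by
  rw [AdicCompletion.maximalIdeal_eq_map, AdicCompletion.maximalIdeal_eq_map, Ideal.map_map]
  have h : (completionMap φ).comp (algebraMap O _) = (algebraMap O' _).comp φ :=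
    RingHom.ext fun a => completionMap_algebraMap φ a
  rw [h, ← Ideal.map_map]
  exact Ideal.map_mono (((local_hom_TFAE φ).out 0 2).mp ‹_›)

end Assembly

/-! ## Local rings of smooth algebras over algebraically closed fields -/

section SmoothLocalRing

/-- At a maximal ideal `p` such that `T ⧸ p` is integral over an algebraically closed field `k` the
residue field is `k`. -/
theorem bijective_algebraMap_residueField_of_isIntegral {k T O : Type*} [Field k] [IsAlgClosed k]
    [CommRing T] [CommRing O] [IsLocalRing O] [Algebra k T] [Algebra k O] [Algebra T O]
    [IsScalarTower k T O] (p : Ideal T) [p.IsMaximal] [IsLocalization.AtPrime O p]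
    [Algebra.IsIntegral k (T ⧸ p)] : Function.Bijective (algebraMap k (ResidueField O)) := by
  let e := IsLocalization.AtPrime.equivQuotMaximalIdeal p O
  have : Algebra.IsIntegral k (ResidueField O) := by
    constructor
    intro z
    obtain ⟨y, rfl⟩ := e.surjective z
    have h : IsIntegral k y := Algebra.IsIntegral.isIntegral y
    refine IsIntegral.map_of_comp_eq (RingHom.id k) e.toRingHom ?_ h
    ext a
    change algebraMap k (ResidueField O) a = e (Ideal.Quotient.mk p (algebraMap k T a))
    rw [IsLocalization.AtPrime.equivQuotMaximalIdeal_apply_mk, ← IsScalarTower.algebraMap_apply]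
    rfl
  exact IsAlgClosed.algebraMap_bijective_of_isIntegral

theorem isIntegral_quotient_of_finiteType {k T : Type*} [Field k] [CommRing T] [Algebra k T]
    [Algebra.FiniteType k T] (p : Ideal T) [p.IsMaximal] : Algebra.IsIntegral k (T ⧸ p) := by
  have : Algebra.FiniteType k (T ⧸ p) := inferInstance
  let : Field (T ⧸ p) := Ideal.Quotient.field p
  have := finite_of_finite_type_of_isJacobsonRing k (T ⧸ p)
  exact Algebra.IsIntegral.of_finite k (T ⧸ p)

theorem isIntegral_quotient_of_under {k S S' : Type*} [Field k] [CommRing S] [CommRing S']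
    [Algebra k S] [Algebra k S'] [Algebra S S'] [IsScalarTower k S S'] [Algebra.IsIntegral S S']
    (p' : Ideal S') [Algebra.IsIntegral k (S ⧸ p'.under S)] : Algebra.IsIntegral k (S' ⧸ p') := by
  have : IsScalarTower k (S ⧸ p'.under S) (S' ⧸ p') := IsScalarTower.of_algebraMap_eq fun x => by
    change Ideal.Quotient.mk p' (algebraMap k S' x) =
      Ideal.Quotient.mk p' (algebraMap S S' (algebraMap k S x))
    rw [← IsScalarTower.algebraMap_apply]
  have : Algebra.IsIntegral (S ⧸ p'.under S) (S' ⧸ p') := inferInstance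
  exact Algebra.IsIntegral.trans (S ⧸ p'.under S)

theorem exists_basis_kaehlerDifferential_of_smooth {k T O : Type*} [Field k] [CommRing T]
    [CommRing O] [IsLocalRing O] [Algebra k T] [Algebra k O] [Algebra T O] [IsScalarTower k T O]
    [Algebra.Smooth k T] (W : Submonoid T) [IsLocalization W O] :
    Algebra.FormallySmooth k O ∧ ∃ n, Nonempty (Module.Basis (Fin n) O Ω[O⁄k]) := by
  have := Algebra.FormallyEtale.of_isLocalization (Rₘ := O) W
  have h1 : Algebra.FormallySmooth k O := Algebra.FormallySmooth.comp k T O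
  refine ⟨h1, ?_⟩
  have : Module.Finite O Ω[O⁄k] :=
    Module.Finite.equiv (KaehlerDifferential.tensorKaehlerEquivOfFormallyEtale k T O)
  have : Module.Free O Ω[O⁄k] := Module.free_of_flat_of_isLocalRing
  exact ⟨_, ⟨Module.finBasis O Ω[O⁄k]⟩⟩

theorem exists_basis_kaehlerDifferential_of_isStandardSmoothOfRelativeDimension {k T O : Type*}
    [Field k] [CommRing T] [CommRing O] [IsLocalRing O] [Algebra k T] [Algebra k O] [Algebra T O]
    [IsScalarTower k T O] {n : ℕ} [Algebra.IsStandardSmoothOfRelativeDimension n k T]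
    (W : Submonoid T) [IsLocalization W O] :
    Algebra.FormallySmooth k O ∧ Nonempty (Module.Basis (Fin n) O Ω[O⁄k]) := by
  have := Algebra.FormallyEtale.of_isLocalization (Rₘ := O) W
  have : Algebra.IsStandardSmooth k T :=
    Algebra.IsStandardSmoothOfRelativeDimension.isStandardSmooth n
  have : Nontrivial T := (algebraMap T O).domain_nontrivial
  have hr := Algebra.IsStandardSmoothOfRelativeDimension.rank_kaehlerDifferential (R := k) (S := T) n
  let b := Module.finBasisOfFinrankEq T Ω[T⁄k] (Module.finrank_eq_of_rank_eq hr)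
  exact ⟨Algebra.FormallySmooth.comp k T O, ⟨(b.baseChange O).map
    (KaehlerDifferential.tensorKaehlerEquivOfFormallyEtale k T O)⟩⟩

end SmoothLocalRing

/-! ## Local rings of schemes over a field -/

section SchemeOverField

variable {k : Type u} [Field k] {X X' : Scheme.{u}} (s : X ⟶ Spec (.of k))

/-- The structure map of the sections over `V` of a scheme over `k`. -/
def structureMapSections (V : X.Opens) : k →+* Γ(X, V) :=
  ((Scheme.ΓSpecIso (.of k)).inv ≫ s.appLE ⊤ V le_top).hom

/-- The structure map of the local ring at `x` of a scheme over `k`. -/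
def structureMapStalk (x : X) : k →+* X.presheaf.stalk x :=
  ((Scheme.ΓSpecIso (.of k)).inv ≫ s.appTop ≫ X.presheaf.germ ⊤ x (TopologicalSpace.Opens.mem_top x)).hom

theorem germ_structureMapSections (V : X.Opens) (x : X) (hx : x ∈ V) (a : k) :
    X.presheaf.germ V x hx (structureMapSections s V a) = structureMapStalk s x a := by
  have h : (Scheme.ΓSpecIso (.of k)).inv ≫ s.appLE ⊤ V le_top ≫ X.presheaf.germ V x hx =
      (Scheme.ΓSpecIso (.of k)).inv ≫ s.appTop ≫ X.presheaf.germ ⊤ x (TopologicalSpace.Opens.mem_top x) := by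
    congr 1
    change (s.app ⊤ ≫ X.presheaf.map (homOfLE le_top).op) ≫ _ = _
    rw [Category.assoc]
    exact congrArg (s.app ⊤ ≫ ·) (X.presheaf.germ_res (homOfLE le_top) x hx)
  exact congr($h a)

theorem stalkMap_structureMapStalk (f : X' ⟶ X) (x' : X') (a : k) :
    f.stalkMap x' (structureMapStalk s (f x') a) = structureMapStalk (f ≫ s) x' a := by
  have h : (Scheme.ΓSpecIso (.of k)).inv ≫ s.appTop ≫ X.presheaf.germ ⊤ (f x') (TopologicalSpace.Opens.mem_top _) ≫
      f.stalkMap x' =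
      (Scheme.ΓSpecIso (.of k)).inv ≫ (f ≫ s).appTop ≫ X'.presheaf.germ ⊤ x' (TopologicalSpace.Opens.mem_top _) := by
    rw [Scheme.Hom.germ_stalkMap, Scheme.Hom.comp_appTop, Category.assoc]
    rfl
  exact congr($h a)

theorem isScalarTower_sections_stalk (V : X.Opens) (x : X) (hx : x ∈ V) :
    letI := (structureMapSections s V).toAlgebra
    letI := (structureMapStalk s x).toAlgebra
    letI := (X.presheaf.germ V x hx).hom.toAlgebra
    IsScalarTower k Γ(X, V) (X.presheaf.stalk x) := by
  let := (structureMapSections s V).toAlgebra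
  let := (structureMapStalk s x).toAlgebra
  let := (X.presheaf.germ V x hx).hom.toAlgebra
  exact IsScalarTower.of_algebraMap_eq fun a => (germ_structureMapSections s V x hx a).symm

theorem RingHom.IsStandardSmoothOfRelativeDimension.structureMapSections {n : ℕ} {V : X.Opens}
    (h : (s.appLE ⊤ V le_top).hom.IsStandardSmoothOfRelativeDimension n) :
    (structureMapSections s V).IsStandardSmoothOfRelativeDimension n :=
  RingHom.isStandardSmoothOfRelativeDimension_respectsIso.2 _
    (Scheme.ΓSpecIso (.of k)).symm.commRingCatIsoToRingEquiv h

theorem RingHom.Smooth.structureMapSections {V : X.Opens} (h : (s.appLE ⊤ V le_top).hom.Smooth) :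
    (structureMapSections s V).Smooth :=
  RingHom.Smooth.propertyIsLocal.respectsIso.2 _
    (Scheme.ΓSpecIso (.of k)).symm.commRingCatIsoToRingEquiv h

theorem exists_isStandardSmoothOfRelativeDimension_structureMapSections (n : ℕ)
    [SmoothOfRelativeDimension n s] (x : X) : ∃ V : X.Opens, IsAffineOpen V ∧ x ∈ V ∧
      (structureMapSections s V).IsStandardSmoothOfRelativeDimension n := by
  obtain ⟨U, hU, V, hV, hxV, e, h⟩ :=
    SmoothOfRelativeDimension.exists_isStandardSmoothOfRelativeDimension (n := n) (f := s) x
  -- `Spec k` has a single point.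
  have hUtop : U = ⊤ := by
    rw [eq_top_iff]
    intro y _
    rw [Subsingleton.elim (α := PrimeSpectrum k) y (s x)]
    exact e hxV
  subst hUtop
  exact ⟨V, hV, hxV, h.structureMapSections s⟩

theorem exists_smooth_structureMapSections (V : X.Opens) [hs : Smooth (V.ι ≫ s)] (x : X)
    (hx : x ∈ V) : ∃ W : X.Opens, IsAffineOpen W ∧ x ∈ W ∧ (structureMapSections s W).Smooth := by
  obtain ⟨_, ⟨W, hW, rfl⟩, hxW, -⟩ := V.toScheme.isBasis_affineOpens.exists_subset_of_mem_open
    (Set.mem_univ (⟨x, hx⟩ : V)) isOpen_univ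
  refine ⟨V.ι ''ᵁ W, hW.image_of_isOpenImmersion _, ⟨_, hxW, rfl⟩,
    RingHom.Smooth.structureMapSections s ?_⟩
  have h := Scheme.Hom.smooth_appLE (V.ι ≫ s) (isAffineOpen_top _) hW le_top
  have : IsIso (V.ι.appLE (V.ι ''ᵁ W) W (V.ι.preimage_image_eq _).ge) :=
    inferInstanceAs (IsIso (V.ι.app _ ≫
      V.toScheme.presheaf.map (eqToHom (V.ι.preimage_image_eq _).symm).op))
  rw [← Scheme.Hom.appLE_comp_appLE _ _ _ (V.ι ''ᵁ W) W le_top (V.ι.preimage_image_eq _).ge,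
    CommRingCat.hom_comp, RingHom.Smooth.propertyIsLocal.respectsIso.cancel_right_isIso] at h
  exact h

theorem exists_basis_kaehlerDifferential_stalk {W : X.Opens} (hW : IsAffineOpen W) {x : X}
    (hx : x ∈ W) (h : (structureMapSections s W).Smooth) :
    letI := (structureMapStalk s x).toAlgebra
    Algebra.FormallySmooth k (X.presheaf.stalk x) ∧
      ∃ n, Nonempty (Module.Basis (Fin n) (X.presheaf.stalk x) Ω[X.presheaf.stalk x⁄k]) := by
  let := (structureMapSections s W).toAlgebra
  let := (structureMapStalk s x).toAlgebra
  let := (X.presheaf.germ W x hx).hom.toAlgebra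
  have := isScalarTower_sections_stalk s W x hx
  have : Algebra.Smooth k Γ(X, W) := h
  have := hW.isLocalization_stalk ⟨x, hx⟩
  exact exists_basis_kaehlerDifferential_of_smooth (T := Γ(X, W))
    (hW.primeIdealOf ⟨x, hx⟩).asIdeal.primeCompl

theorem exists_basis_kaehlerDifferential_stalk_of_relativeDimension {n : ℕ} {W : X.Opens}
    (hW : IsAffineOpen W) {x : X} (hx : x ∈ W)
    (h : (structureMapSections s W).IsStandardSmoothOfRelativeDimension n) :
    letI := (structureMapStalk s x).toAlgebra
    Algebra.FormallySmooth k (X.presheaf.stalk x) ∧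
      Nonempty (Module.Basis (Fin n) (X.presheaf.stalk x) Ω[X.presheaf.stalk x⁄k]) := by
  let := (structureMapSections s W).toAlgebra
  let := (structureMapStalk s x).toAlgebra
  let := (X.presheaf.germ W x hx).hom.toAlgebra
  have := isScalarTower_sections_stalk s W x hx
  have : Algebra.IsStandardSmoothOfRelativeDimension n k Γ(X, W) := h
  have := hW.isLocalization_stalk ⟨x, hx⟩
  exact exists_basis_kaehlerDifferential_of_isStandardSmoothOfRelativeDimension (T := Γ(X, W))
    (hW.primeIdealOf ⟨x, hx⟩).asIdeal.primeCompl

end SchemeOverField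

/-! ## The normalisation over the étale locus -/

section NormalizationEtale

/-- Over an affine open over which `f` is integral and étale the normalization in `f` is étale. -/
theorem etale_fromNormalization_app {X Y : Scheme.{u}} (f : X ⟶ Y) [QuasiCompact f]
    [QuasiSeparated f] {W : Y.Opens} (hW : IsAffineOpen W) (hint : (f.app W).hom.IsIntegral)
    (het : (f.app W).hom.Etale) : (f.fromNormalization.app W).hom.Etale := by
  let : Algebra Γ(Y, W) Γ(X, f ⁻¹ᵁ W) := (f.app W).hom.toAlgebra
  have h1 : Algebra.Etale Γ(Y, W) Γ(X, f ⁻¹ᵁ W) := het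
  have h2 : Algebra.IsIntegral Γ(Y, W) Γ(X, f ⁻¹ᵁ W) := ⟨hint⟩
  have h3 : Algebra.Etale Γ(Y, W) (integralClosure Γ(Y, W) Γ(X, f ⁻¹ᵁ W)) :=
    Algebra.Etale.of_equiv (((Subalgebra.equivOfEq _ _ (integralClosure_eq_top_iff.2 h2)).trans
      Subalgebra.topEquiv).symm)
  rw [Scheme.Hom.fromNormalization_app f hW, CommRingCat.hom_comp,
    RingHom.Etale.propertyIsLocal.respectsIso.cancel_right_isIso, CommRingCat.hom_ofHom,
    RingHom.etale_algebraMap]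
  exact h3

/-- Over `X - D` the cover is finite, so its ring of functions is its own integral closure and `X'`
agrees with `U'`. -/
theorem BranchedCover.etale_proj_app {k : Type u} [Field k] (B : BranchedCover k) {W : B.X.Opens}
    (hW : IsAffineOpen W) (hle : W ≤ complementOpen B.incl) : (B.proj.app W).hom.Etale := by
  have : Etale B.cover := B.isGaloisCover_cover.2.1
  let ι := (complementOpen B.incl).ι
  have hle' : W ≤ ι.opensRange := by simpa [ι] using hle
  have hW' : IsAffineOpen (ι ⁻¹ᵁ W) := hW.preimage_of_isOpenImmersion ι hle'
  have hiso : IsIso (ι.app W) := ι.isIso_app W hle'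
  refine etale_fromNormalization_app B.toX hW ?_ ?_
  · change (ι.app W ≫ B.cover.app (ι ⁻¹ᵁ W)).hom.IsIntegral
    rw [CommRingCat.hom_comp]
    exact RingHom.IsIntegral.trans _ _
      (RingHom.isIntegral_of_surjective _ (ConcreteCategory.bijective_of_isIso (ι.app W)).2)
      (B.cover.finite_app _ hW').to_isIntegral
  · change (ι.app W ≫ B.cover.app (ι ⁻¹ᵁ W)).hom.Etale
    rw [CommRingCat.hom_comp, RingHom.Etale.propertyIsLocal.respectsIso.cancel_left_isIso,
      Scheme.Hom.app_eq_appLE]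
    exact B.cover.etale_appLE hW' (hW'.preimage B.cover) le_rfl

instance {k : Type u} [Field k] (B : BranchedCover k) : IsIntegralHom B.proj :=
  inferInstanceAs (IsIntegralHom B.toX.fromNormalization)

end NormalizationEtale

/-! ## Basic opens over which a morphism is étale -/

section EtaleLocus

variable {X X' : Scheme.{u}} (f : X' ⟶ X) {U : X.Opens}

/-- Basic opens over which an affine morphism is étale give localizations that are étale. -/
theorem exists_localizations_of_etale_app [IsAffineHom f] (hU : IsAffineOpen U) (d : Γ(X, U))
    (het : (f.app (X.basicOpen d)).hom.Etale) :
    letI := (f.app U).hom.toAlgebra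
    ∃ (Sd S'd : Type u) (_ : CommRing Sd) (_ : CommRing S'd) (_ : Algebra Γ(X, U) Sd)
      (_ : Algebra Γ(X', f ⁻¹ᵁ U) S'd) (_ : Algebra Sd S'd) (_ : Algebra Γ(X, U) S'd)
      (_ : IsScalarTower Γ(X, U) Sd S'd) (_ : IsScalarTower Γ(X, U) Γ(X', f ⁻¹ᵁ U) S'd)
      (_ : IsLocalization.Away d Sd)
      (_ : IsLocalization.Away (algebraMap Γ(X, U) Γ(X', f ⁻¹ᵁ U) d) S'd),
      Algebra.FormallyEtale Sd S'd := by
  let := (f.app U).hom.toAlgebra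
  let i : X.basicOpen d ⟶ U := homOfLE (X.basicOpen_le d)
  let i' : f ⁻¹ᵁ X.basicOpen d ⟶ f ⁻¹ᵁ U := homOfLE (f.preimage_mono (X.basicOpen_le d))
  let a1 := (X.presheaf.map i.op).hom.toAlgebra
  let a2 := (X'.presheaf.map i'.op).hom.toAlgebra
  let a3 := (f.app (X.basicOpen d)).hom.toAlgebra
  let a5 := ((X'.presheaf.map i'.op).hom.comp (f.app U).hom).toAlgebra
  have h := hU.isLocalization_of_eq_basicOpen d i rfl
  have h' := (hU.preimage f).isLocalization_of_eq_basicOpen (f.app U d) i'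
    (Scheme.preimage_basicOpen f d)
  have het' : Algebra.Etale Γ(X, X.basicOpen d) Γ(X', f ⁻¹ᵁ X.basicOpen d) := het
  refine ⟨Γ(X, X.basicOpen d), Γ(X', f ⁻¹ᵁ X.basicOpen d), inferInstance, inferInstance, a1, a2, a3,
    a5, ?_, ?_, h, h', inferInstance⟩
  · exact IsScalarTower.of_algebraMap_eq fun x => congr($(f.naturality i.op).hom x).symm
  · exact IsScalarTower.of_algebraMap_eq fun x => rfl

theorem exists_pow_smul_D_eq_zero_of_etale_app [IsAffineHom f] (hU : IsAffineOpen U) (d : Γ(X, U))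
    (het : (f.app (X.basicOpen d)).hom.Etale) :
    letI := (f.app U).hom.toAlgebra
    ∀ a : Γ(X', f ⁻¹ᵁ U), ∃ n : ℕ,
      f.app U d ^ n • KaehlerDifferential.D Γ(X, U) Γ(X', f ⁻¹ᵁ U) a = 0 := by
  let := (f.app U).hom.toAlgebra
  obtain ⟨Sd, S'd, _, _, _, _, _, _, _, _, _, _, _⟩ := exists_localizations_of_etale_app f hU d het
  exact exists_pow_smul_D_eq_zero (Sd := Sd) (S'd := S'd) d

end EtaleLocus

/-! ## Branched covers of surfaces -/

namespace BranchedCover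

variable {k : Type u} [Field k] (B : BranchedCover k)

/-- If `D` were all of `X`, its generic point would map to that of `X`, whose local ring is a field,
against codimension one. -/
theorem nonempty_complementOpen : (complementOpen B.incl : Set B.X).Nonempty := by
  by_contra hne
  have hrange : Set.range B.incl = Set.univ := by
    rw [← Set.compl_empty_iff]
    exact Set.not_nonempty_iff_eq_empty.1 hne
  have h : IsGenericPoint (B.incl (genericPoint B.D)) (⊤ : Set B.X) := by
    have := (genericPoint_spec B.D).image B.incl.continuous
    rwa [Set.image_univ, hrange, closure_univ] at this
  have h1 : B.incl (genericPoint B.D) = genericPoint B.X := h.eq (genericPoint_spec B.X)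
  have h2 := B.codim_D
  rw [h1] at h2
  have h3 : ringKrullDim B.X.functionField = 0 := ringKrullDim_eq_zero_of_field _
  exact absurd (h3.symm.trans h2) (by decide)

theorem exists_basicOpen_le_complementOpen {U : B.X.Opens} (hU : IsAffineOpen U)
    (hne : (U : Set B.X).Nonempty) : ∃ d : Γ(B.X, U), B.X.basicOpen d ≤ complementOpen B.incl ∧
      (B.X.basicOpen d : Set B.X).Nonempty := by
  obtain ⟨z, hzU, hz⟩ := nonempty_preirreducible_inter U.isOpen (complementOpen B.incl).isOpen
    hne B.nonempty_complementOpen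
  obtain ⟨d, hd, hzd⟩ := hU.exists_basicOpen_le ⟨z, hz⟩ hzU
  exact ⟨d, hd, z, hzd⟩

/-- A function that does not vanish identically on `X` does not vanish near any point of `X'`. -/
theorem germ_app_ne_zero {U : B.X.Opens} (d : Γ(B.X, U))
    (hd : (B.X.basicOpen d : Set B.X).Nonempty) (x' : B.X') (hx' : x' ∈ B.proj ⁻¹ᵁ U) :
    B.X'.presheaf.germ (B.proj ⁻¹ᵁ U) x' hx' (B.proj.app U d) ≠ 0 := by
  intro h0
  rw [← map_zero (B.X'.presheaf.germ (B.proj ⁻¹ᵁ U) x' hx').hom] at h0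
  obtain ⟨W, hxW, i, j, hW⟩ := B.X'.presheaf.germ_eq x' hx' hx' _ _ h0
  have hbot : B.X'.basicOpen (B.proj.app U d) ⊓ W = ⊥ := by
    have h1 := B.X'.basicOpen_res (B.proj.app U d) i.op
    rw [hW, map_zero, Scheme.basicOpen_zero] at h1
    rw [inf_comm]
    exact h1.symm
  have : Etale B.cover := B.isGaloisCover_cover.2.1
  have : Etale B.toX := by unfold BranchedCover.toX; infer_instance
  let t : B.U' ⟶ B.X' := B.toX.toNormalization
  have : IsDominant t := inferInstanceAs (IsDominant B.toX.toNormalization)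
  have ht : t ≫ B.proj = B.toX := B.toX.toNormalization_fromNormalization
  obtain ⟨u, hu⟩ : (t ⁻¹ᵁ W : Set B.U').Nonempty := by
    obtain ⟨_, hw, u, rfl⟩ := t.denseRange.inter_open_nonempty W W.isOpen ⟨x', hxW⟩
    exact ⟨u, hw⟩
  -- `U'` is dense in `X'` and étale over `X`, so the part of it over `W` has nonempty open image,
  -- which meets the locus `d ≠ 0` of the irreducible `X`.
  have hopen : IsOpen (B.toX '' (t ⁻¹ᵁ W : Set B.U')) := B.toX.isOpenMap _ (t ⁻¹ᵁ W).isOpen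
  obtain ⟨_, ⟨v, hv, rfl⟩, hvd⟩ := nonempty_preirreducible_inter hopen (B.X.basicOpen d).isOpen
    ⟨_, u, hu, rfl⟩ hd
  have h2 : t v ∈ B.proj ⁻¹ᵁ B.X.basicOpen d := by
    change B.proj (t v) ∈ B.X.basicOpen d
    rw [← Scheme.Hom.comp_apply, ht]
    exact hvd
  rw [Scheme.preimage_basicOpen] at h2
  have h3 : t v ∈ B.X'.basicOpen (B.proj.app U d) ⊓ W := ⟨h2, hv⟩
  rw [hbot] at h3
  exact h3

end BranchedCover

namespace PointedBranchedCover

variable {k : Type u} [Field k] (B : PointedBranchedCover k)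

instance : Algebra (B.X.presheaf.stalk B.x) B.A :=
  inferInstanceAs (Algebra _ (AdicCompletion (maximalIdeal (B.X.presheaf.stalk B.x)) _))

instance : Algebra (B.X'.presheaf.stalk B.x') B.R :=
  inferInstanceAs (Algebra _ (AdicCompletion (maximalIdeal (B.X'.presheaf.stalk B.x')) _))

theorem mem_range_incl_iff {g : B.A} (hD : B.IsEquationOfD g) (P : Spec (.of B.A)) :
    B.fromCompletion P ∈ Set.range B.incl ↔ g ∈ P.asIdeal := by
  obtain ⟨e, he⟩ := hD
  have h1 : Set.range (pullback.snd B.incl B.fromCompletion) =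
      B.fromCompletion ⁻¹' Set.range B.incl := Scheme.Pullback.range_snd _ _
  have h2 : Set.range (pullback.snd B.incl B.fromCompletion) =
      PrimeSpectrum.zeroLocus {g} := by
    rw [← he, Scheme.Hom.comp_base, TopCat.coe_comp, Set.range_comp,
      Set.range_eq_univ.2 e.hom.surjective, Set.image_univ]
    refine (range_comap_of_surjective _ _ Ideal.Quotient.mk_surjective).trans ?_
    rw [Ideal.mk_ker, PrimeSpectrum.zeroLocus_span]
  rw [← Set.mem_preimage, ← h1, h2]
  exact Set.singleton_subset_iff

theorem fromCompletion_mem_basicOpen_iff {U : B.X.Opens} (hU : IsAffineOpen U) (hx : B.x ∈ U)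
    (d : Γ(B.X, U)) (P : Spec (.of B.A)) :
    B.fromCompletion P ∈ B.X.basicOpen d ↔ algebraMap (B.X.presheaf.stalk B.x)
      (AdicCompletion (maximalIdeal (B.X.presheaf.stalk B.x)) (B.X.presheaf.stalk B.x))
      (B.X.presheaf.germ U B.x hx d) ∉ P.asIdeal := by
  unfold fromCompletion
  rw [← hU.fromSpecStalk_eq_fromSpecStalk hx, IsAffineOpen.fromSpecStalk,
    Scheme.Hom.comp_apply, Scheme.Hom.comp_apply, ← Scheme.Hom.mem_preimage,
    hU.fromSpec_preimage_basicOpen]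
  rfl

theorem fromCompletion_mem {U : B.X.Opens} (hx : B.x ∈ U) (P : Spec (.of B.A)) :
    B.fromCompletion P ∈ U := by
  unfold fromCompletion
  rw [Scheme.Hom.comp_apply]
  set y := Spec.map (CommRingCat.ofHom (algebraMap (B.X.presheaf.stalk B.x)
    (AdicCompletion (maximalIdeal (B.X.presheaf.stalk B.x)) (B.X.presheaf.stalk B.x)))) P
  have : B.X.fromSpecStalk B.x y ∈ Set.range (B.X.fromSpecStalk B.x) := ⟨y, rfl⟩
  rw [Scheme.range_fromSpecStalk] at this
  exact this.mem_open U.isOpen hx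

/-- With `g = 0` the generic point of `Spec A` would map into `D`. A function `d` whose nonvanishing
locus is nonempty and avoids `D` would then vanish in `A`, hence on the integral surface `X`. -/
theorem equation_ne_zero [IsDomain B.A] {g : B.A} (hD : B.IsEquationOfD g) : g ≠ 0 := by
  rintro rfl
  obtain ⟨_, ⟨U, hU, rfl⟩, hx, -⟩ := B.X.isBasis_affineOpens.exists_subset_of_mem_open
    (Set.mem_univ B.x) isOpen_univ
  obtain ⟨d, hd, z, hz⟩ := B.exists_basicOpen_le_complementOpen hU ⟨B.x, hx⟩
  let P : Spec (.of B.A) := (⊥ : PrimeSpectrum B.A)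
  have h1 := (B.mem_range_incl_iff hD P).2 (zero_mem _)
  have h2 : B.fromCompletion P ∉ B.X.basicOpen d := fun h => hd h h1
  rw [B.fromCompletion_mem_basicOpen_iff hU hx, not_not] at h2
  have h3 : algebraMap (B.X.presheaf.stalk B.x)
      (AdicCompletion (maximalIdeal (B.X.presheaf.stalk B.x)) (B.X.presheaf.stalk B.x))
      (B.X.presheaf.germ U B.x hx d) = 0 := h2
  have h4 : B.X.presheaf.germ U B.x hx d = 0 :=
    AdicCompletion.of_injective _ _ (h3.trans (map_zero _).symm)
  have h5 : d = 0 := germ_injective_of_isIntegral B.X B.x hx (h4.trans (map_zero _).symm)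
  rw [h5, Scheme.basicOpen_zero] at hz
  exact hz

end PointedBranchedCover

end

/-! ### The theorem for a pointed branched cover -/

theorem proposition3p8 {k : Type u} [Field k] [IsAlgClosed k] (B : PointedBranchedCover k)
    (g : B.A) (hg : g ∈ maximalIdeal B.A) (hD : B.IsEquationOfD g)
    (h : B.A) (hh : h ∈ maximalIdeal B.A)
    (hC : IsRegularLocalRing (B.A ⧸ Ideal.span {h}))
    (hC1 : ringKrullDim (B.A ⧸ Ideal.span {h}) = 1)
    (hCD : Disjoint (Ideal.span {h}).minimalPrimes (Ideal.span {g}).minimalPrimes) :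
    (annihilatingExponents (FractionRing B.A) B.R g).Nonempty ∧
    Module.Finite B.A (CodifferentQuotient B.A (FractionRing B.A) B.R) ∧
    Module.length B.A (B.A ⧸ Ideal.span {g, h}) ≠ ⊤ ∧
    resolutionStages B.R (algebraMap B.A B.R h) ≤
      (leastExponent (FractionRing B.A) B.R g : ℕ∞) * (codifferentGenerators B.A (FractionRing B.A) B.R : ℕ∞) *
        Module.length B.A (B.A ⧸ Ideal.span {g, h}) := by
  obtain ⟨U, hU, hx, hUs⟩ :=
    exists_isStandardSmoothOfRelativeDimension_structureMapSections B.str 2 B.x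
  obtain ⟨V, hxV, hV⟩ := B.smoothAt_x'
  -- `W` need not be related to the preimage of `U`: it only provides the differentials of the local
  -- ring at `x'`, while integrality is read off on the preimage of `U`.
  obtain ⟨W, hW, hxW, hWs⟩ := exists_smooth_structureMapSections (B.proj ≫ B.str) V B.x' hxV
  have hx' : B.x' ∈ B.proj ⁻¹ᵁ U := hx
  let O := B.X.presheaf.stalk B.x
  let O' := B.X'.presheaf.stalk B.x'
  let S := Γ(B.X, U)
  let S' := Γ(B.X', B.proj ⁻¹ᵁ U)
  have hO : IsNoetherianRing O := inferInstance
  have hO' : IsNoetherianRing O' := B.isNoetherianRing_stalk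
  let : Algebra k O := (structureMapStalk B.str B.x).toAlgebra
  let : Algebra k O' := (structureMapStalk (B.proj ≫ B.str) B.x').toAlgebra
  let : Algebra k S := (structureMapSections B.str U).toAlgebra
  let : Algebra S O := (B.X.presheaf.germ U B.x hx).hom.toAlgebra
  let : Algebra S S' := (B.proj.app U).hom.toAlgebra
  let : Algebra S' O' := (B.X'.presheaf.germ _ B.x' hx').hom.toAlgebra
  let : Algebra O O' := (B.proj.stalkMap B.x').hom.toAlgebra
  let : Algebra S O' := ((algebraMap S' O').comp (algebraMap S S')).toAlgebra
  let : Algebra k S' := ((algebraMap S S').comp (algebraMap k S)).toAlgebra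
  have : IsScalarTower k S O := isScalarTower_sections_stalk B.str U B.x hx
  have : IsScalarTower k S S' := IsScalarTower.of_algebraMap_eq fun _ => rfl
  have : IsScalarTower S S' O' := IsScalarTower.of_algebraMap_eq fun _ => rfl
  have : IsScalarTower k O O' := IsScalarTower.of_algebraMap_eq fun a =>
    (stalkMap_structureMapStalk B.str B.proj B.x' a).symm
  have : IsScalarTower S O O' := IsScalarTower.of_algebraMap_eq fun a =>
    (Scheme.Hom.germ_stalkMap_apply B.proj U B.x' hx a).symm
  have : IsScalarTower k S' O' := IsScalarTower.of_algebraMap_eq fun a => by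
    rw [IsScalarTower.algebraMap_apply k O O', IsScalarTower.algebraMap_apply k S O,
      IsScalarTower.algebraMap_apply k S S', ← IsScalarTower.algebraMap_apply S O O',
      ← IsScalarTower.algebraMap_apply S S' O']
  have : IsLocalHom (algebraMap O O') :=
    inferInstanceAs (IsLocalHom (B.proj.stalkMap B.x').hom)
  have : Algebra.IsIntegral S S' := ⟨B.proj.isIntegral_app U hU⟩
  have hU' := hU.preimage B.proj
  let p := (hU.primeIdealOf ⟨B.x, hx⟩).asIdeal
  let p' := (hU'.primeIdealOf ⟨B.x', hx'⟩).asIdeal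
  have hpp : p'.under S = p := by
    have := IsAffineOpen.comap_primeIdealOf_appLE U hU _ hU' le_rfl hx'
    rw [Scheme.Hom.appLE_eq_app] at this
    exact congrArg PrimeSpectrum.asIdeal this
  have : IsLocalization.AtPrime O p := hU.isLocalization_stalk ⟨B.x, hx⟩
  have : IsLocalization.AtPrime O' p' := hU'.isLocalization_stalk ⟨B.x', hx'⟩
  -- Closedness of `x` makes both primes maximal, so both residue fields are `k`.
  have hpmax : p.IsMaximal := hU.primeIdealOf_isMaximal_of_isClosed ⟨B.x, hx⟩ B.isClosed_x
  have hpmax' : p'.IsMaximal := Ideal.IsIntegral.isMaximal_of_isMaximal_comap p' (hpp ▸ hpmax)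
  have : (p'.under S).IsPrime := hpp ▸ hpmax.isPrime
  have : IsLocalization.AtPrime O (p'.under S) := by simpa only [hpp]
  have : Algebra.IsStandardSmoothOfRelativeDimension 2 k S := hUs
  have : Algebra.IsStandardSmooth k S :=
    Algebra.IsStandardSmoothOfRelativeDimension.isStandardSmooth 2
  have : Algebra.IsIntegral k (S ⧸ p) := isIntegral_quotient_of_finiteType p
  have : Algebra.IsIntegral k (S ⧸ p'.under S) := by rwa [hpp]
  have : Algebra.IsIntegral k (S' ⧸ p') := isIntegral_quotient_of_under (S := S) p'
  have hres : Function.Bijective (algebraMap k (ResidueField O)) :=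
    bijective_algebraMap_residueField_of_isIntegral (T := S) p
  have hres' : Function.Bijective (algebraMap k (ResidueField O')) :=
    bijective_algebraMap_residueField_of_isIntegral (T := S') p'
  obtain ⟨_, ⟨b⟩⟩ := exists_basis_kaehlerDifferential_stalk_of_relativeDimension B.str hU hx hUs
  obtain ⟨_, n, ⟨b'⟩⟩ := exists_basis_kaehlerDifferential_stalk (B.proj ≫ B.str) hW hxW hWs
  have hdom : IsDomain O' := isDomain_of_basis_kaehlerDifferential b' hres'
  have het : ∀ d : S, B.X.basicOpen d ≤ complementOpen B.incl →
      (B.proj.app (B.X.basicOpen d)).hom.Etale := fun d hd => B.etale_proj_app (hU.basicOpen d) hd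
  -- Smoothness at `x'` comes without a relative dimension; it is compared with that of `X` over the
  -- étale locus, through the fraction field of `O'`.
  obtain rfl : 2 = n := by
    obtain ⟨d, hd, hne⟩ := B.exists_basicOpen_le_complementOpen hU ⟨B.x, hx⟩
    obtain ⟨Sd, S'd, _, _, _, _, _, _, _, _, _, _, _⟩ :=
      exists_localizations_of_etale_app B.proj hU d (het d hd)
    exact eq_of_basis_kaehlerDifferential_of_formallyEtale_away (FractionRing O') (Sd := Sd)
      (S'd := S'd) d p.primeCompl p'.primeCompl (B.germ_app_ne_zero d hne B.x' hx') b b'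
  have : IsDomain B.A := isDomain_adicCompletion_of_basis_kaehlerDifferential b hres
  have : IsDomain B.R := isDomain_adicCompletion_of_basis_kaehlerDifferential b' hres'
  have : IsNoetherianRing B.A :=
    isNoetherianRing_adicCompletion_of_basis_kaehlerDifferential b hres
  have : IsNoetherianRing B.R :=
    isNoetherianRing_adicCompletion_of_basis_kaehlerDifferential b' hres'
  have : IsAdicComplete (maximalIdeal B.A) B.A := inferInstanceAs
    (IsAdicComplete (maximalIdeal (AdicCompletion (maximalIdeal O) O))
      (AdicCompletion (maximalIdeal O) O))
  obtain ⟨xA, yA, hxA, hyxA, -, hymA⟩ := exists_prime_and_notMem_adicCompletion b hres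
  obtain ⟨x, y, hx1, hyx, hxm, hym⟩ := exists_prime_and_notMem_adicCompletion b' hres'
  have hdim : ringKrullDim B.A = 2 := le_antisymm (ringKrullDim_adicCompletion_le b hres)
    (two_le_ringKrullDim_of_prime (R := B.A) hxA hyxA hymA)
  have hcomm : ∀ a : O, algebraMap B.A B.R (algebraMap O B.A a) =
      algebraMap O' B.R (algebraMap O O' a) :=
    fun a => completionMap_algebraMap (B.proj.stalkMap B.x').hom a
  have hAO : (maximalIdeal O).map (algebraMap O B.A) ≤ maximalIdeal B.A :=
    (AdicCompletion.maximalIdeal_eq_map (R := O)).ge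
  have hAR : (maximalIdeal B.A).map (algebraMap B.A B.R) ≤ maximalIdeal B.R :=
    map_maximalIdeal_completionMap_le (B.proj.stalkMap B.x').hom
  have happrox : ∀ (N : ℕ) (r : B.R), ∃ a : O', r - algebraMap O' B.R a ∈
      (maximalIdeal O' ^ N).map (algebraMap O' B.R) :=
    AdicCompletion.exists_sub_algebraMap_mem_map_pow
  have hunr : ∀ P : Ideal B.A, P.IsPrime → g ∉ P → ∃ d : S,
      algebraMap O B.A (algebraMap S O d) ∉ P ∧
      ∀ a : S', ∃ n : ℕ, algebraMap S S' d ^ n • KaehlerDifferential.D S S' a = 0 := by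
    -- A prime without `g` maps into `X - D`, so some basic open inside `X - D` contains its image;
    -- over that open the projection is étale.
    intro P hP hgP
    let Q : Spec (.of B.A) := (⟨P, hP⟩ : PrimeSpectrum B.A)
    have hQ : B.fromCompletion Q ∈ complementOpen B.incl :=
      fun hQ => hgP ((B.mem_range_incl_iff hD Q).1 hQ)
    obtain ⟨d, hd, hQd⟩ := hU.exists_basicOpen_le ⟨_, hQ⟩ (B.fromCompletion_mem hx Q)
    exact ⟨d, (B.fromCompletion_mem_basicOpen_iff hU hx d Q).1 hQd,
      exists_pow_smul_D_eq_zero_of_etale_app B.proj hU d (het d hd)⟩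
  have hx1 : Prime (x : B.R) := hx1
  have hyx : (y : B.R) ∉ Ideal.span {(x : B.R)} := hyx
  have hxm : (x : B.R) ∈ maximalIdeal B.R := hxm
  have hym : (y : B.R) ∈ maximalIdeal B.R := hym
  have hg0 := B.equation_ne_zero hD
  exact resolutionStages_le_of_isIntegral (k := k) (S := S) (O := O) (O' := O') (A := B.A)
    (R := B.R) p' hres'.2 hcomm hAO hAR happrox hdim hx1 hyx hxm hym hg hg0 hh hC hC1 hCD hunr
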